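/- **Setting.** Let $N\ge 0$ and $\varepsilon\in(0,1)$. For $1\le i\le N$ let a reference filament be given by a centerline $\gamma_i:[0,L_i]\to\mathbb R^3$ (smooth, parametrized by arc length, without self-intersections, not a straight line, centered: $\int_{\gamma_i([0,L_i])}x\,d\mathcal H^1=0$), a smooth frame $R_i:[0,L_i]\to SO(3)$ with $R_ie_3=\gamma_i'$, and a smooth shape map $\Psi_i:[0,L_i]\times\overline{B_1(0)}\to\mathbb R^2$ with $\Psi_i(s,0)=0$ and $\Psi_i(s,\cdot)$ a diffeomorphism onto its image; for a closed filament $[0,L_i]$ is replaced by $\mathbb R/L_i\mathbb Z$. Put $$\bar{\mathcal S}_i=\{\gamma_i(s)+\varepsilon R_i(s)(\Psi_i(s,y),0): s\in[0,L_i],\ |y|<1\}$$ and assume that $\varepsilon$ is so small that the parametrization $(s,y)\mapsto\gamma_i(s)+\varepsilon R_i(s)(\Psi_i(s,y),0)$ is an embedding up to the boundary (for $|y|\le1$). Let $\rho_i>0$ be the constant density of the $i$-th filament, $\bar h_i$ its center of mass, $\varepsilon^2m_i$ its mass and $\varepsilon^2\mathcal J_{0,i}$ its inertia matrix about $\bar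 h_i$. On a time interval $[0,T)$ let $h_i(t)\in\mathbb R^3$, $Q_i(t)\in SO(3)$ be differentiable with $h_i'=\mathrm v_i$, $Q_i'=(\omega_i\wedge\cdot)Q_i$, and set $\mathcal S_i(t)=h_i(t)+Q_i(t)(\bar{\mathcal S}_i-\bar h_i)$, $\mathcal J_i=Q_i\mathcal J_{0,i}Q_i^T$. Let $\mathcal F(t)=\mathbb R^3\setminus\bigcup_i\overline{\mathcal S_i(t)}$, let $n$ be the unit normal on $\bigcup_i\partial\mathcal S_i(t)$ pointing outside $\mathcal F(t)$ (that is, into the filaments), and let $\Sigma(u,p)=2D(u)-p\,\mathrm{Id}$, $D(u)=\frac12(\nabla u+\nabla u^T)$. Let $(u^\flat,p^\flat)\in C([0,\infty);\dot H^1(\mathbb R^3)\times L^2(\mathbb R^3))\cap\big(W^{2,\infty}\times W^{1,\infty}\big)((0,\infty)\times\mathbb R^3)$ with $\operatorname{div}u^\flat=0$ be the background flow, and for each $t$ let $(u^{\mathfrak p},p^{\mathfrak p})\in\dot H^1(\mathbb R^3)\times L^2(\mathcal F)$ solve $$-\Delta u^{\mathfrak p}+\nabla p^{\mathfrak p}=0,\quad\operatorname{div}u^{\mathfrak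 p}=0\ \text{ in }\mathcal F(t),\qquad u^{\mathfrak p}=\mathrm v_i+\omega_i\wedge(x-h_i)-u^\flat\ \text{ in }\mathcal S_i(t).$$ Set $u=u^\flat+u^{\mathfrak p}$, $p=p^\flat+p^{\mathfrak p}$. The Newton equations are, for $1\le i\le N$, $$\varepsilon^2m_i\mathrm v_i'=-\int_{\partial\mathcal S_i}\Sigma(u,p)n\,d\mathcal H^2,\qquad \varepsilon^2(\mathcal J_i\omega_i)'=-\int_{\partial\mathcal S_i}(x-h_i)\wedge\Sigma(u,p)n\,d\mathcal H^2 .\tag{N}$$ Let $v_{i,\alpha}(x)=e_\alpha$ for $\alpha=1,2,3$ and $v_{i,\alpha}(x)=e_{\alpha-3}\wedge(x-h_i)$ for $\alpha=4,5,6$, and let $(V_{i,\alpha},P_{i,\alpha})\in\dot H^1(\mathbb R^3)\times L^2(\mathcal F)$ solve the steady Stokes system in $\mathcal F(t)$ with $V_{i,\alpha}=\delta_{ij}v_{i,\alpha}$ in $\mathcal S_j(t)$. Define the $6N\times6N$ matrices and vectors of $\mathbb R^{6N}$ $$\mathcal K_{i,\alpha,j,\beta}=\int_{\partial\mathcal S_j}(\Sigma(V_{i,\alpha},P_{i,\alpha})n)\cdot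 v_{j,\beta}\,d\mathcal H^2,\qquad \mathfrak f^\flat_{i,\alpha}=\int_{\bigcup_j\partial\mathcal S_j}(\Sigma(V_{i,\alpha},P_{i,\alpha})n)\cdot u^\flat\,d\mathcal H^2,$$ $$\mathrm Y=(\mathrm v_i,\omega_i)_i,\qquad \mathrm Y^\flat=\mathcal K^{-1}\mathfrak f^\flat,\qquad \mathcal M=\operatorname{diag}(m_i\mathrm{Id}_3,\mathcal J_i)_i,$$ $$\mathfrak f^a=(F^a_i,T^a_i)_i,\qquad F^a_i=-\int_{\partial\mathcal S_i}\Sigma(u^\flat,p^\flat)n\,d\mathcal H^2,\qquad T^a_i=-\int_{\partial\mathcal S_i}(x-h_i)\wedge\Sigma(u^\flat,p^\flat)n\,d\mathcal H^2 .$$ Here, for the flows $(u,p)$ and $(V_{i,\alpha},P_{i,\alpha})$, the traction $\Sigma n$ is the normal trace on $\bigcup_i\partial\mathcal S_i$ from $\mathcal F$, characterized by Green's formula and assumed to be an integrable function. **Statement.** Suppose that the filaments are separated on $[0,T)$, i.e. the sets $\overline{\mathcal S_i(t)}$ are pairwise disjoint for every $t\in[0,T)$. Then, at every $t\in[0,T)$,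 the matrix $\mathcal K$ is invertible, and the Newton equations (N) hold if and only if the compressed equation $$\varepsilon^2\frac{d}{dt}(\mathcal M\mathrm Y)=-\mathcal K(\mathrm Y-\mathrm Y^\flat)+\mathfrak f^a$$ holds (derivatives being part of the assertion on either side, one-sided at $t=0$). -/

import Mathlib

open MeasureTheory Set Filter Topology
open scoped ContDiff Matrix NNReal

noncomputable section

namespace Filaments

/-! ## Linear algebra in three dimensions -/

/-- Physical space with its Euclidean norm. -/
abbrev R3 := EuclideanSpace ℝ (Fin 3)

/-- The plane containing the cross-section shapes. -/
abbrev R2 := EuclideanSpace ℝ (Fin 2)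

/-- Real `3 × 3` matrices. -/
abbrev Mat3 := Matrix (Fin 3) (Fin 3) ℝ

/-- The six degrees of freedom of one rigid body: `Sum.inl a` is the translation along the `a`-th
axis, `Sum.inr a` the rotation about it. -/
abbrev Dof := Fin 3 ⊕ Fin 3

/-- The `a`-th vector of the canonical basis. -/
def basisVec (a : Fin 3) : R3 := EuclideanSpace.single a 1

/-- The wedge (cross) product. -/
def cross (a b : R3) : R3 := WithLp.toLp 2 (crossProduct (WithLp.ofLp a) (WithLp.ofLp b))

/-- The matrix `(w ∧ ·)`. -/
def skew (w : R3) : Mat3 := LinearMap.toMatrix' (crossProduct (WithLp.ofLp w))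

/-- The matrix-vector product. -/
def act (A : Mat3) (x : R3) : R3 := WithLp.toLp 2 (A *ᵥ WithLp.ofLp x)

/-- The embedding `y ↦ (y, 0)` of the plane. -/
def inPlane (y : R2) : R3 := !₂[y 0, y 1, 0]

/-! ## Reference filaments -/

/-- A reference filament: centerline `γ` parametrized by arc length, frame `R` and cross-section
shape `Ψ`. Only the values for `s ∈ [0, L]` and `y` in the closed unit disc matter; a map that is
smooth on these closed sets is recorded through a smooth extension. -/
structure Filament where
  /-- Whether the filament is closed (a loop). -/
  IsLoop : Prop
  /-- The length of the centerline. -/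
  L : ℝ
  /-- The centerline. -/
  γ : ℝ → R3
  /-- The frame, which maps the third axis to the tangent vector. -/
  R : ℝ → Mat3
  /-- The shape of the cross sections. -/
  Ψ : ℝ → R2 → R2
  L_pos : 0 < L
  γ_smooth : ContDiff ℝ ∞ γ
  R_smooth : ∀ a b, ContDiff ℝ ∞ (fun s => R s a b)
  Ψ_smooth : ContDiff ℝ ∞ (fun z : ℝ × R2 => Ψ z.1 z.2)
  arclength : ∀ s ∈ Icc 0 L, ‖deriv γ s‖ = 1
  R_mem : ∀ s ∈ Icc 0 L, R s ∈ Matrix.specialOrthogonalGroup (Fin 3) ℝ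
  R_tangent : ∀ s ∈ Icc 0 L, act (R s) (basisVec 2) = deriv γ s
  Ψ_zero : ∀ s ∈ Icc 0 L, Ψ s 0 = 0
  Ψ_inj : ∀ s ∈ Icc 0 L, InjOn (Ψ s) (Metric.closedBall 0 1)
  Ψ_immersion : ∀ s ∈ Icc 0 L, ∀ y ∈ Metric.closedBall (0 : R2) 1,
    Function.Bijective (fderiv ℝ (Ψ s) y)
  /-- No self-intersection, non-closed case. -/
  γ_inj : ¬ IsLoop → InjOn γ (Icc 0 L)
  /-- No self-intersection, closed case. -/
  γ_inj_loop : IsLoop → InjOn γ (Ico 0 L)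
  γ_periodic : IsLoop → Function.Periodic γ L
  R_periodic : IsLoop → Function.Periodic R L
  Ψ_periodic : IsLoop → Function.Periodic Ψ L
  /-- The centerline is not a straight line. -/
  not_straight : ∃ s ∈ Icc 0 L, deriv (deriv γ) s ≠ 0
  /-- The centerline is centered at the origin. -/
  centered : ∫ x in γ '' Icc 0 L, x ∂μHE[1] = 0

namespace Filament

variable (f : Filament) (ε : ℝ)

/-- The parametrization of the filament of thickness `ε`. -/
def tube (z : ℝ × R2) : R3 := f.γ z.1 + ε • act (f.R z.1) (inPlane (f.Ψ z.1 z.2))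

/-- The reference filament of thickness `ε`. -/
def refSet : Set R3 := {x | ∃ s ∈ Icc 0 f.L, ∃ y ∈ Metric.ball (0 : R2) 1, x = f.tube ε (s, y)}

/-- The tube of thickness `ε` does not overlap itself: its parametrization is an embedding up to
the boundary (for a loop, modulo the period). True for every sufficiently small `ε > 0`. -/
structure IsEmbedded : Prop where
  inj : ¬ f.IsLoop → InjOn (f.tube ε) (Icc 0 f.L ×ˢ Metric.closedBall (0 : R2) 1)
  inj_loop : f.IsLoop → InjOn (f.tube ε) (Ico 0 f.L ×ˢ Metric.closedBall (0 : R2) 1)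
  immersion : ∀ z ∈ Icc 0 f.L ×ˢ Metric.closedBall (0 : R2) 1,
    Function.Bijective (fderiv ℝ (f.tube ε) z)

/-- The center of mass of the reference filament (its mass density is constant). -/
def center : R3 := ⨍ x in f.refSet ε, x

/-- The filament whose center of mass is `h` and whose orientation is `Q`. -/
def body (h : R3) (Q : Mat3) : Set R3 := (fun x => h + act Q (x - f.center ε)) '' f.refSet ε

/-- The number `m` for which `ε² m` is the mass of the filament of volumetric density `ρ`. -/
def mass (ρ : ℝ) : ℝ := ρ * volume.real (f.refSet ε) / ε ^ 2

/-- The matrix `J₀` for which `ε² J₀` is the inertia matrix, about its center of mass, of the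
reference filament of volumetric density `ρ`. -/
def refInertia (ρ : ℝ) : Mat3 := Matrix.of fun a b =>
  ρ / ε ^ 2 * ∫ x in f.refSet ε,
    (‖x - f.center ε‖ ^ 2 * (1 : Mat3) a b - (x - f.center ε) a * (x - f.center ε) b)

/-- Sylvester's law: the (rescaled) inertia matrix in the orientation `Q`. -/
def inertia (ρ : ℝ) (Q : Mat3) : Mat3 := Q * f.refInertia ε ρ * Qᵀ

end Filament

/-! ## Calculus and function spaces -/

/-- The Jacobian matrix `(∂_b φ_a)_{a b}`. -/
def jac (φ : R3 → R3) (x : R3) : Mat3 := Matrix.of fun a b => fderiv ℝ φ x (basisVec b) a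

/-- The divergence. -/
def div (φ : R3 → R3) (x : R3) : ℝ := (jac φ x).trace

/-- The double contraction `A : B`. -/
def contract (A B : Mat3) : ℝ := ∑ a, ∑ b, A a b * B a b

/-- The deformation tensor `D(u)` computed from the gradient `G` of `u`. -/
def deformation (G : Mat3) : Mat3 := (1 / 2 : ℝ) • (G + Gᵀ)

/-- The stress tensor `Σ(u, p) = 2 D(u) - p Id`, computed from the gradient `G` of `u`. -/
def stress (G : Mat3) (p : ℝ) : Mat3 := (2 : ℝ) • deformation G - p • (1 : Mat3)

/-- `u` belongs to the homogeneous Sobolev space `Ḣ¹(ℝ³)` (the completion of the test functions for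
the norm `‖∇u‖_{L²}`, that is the functions of `L⁶` with weak gradient in `L²`) and `G` is its
weak gradient. -/
structure IsDotH1 (u : R3 → R3) (G : R3 → Mat3) : Prop where
  memL6 : MemLp u 6 volume
  grad_memL2 : ∀ a b, MemLp (fun x => G x a b) 2 volume
  weak_grad : ∀ φ : R3 → ℝ, ContDiff ℝ ∞ φ → HasCompactSupport φ → ∀ a b,
    ∫ x, u x a * fderiv ℝ φ x (basisVec b) = - ∫ x, G x a b * φ x

/-- `W^{1,∞}` on (the closure of) a convex open set: bounded Lipschitz functions. -/
def IsW1Infty {X Y : Type*} [NormedAddCommGroup X] [NormedAddCommGroup Y]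
    (U : Set X) (g : X → Y) : Prop :=
  ∃ C : ℝ≥0, (∀ z ∈ U, ‖g z‖ ≤ C) ∧ LipschitzOnWith C g U

/-- `W^{2,∞}` on (the closure of) a convex open set: bounded Lipschitz functions whose derivative is
bounded and Lipschitz. -/
def IsW2Infty {X Y : Type*} [NormedAddCommGroup X] [NormedSpace ℝ X] [NormedAddCommGroup Y]
    [NormedSpace ℝ Y] (U : Set X) (g : X → Y) : Prop :=
  DifferentiableOn ℝ g U ∧ IsW1Infty U g ∧ IsW1Infty U (fderivWithin ℝ g U)

/-- The background flow: `(u, p) ∈ C([0,∞); Ḣ¹ × L²) ∩ (W^{2,∞} × W^{1,∞})`, `div u = 0`. -/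
structure IsBackgroundFlow (u : ℝ → R3 → R3) (p : ℝ → R3 → ℝ) : Prop where
  vel_W2 : IsW2Infty (Ici (0 : ℝ) ×ˢ (univ : Set R3)) (fun z => u z.1 z.2)
  pres_W1 : IsW1Infty (Ici (0 : ℝ) ×ˢ (univ : Set R3)) (fun z => p z.1 z.2)
  vel_dotH1 : ∀ t, 0 ≤ t → IsDotH1 (u t) (jac (u t))
  pres_L2 : ∀ t, 0 ≤ t → MemLp (p t) 2 volume
  vel_cont : ∀ t, 0 ≤ t → Tendsto
    (fun s => eLpNorm (fun x => fderiv ℝ (u s) x - fderiv ℝ (u t) x) 2 volume) (𝓝[Ici 0] t) (𝓝 0)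
  pres_cont : ∀ t, 0 ≤ t → Tendsto
    (fun s => eLpNorm (fun x => p s x - p t x) 2 volume) (𝓝[Ici 0] t) (𝓝 0)
  div_free : ∀ t, 0 ≤ t → ∀ x, div (u t) x = 0

/-! ## The steady Stokes problem outside the filaments -/

section Stokes

variable {N : ℕ} (S : Fin N → Set R3)

/-- The open set occupied by the fluid. -/
def fluidDomain : Set R3 := (⋃ j, closure (S j))ᶜ

/-- The union of the boundaries of the filaments. -/
def bodyBoundary : Set R3 := ⋃ j, frontier (S j)

/-- `n` is the unit normal on the boundaries of the filaments that points outside the fluid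
domain, in the sense of sets of finite perimeter: it is a unit field for which the Gauss-Green
formula holds. (`μHE[2]` is the two-dimensional Hausdorff measure, normalized to be the area.) -/
structure IsOutwardNormal (n : R3 → R3) : Prop where
  integrable : IntegrableOn n (bodyBoundary S) μHE[2]
  unit : ∀ᵐ x ∂(μHE[2].restrict (bodyBoundary S)), ‖n x‖ = 1
  gauss_green : ∀ φ : R3 → R3, ContDiff ℝ ∞ φ → HasCompactSupport φ →
    ∫ x in fluidDomain S, div φ x = ∫ x in bodyBoundary S, inner ℝ (n x) (φ x) ∂μHE[2]

/-- `τ` is the normal trace `σ n`, from inside the fluid domain, of the tensor field `σ`, with `n`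
pointing outside the fluid domain: `σ` is locally integrable up to the boundary, so is its weak
(row-wise) divergence `g`, and `∫_F (σ : ∇φ + g · φ) = ∫_{∂F} τ · φ` for all test fields `φ`. -/
structure HasNormalTrace (σ : R3 → Mat3) (τ : R3 → R3) : Prop where
  tensor_loc : ∀ a b, LocallyIntegrable ((fluidDomain S).indicator fun x => σ x a b) volume
  integrable : IntegrableOn τ (bodyBoundary S) μHE[2]
  green : ∃ g : R3 → R3, LocallyIntegrable ((fluidDomain S).indicator g) volume ∧
    ∀ φ : R3 → R3, ContDiff ℝ ∞ φ → HasCompactSupport φ →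
      ∫ x in fluidDomain S, (contract (σ x) (jac φ x) + inner ℝ (g x) (φ x)) =
        ∫ x in bodyBoundary S, inner ℝ (τ x) (φ x) ∂μHE[2]

/-- `(u, p) ∈ Ḣ¹(ℝ³) × L²(F)` solves `-Δu + ∇p = 0`, `div u = 0` in the fluid domain (in the sense
of distributions), and `u = d j` in the `j`-th filament; `G` is the weak gradient of `u`. -/
structure IsStokesSolution (d : Fin N → R3 → R3) (u : R3 → R3) (G : R3 → Mat3) (p : R3 → ℝ) :
    Prop where
  dotH1 : IsDotH1 u G
  pressure : MemLp p 2 (volume.restrict (fluidDomain S))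
  momentum : ∀ φ : R3 → R3, ContDiff ℝ ∞ φ → HasCompactSupport φ → tsupport φ ⊆ fluidDomain S →
    ∫ x in fluidDomain S, (contract (G x) (jac φ x) - p x * div φ x) = 0
  incompressible : ∀ᵐ x ∂(volume.restrict (fluidDomain S)), (G x).trace = 0
  boundary : ∀ j, ∀ᵐ x ∂(volume.restrict (S j)), u x = d j x

/-- The elementary rigid velocities with respect to the center `h`. -/
def rigidField (h : R3) : Dof → R3 → R3
  | Sum.inl a => fun _ => basisVec a
  | Sum.inr a => fun x => cross (basisVec a) (x - h)

/-- The Stokes resistance matrix, computed from the tractions `τV i α = Σ(V_{i,α}, P_{i,α}) n`. -/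
def resistance (h : Fin N → R3) (τV : Fin N → Dof → R3 → R3) :
    Matrix (Fin N × Dof) (Fin N × Dof) ℝ :=
  Matrix.of fun k l =>
    ∫ x in frontier (S l.1), inner ℝ (τV k.1 k.2 x) (rigidField (h l.1) l.2 x) ∂μHE[2]

/-- The Faxén forces and torques of the velocity field `u`. -/
def faxenForce (τV : Fin N → Dof → R3 → R3) (u : R3 → R3) : Fin N × Dof → ℝ :=
  fun k => ∫ x in bodyBoundary S, inner ℝ (τV k.1 k.2 x) (u x) ∂μHE[2]

/-- The Faxén velocities `K⁻¹ f`. -/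
def faxenVelocity (h : Fin N → R3) (τV : Fin N → Dof → R3 → R3) (u : R3 → R3) :
    Fin N × Dof → ℝ :=
  (resistance S h τV)⁻¹ *ᵥ faxenForce S τV u

/-- The Archimedes-type forces and torques: those that the stress of the smooth flow `(u, p)`
exerts on the filaments, `n` being the normal that points outside the fluid (into the filaments),
whence the sign. -/
def archimedesForce (h : Fin N → R3) (n : R3 → R3) (u : R3 → R3) (p : R3 → ℝ) :
    Fin N × Dof → ℝ
  | (i, Sum.inl a) =>
      (- ∫ x in frontier (S i), act (stress (jac u x) (p x)) (n x) ∂μHE[2]) a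
  | (i, Sum.inr a) =>
      (- ∫ x in frontier (S i), cross (x - h i) (act (stress (jac u x) (p x)) (n x)) ∂μHE[2]) a

end Stokes

/-! ## The motion of the filaments -/

section Motion

variable {N : ℕ}

/-- The vector of all translation and rotation velocities. -/
def velocityVector (v w : Fin N → R3) : Fin N × Dof → ℝ
  | (i, Sum.inl a) => v i a
  | (i, Sum.inr a) => w i a

/-- The block diagonal matrix with blocks `m i • Id` and `J i`. -/
def inertiaMatrix (m : Fin N → ℝ) (J : Fin N → Mat3) : Matrix (Fin N × Dof) (Fin N × Dof) ℝ :=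
  Matrix.of fun k l =>
    if k.1 = l.1 then
      Matrix.fromBlocks (m k.1 • (1 : Mat3)) (0 : Mat3) (0 : Mat3) (J k.1) k.2 l.2
    else 0

/-- The positions occupied by the filaments at time `t`. -/
def bodies (fil : Fin N → Filament) (ε : ℝ) (h : Fin N → ℝ → R3) (Q : Fin N → ℝ → Mat3) (t : ℝ) :
    Fin N → Set R3 :=
  fun i => (fil i).body ε (h i t) (Q i t)

/-- The kinematics on `[0, T)`: `Q i t` is a rotation, `h' = v` and `Q' = (w ∧ ·) Q`. -/
structure IsRigidMotion (T : ℝ) (h : Fin N → ℝ → R3) (Q : Fin N → ℝ → Mat3)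
    (v w : Fin N → ℝ → R3) : Prop where
  rotation : ∀ i, ∀ t ∈ Ico 0 T, Q i t ∈ Matrix.specialOrthogonalGroup (Fin 3) ℝ
  translation_deriv : ∀ i, ∀ t ∈ Ico 0 T, HasDerivWithinAt (h i) (v i t) (Ico 0 T) t
  rotation_deriv : ∀ i, ∀ t ∈ Ico 0 T, ∀ a b,
    HasDerivWithinAt (fun s => Q i s a b) ((skew (w i t) * Q i t) a b) (Ico 0 T) t

/-- The filaments are separated: their closures (which are compact) are pairwise disjoint. -/
def Separated (S : Fin N → Set R3) : Prop := ∀ i j, i ≠ j → Disjoint (closure (S i)) (closure (S j))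

/-- The Newton equations at time `t`, for the traction `τ = Σ(u, p) n` of the total flow:
`ε² m_i v_i' = -∫_{∂S_i} τ` and `ε² (J_i w_i)' = -∫_{∂S_i} (x - h_i) ∧ τ`. -/
def NewtonAt (fil : Fin N → Filament) (ρ : Fin N → ℝ) (ε T : ℝ) (h : Fin N → ℝ → R3)
    (Q : Fin N → ℝ → Mat3) (v w : Fin N → ℝ → R3) (τ : R3 → R3) (t : ℝ) : Prop :=
  ∀ i,
    (∃ a, HasDerivWithinAt (v i) a (Ico 0 T) t ∧
      (ε ^ 2 * (fil i).mass ε (ρ i)) • a =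
        - ∫ x in frontier (bodies fil ε h Q t i), τ x ∂μHE[2]) ∧
    (∃ b, HasDerivWithinAt (fun s => act ((fil i).inertia ε (ρ i) (Q i s)) (w i s)) b (Ico 0 T) t ∧
      ε ^ 2 • b = - ∫ x in frontier (bodies fil ε h Q t i), cross (x - h i t) (τ x) ∂μHE[2])

/-- The compressed form at time `t`: `ε² d/dt (M Y) = -K (Y - Y♭) + fᵃ`, where `τV` are the
tractions of the elementary Stokes flows and `(u, p)` is the background flow, at time `t`. -/
def CompressedAt (fil : Fin N → Filament) (ρ : Fin N → ℝ) (ε T : ℝ) (h : Fin N → ℝ → R3)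
    (Q : Fin N → ℝ → Mat3) (v w : Fin N → ℝ → R3) (n : R3 → R3) (τV : Fin N → Dof → R3 → R3)
    (u : R3 → R3) (p : R3 → ℝ) (t : ℝ) : Prop :=
  let S := bodies fil ε h Q t
  let hc : Fin N → R3 := fun i => h i t
  let M : ℝ → Matrix (Fin N × Dof) (Fin N × Dof) ℝ := fun s =>
    inertiaMatrix (fun i => (fil i).mass ε (ρ i)) (fun i => (fil i).inertia ε (ρ i) (Q i s))
  let Y : ℝ → Fin N × Dof → ℝ := fun s => velocityVector (fun i => v i s) (fun i => w i s)
  ∃ Z, HasDerivWithinAt (fun s => M s *ᵥ Y s) Z (Ico 0 T) t ∧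
    ε ^ 2 • Z =
      - (resistance S hc τV *ᵥ (Y t - faxenVelocity S hc τV u)) + archimedesForce S hc n u p

end Motion

end Filaments

end

open Filaments

/-!
The matrix equation and the Newton equations are the same system of scalar identities once the
forces are expressed through the elementary Stokes flows `V_k`, `k = (i, α)`. This rests on Green's
formula for the traction `τ` of a divergence free stress `σ ∈ L²(F)` against a field `u ∈ Ḣ¹` whose
values on the filaments are prescribed (`IsTraction.integral_contract`):
`∫_F σ : ∇u = ∑_j ∫_{∂S_j} τ · u`.

* Taking for `σ` the stress of `V_k` and for `u` the flow `V_l` gives `K_{kl} = ∫_F 2 D(V_k) : D(V_l)`.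
  If `K c = 0`, the flow `∑ c_k V_k` therefore dissipates nothing; its deformation tensor vanishes
  in the whole space, so that it is zero in `Ḣ¹` (`IsDotH1.ae_eq_zero_of_deformation`), and so are
  the rigid velocities that it takes on the filaments: `c = 0` (`isUnit_det_resistance`).
* The stress of the perturbation flow tested with `V_k`, and the stress of `V_k` tested with the
  perturbation flow, give the same volume integral. This is the reciprocal theorem, which yields
  Faxén's law `∫_{∂S_i} τᵖ · v_k = (K Y - f♭)_k` (`integral_traction_eq`), where `τᵖ` is the traction
  of the perturbation flow. Since `τᵖ = τ - Σ(u♭, p♭) n` (`IsStokesSolution.isTraction_sub`), the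
  right-hand sides of the two systems agree component by component. The left-hand sides do because
  the masses do not vanish.

The normal traces are defined by smooth test fields only, whereas the fields to be inserted are in
`Ḣ¹`. The difference between `u` and a compactly supported extension of its values on the filaments
vanishes on the filaments, and the point is that it is a limit of test fields supported in the
fluid domain (`IsScalarDotH1.sum_integral_mul_eq_zero`). This is where the geometry enters: every
filament satisfies a uniform interior cone condition (`IsTube.exists_cone`), because it is locally
the diffeomorphic image of a convex set; translating the function along the axis of the cone and
mollifying makes it vanish near the closed filaments. The background flow is only `W^{2,∞}`, so
that its stress is merely Lipschitz; the Gauss-Green formula extends to such fields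
(`IsOutwardNormal.green_of_lipschitz`).
-/

noncomputable section

namespace Filaments

open scoped Convolution

/-! ### Mollification -/

/-- The convolution of a scalar field with a normalized bump function. -/
def mollify (ρ : ContDiffBump (0 : R3)) (f : R3 → ℝ) : R3 → ℝ :=
  f ⋆[ContinuousLinearMap.mul ℝ ℝ, volume] ρ.normed volume

theorem mollify_apply (ρ : ContDiffBump (0 : R3)) (f : R3 → ℝ) (x : R3) :
    mollify ρ f x = ∫ t, f t * ρ.normed volume (x - t) := rfl

theorem mollify_eq_convolution (ρ : ContDiffBump (0 : R3)) (f : R3 → ℝ) :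
    mollify ρ f = ρ.normed volume ⋆[ContinuousLinearMap.lsmul ℝ ℝ, volume] f := by
  rw [mollify, ← convolution_flip]
  congr 1
  ext
  simp

theorem mollify_apply' (ρ : ContDiffBump (0 : R3)) (f : R3 → ℝ) (x : R3) :
    mollify ρ f x = ∫ t, ρ.normed volume t * f (x - t) := by
  rw [mollify_eq_convolution]; rfl

theorem contDiff_mollify (ρ : ContDiffBump (0 : R3)) {f : R3 → ℝ}
    (hf : LocallyIntegrable f volume) : ContDiff ℝ ∞ (mollify ρ f) :=
  ρ.hasCompactSupport_normed.contDiff_convolution_right _ hf (n := ⊤) ρ.contDiff_normed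

/-- `g` is the distributional gradient of the scalar field `w`. -/
def IsWeakGradient (w : R3 → ℝ) (g : Fin 3 → R3 → ℝ) : Prop :=
  ∀ φ : R3 → ℝ, ContDiff ℝ ∞ φ → HasCompactSupport φ → ∀ b,
    ∫ x, w x * fderiv ℝ φ x (basisVec b) = - ∫ x, g b x * φ x

theorem fderiv_mollify (ρ : ContDiffBump (0 : R3)) {w : R3 → ℝ} {g : Fin 3 → R3 → ℝ}
    (hw : LocallyIntegrable w volume) (hg : IsWeakGradient w g) (b : Fin 3) (x : R3) :
    fderiv ℝ (mollify ρ w) x (basisVec b) = mollify ρ (g b) x := by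
  have hρ : ContDiff ℝ ∞ (ρ.normed volume) := ρ.contDiff_normed (n := ⊤)
  have hd : ∀ y, HasFDerivAt (ρ.normed volume) (fderiv ℝ (ρ.normed volume) y) y := fun y =>
    (hρ.differentiable (by simp) y).hasFDerivAt
  have h1 := ρ.hasCompactSupport_normed.hasFDerivAt_convolution_right
    (ContinuousLinearMap.mul ℝ ℝ) hw (hρ.of_le (by simp)) x (μ := volume)
  have h2 : HasCompactSupport (fun t => ρ.normed volume (x - t)) :=
    (ρ.hasCompactSupport_normed (μ := volume)).comp_homeomorph (Homeomorph.subLeft x)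
  have h3 := hg (fun t => ρ.normed volume (x - t)) (hρ.comp (contDiff_const.sub contDiff_id)) h2 b
  have h4 : ∀ t, fderiv ℝ (fun t => ρ.normed volume (x - t)) t (basisVec b) =
      - fderiv ℝ (ρ.normed volume) (x - t) (basisVec b) := by
    intro t
    have := (hd (x - t)).comp t ((hasFDerivAt_id t).const_sub x)
    have h5 := this.fderiv
    simp only [Function.comp_def] at h5
    rw [h5]; simp
  simp only [h4, mul_neg, integral_neg, neg_inj] at h3
  rw [mollify, h1.fderiv, convolution_precompR_apply (hcg := ρ.hasCompactSupport_normed.fderiv ℝ)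
    (hf := hw) (hg := hρ.continuous_fderiv (by simp)), mollify_apply, ← h3]
  rfl

theorem abs_mollify_sub_le (ρ : ContDiffBump (0 : R3)) {f : R3 → ℝ}
    (hf : AEStronglyMeasurable f volume) {x : R3} {ε : ℝ}
    (h : ∀ y ∈ Metric.ball x ρ.rOut, |f y - f x| ≤ ε) : |mollify ρ f x - f x| ≤ ε := by
  have := ρ.dist_normed_convolution_le hf (x₀ := x) (ε := ε) (μ := volume)
    (by simpa [Real.dist_eq] using h)
  rwa [← mollify_eq_convolution, Real.dist_eq] at this

theorem mollify_eq_zero (ρ : ContDiffBump (0 : R3)) {f : R3 → ℝ} {x : R3}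
    (h : ∀ᵐ y, y ∈ Metric.ball x ρ.rOut → f y = 0) : mollify ρ f x = 0 := by
  rw [mollify_apply]
  refine integral_eq_zero_of_ae ?_
  filter_upwards [h] with y hy
  by_cases hyx : y ∈ Metric.ball x ρ.rOut
  · simp [hy hyx]
  · have : ρ.normed volume (x - y) = 0 := by
      rw [← Function.notMem_support, ρ.support_normed_eq]
      rwa [mem_ball_zero_iff, ← dist_eq_norm, dist_comm]
    simp [this]

/-- A bump function supported in the closed ball of radius `r`. -/
def bumpOfRadius (r : ℝ) (hr : 0 < r) : ContDiffBump (0 : R3) := ⟨r / 2, r, by linarith, by linarith⟩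

/-- A sequence of bump functions whose supports shrink to the origin. -/
def bumpSeq (k : ℕ) : ContDiffBump (0 : R3) := bumpOfRadius (1 / ((k : ℝ) + 1)) (by positivity)

theorem tendsto_rOut_bumpSeq : Tendsto (fun k => (bumpSeq k).rOut) atTop (𝓝 0) :=
  tendsto_one_div_add_atTop_nhds_zero_nat

/-- The mollifications of a uniformly continuous function converge uniformly. -/
theorem eventually_abs_mollify_sub_le {f : R3 → ℝ} (hf : UniformContinuous f) {ε : ℝ}
    (hε : 0 < ε) : ∀ᶠ k in atTop, ∀ x, |mollify (bumpSeq k) f x - f x| ≤ ε := by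
  obtain ⟨δ, hδ, h⟩ := Metric.uniformContinuous_iff.1 hf ε hε
  filter_upwards [tendsto_rOut_bumpSeq.eventually (gt_mem_nhds hδ)] with k hk x
  refine abs_mollify_sub_le _ hf.continuous.aestronglyMeasurable fun y hy => ?_
  have := h (lt_trans (Metric.mem_ball.1 hy) hk)
  rw [Real.dist_eq] at this
  exact this.le

/-- The weak gradient of a continuously differentiable function is its classical gradient. -/
theorem isWeakGradient_of_contDiff {φ : R3 → ℝ} (hφ : ContDiff ℝ 1 φ) :
    IsWeakGradient φ (fun b x => fderiv ℝ φ x (basisVec b)) := by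
  intro χ hχ hχc b
  have c1 : Continuous fun x => fderiv ℝ φ x (basisVec b) :=
    (hφ.continuous_fderiv (by simp)).clm_apply continuous_const
  have c2 : Continuous fun x => fderiv ℝ χ x (basisVec b) :=
    (hχ.continuous_fderiv (by simp)).clm_apply continuous_const
  refine integral_mul_fderiv_eq_neg_fderiv_mul_of_integrable ?_ ?_ ?_ ?_ ?_
  · exact (c1.mul hχ.continuous).integrable_of_hasCompactSupport hχc.mul_left
  · exact (hφ.continuous.mul c2).integrable_of_hasCompactSupport
      (hχc.fderiv_apply ℝ (basisVec b)).mul_left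
  · exact (hφ.continuous.mul hχ.continuous).integrable_of_hasCompactSupport hχc.mul_left
  · exact fun x _ => hφ.differentiable (by simp) x
  · exact fun x _ => hχ.differentiable (by simp) x

/-- A function of `L^p`, `p < ∞`, whose weak gradient vanishes is zero: it is constant since its
mollifications are. -/
theorem ae_eq_zero_of_weakGradient_zero {f : R3 → ℝ} {p : ENNReal} (hp : 1 ≤ p) (hp' : p ≠ ⊤)
    (hf : MemLp f p volume) (h : IsWeakGradient f (fun _ _ => 0)) : f =ᵐ[volume] 0 := by
  have hloc := hf.locallyIntegrable hp
  have hconst : ∀ k x, mollify (bumpSeq k) f x = mollify (bumpSeq k) f 0 := by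
    intro k x
    refine is_const_of_fderiv_eq_zero
      ((contDiff_mollify (bumpSeq k) hloc).differentiable (by simp)) (fun y => ?_) x 0
    refine ContinuousLinearMap.coe_injective ((EuclideanSpace.basisFun (Fin 3) ℝ).toBasis.ext
      fun b => ?_)
    have := fderiv_mollify (bumpSeq k) hloc h b y
    simpa [mollify_apply, basisVec] using this
  have hlim := ContDiffBump.ae_convolution_tendsto_right_of_locallyIntegrable (K := 2)
    tendsto_rOut_bumpSeq (Eventually.of_forall fun k => by simp [bumpSeq, bumpOfRadius]; linarith) hloc
  simp only [← mollify_eq_convolution] at hlim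
  obtain ⟨x₀, hx₀⟩ := hlim.exists
  have hae : f =ᵐ[volume] fun _ => f x₀ := by
    filter_upwards [hlim] with x hx
    refine tendsto_nhds_unique hx (hx₀.congr fun k => ?_)
    rw [hconst k x, hconst k x₀]
  have hmem := (memLp_congr_ae hae).1 hf
  rw [memLp_const_iff (by positivity) hp'] at hmem
  rcases hmem with h0 | h0
  · filter_upwards [hae] with x hx
    simp [hx, h0]
  · simp at h0

/-! ### Continuity of translations in `L²` -/

theorem continuous_integral_mul_translate {f g : R3 → ℝ} (hf : MemLp f 2 volume)
    (hg : MemLp g 2 volume) : Continuous fun z => ∫ x, f x * g (x + z) := by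
  have h1 : Continuous fun z : R3 =>
      (inner ℝ (hf.toLp f) ((DomAddAct.mk z : R3ᵈᵃᵃ) +ᵥ hg.toLp g : Lp ℝ 2 (volume : Measure R3)) : ℝ) := by
    have : Fact ((2 : ENNReal) ≠ ⊤) := ⟨by simp⟩
    refine continuous_const.inner ?_
    exact (DomAddAct.continuous_mk).vadd continuous_const
  convert h1 using 2 with z
  rw [L2.inner_def]
  refine integral_congr_ae ?_
  have h2 := (measurePreserving_add_right (volume : Measure R3) z).quasiMeasurePreserving.ae_eq_comp
    hg.coeFn_toLp
  filter_upwards [hf.coeFn_toLp, DomAddAct.vadd_Lp_ae_eq (DomAddAct.mk z) (hg.toLp g), h2]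
    with x hx1 hx2 hx3
  simp only [Function.comp_def] at hx3
  rw [hx1, hx2]
  simp only [Equiv.symm_apply_apply, vadd_eq_add, add_comm z x, hx3]
  simp [mul_comm]

open scoped Manifold

theorem integral_mul_mollify_translate (ρ : ContDiffBump (0 : R3)) {s g : R3 → ℝ}
    (hs : MemLp s 2 volume) (hg : MemLp g 2 volume) (a : R3) :
    ∫ x, s x * mollify ρ g (x + a) = mollify ρ (fun z => ∫ x, s x * g (x + z)) a := by
  have hρ : Continuous (ρ.normed volume) := (ρ.contDiff_normed (n := ⊤)).continuous
  have hga : AEStronglyMeasurable (fun y => g (y + a)) volume :=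
    hg.1.comp_quasiMeasurePreserving
      (measurePreserving_add_right (volume : Measure R3) a).quasiMeasurePreserving
  have hmeas : AEStronglyMeasurable
      (fun p : R3 × R3 => s p.1 * (ρ.normed volume p.2 * g (p.1 + a - p.2)))
      (volume.prod volume) := by
    have h := AEStronglyMeasurable.convolution_integrand (ContinuousLinearMap.mul ℝ ℝ)
      (μ := (volume : Measure R3)) (ν := (volume : Measure R3)) hρ.aestronglyMeasurable hga
    refine (hs.1.comp_fst.mul h).congr (Eventually.of_forall fun p => ?_)
    simp [sub_add_eq_add_sub]
  have hint : Integrable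
      (fun p : R3 × R3 => s p.1 * (ρ.normed volume p.2 * g (p.1 + a - p.2)))
      (volume.prod volume) := by
    rw [integrable_prod_iff' hmeas]
    refine ⟨Eventually.of_forall fun t => ?_, ?_⟩
    · have h1 : MemLp (fun x => g (x + (a - t))) 2 volume :=
        hg.comp_measurePreserving (measurePreserving_add_right volume (a - t))
      refine ((hs.integrable_mul h1).const_mul (ρ.normed volume t)).congr
        (Eventually.of_forall fun x => ?_)
      simp only [Pi.mul_apply, add_sub_assoc]
      ring
    · have h1 : Continuous fun t => ρ.normed volume t * ∫ x, |s x| * |g (x + (a - t))| :=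
        hρ.mul ((continuous_integral_mul_translate hs.abs hg.abs).comp
          (continuous_const.sub continuous_id))
      refine (h1.integrable_of_hasCompactSupport
        (ρ.hasCompactSupport_normed (μ := volume)).mul_right).congr
        (Eventually.of_forall fun t => ?_)
      dsimp only
      rw [← integral_const_mul]
      refine integral_congr_ae (Eventually.of_forall fun x => ?_)
      simp only [Real.norm_eq_abs, abs_mul, abs_of_nonneg (ρ.nonneg_normed t), add_sub_assoc]
      ring
  have hswap := integral_integral_swap (f := fun x t =>
    s x * (ρ.normed volume t * g (x + a - t))) hint
  simp only [mollify_apply', ← integral_const_mul]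
  rw [hswap]
  refine integral_congr_ae (Eventually.of_forall fun t => ?_)
  refine integral_congr_ae (Eventually.of_forall fun x => ?_)
  simp only [add_sub_assoc]
  ring

/-! ### Approximation of Sobolev functions that vanish on a set with the cone property -/

/-- `A` satisfies a uniform interior cone condition near the points of `C`: locally, the balls of
radius `δ c` around the points of `C` translated by `δ ξ` are contained in `A`. -/
def HasLocalCone (A C : Set R3) : Prop :=
  ∀ x₀ : R3, ∃ U : Set R3, IsOpen U ∧ x₀ ∈ U ∧ ∃ (ξ : R3) (c δ₀ : ℝ), 0 < c ∧ 0 < δ₀ ∧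
    ∀ x ∈ U ∩ C, ∀ δ ∈ Ioo 0 δ₀, Metric.ball (x + δ • ξ) (δ * c) ⊆ A

/-- A weak gradient `g` is orthogonal to every field `s` that is divergence free outside `C`, if it
comes from a function `w` that vanishes on `A` and is supported where the cone condition holds with
a fixed axis: the translates along the axis, mollified, vanish near `C`. -/
theorem sum_integral_mul_weakGradient_eq_zero_of_cone {A C U K : Set R3} {ξ : R3} {c δ₀ : ℝ}
    {w : R3 → ℝ} {s g : Fin 3 → R3 → ℝ}
    (hU : IsOpen U) (hK : IsCompact K) (hKU : K ⊆ U) (hc : 0 < c) (hδ₀ : 0 < δ₀)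
    (hcone : ∀ x ∈ U ∩ C, ∀ δ ∈ Ioo 0 δ₀, Metric.ball (x + δ • ξ) (δ * c) ⊆ A)
    (hs : ∀ b, MemLp (s b) 2 volume)
    (hdiv : ∀ φ : R3 → ℝ, ContDiff ℝ ∞ φ → HasCompactSupport φ → tsupport φ ⊆ Cᶜ →
      ∑ b, ∫ x, s b x * fderiv ℝ φ x (basisVec b) = 0)
    (hw : LocallyIntegrable w volume) (hg : ∀ b, MemLp (g b) 2 volume) (hwg : IsWeakGradient w g)
    (hwK : ∀ᵐ x, x ∉ K → w x = 0) (hwA : ∀ᵐ x, x ∈ A → w x = 0) :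
    ∑ b, ∫ x, s b x * g b x = 0 := by
  obtain ⟨r, hr, hrU⟩ := hK.exists_thickening_subset_open hU hKU
  set Φ : R3 → ℝ := fun z => ∑ b, ∫ x, s b x * g b (x + z) with hΦ
  have hΦc : Continuous Φ :=
    continuous_finsetSum _ fun b _ => continuous_integral_mul_translate (hs b) (hg b)
  -- the test function `x ↦ mollify ρ w (x + δ ξ)` vanishes near `C`
  have key : ∀ δ (hδ : 0 < δ), δ < δ₀ → δ * (‖ξ‖ + c) < r →
      mollify (bumpOfRadius (δ * c / 2) (by positivity)) Φ (δ • ξ) = 0 := by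
    intro δ hδ hδ' hδr
    set ρ := bumpOfRadius (δ * c / 2) (by positivity) with hρ
    have hout : ρ.rOut = δ * c / 2 := rfl
    set φ : R3 → ℝ := fun x => mollify ρ w (x + δ • ξ) with hφ
    have hsmooth : ContDiff ℝ ∞ φ := (contDiff_mollify ρ hw).comp (contDiff_id.add contDiff_const)
    have hnear : ∀ x, x ∉ Metric.thickening r K → φ x = 0 := by
      intro x hx
      refine mollify_eq_zero ρ ?_
      filter_upwards [hwK] with y hy hyx
      refine hy fun hyK => hx (Metric.mem_thickening_iff.2 ⟨y, hyK, ?_⟩)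
      rw [Metric.mem_ball, hout] at hyx
      calc dist x y ≤ dist x (x + δ • ξ) + dist (x + δ • ξ) y := dist_triangle _ _ _
        _ < δ * ‖ξ‖ + δ * c := by
          rw [dist_self_add_right, norm_smul, Real.norm_of_nonneg hδ.le, dist_comm (x + δ • ξ)]
          nlinarith [mul_pos hδ hc]
        _ < r := by linarith
    have hcpt : HasCompactSupport φ := by
      refine HasCompactSupport.intro (hK.cthickening (r := r)) fun x hx => hnear x fun h => ?_
      exact hx (Metric.thickening_subset_cthickening _ _ h)
    have hzero : ∀ x ∈ Metric.thickening (δ * c / 2) C, φ x = 0 := by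
      intro x hx
      obtain ⟨z, hzC, hz⟩ := Metric.mem_thickening_iff.1 hx
      by_cases hxU : z ∈ U
      · refine mollify_eq_zero ρ ?_
        filter_upwards [hwA] with y hy hyx
        refine hy (hcone z ⟨hxU, hzC⟩ δ ⟨hδ, hδ'⟩ ?_)
        rw [Metric.mem_ball] at hyx ⊢
        calc dist y (z + δ • ξ) ≤ dist y (x + δ • ξ) + dist (x + δ • ξ) (z + δ • ξ) :=
              dist_triangle _ _ _
          _ < δ * c := by rw [dist_add_right]; rw [hout] at hyx; linarith
      · refine mollify_eq_zero ρ ?_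
        filter_upwards [hwK] with y hy hyx
        refine hy fun hyK => hxU (hrU (Metric.mem_thickening_iff.2 ⟨y, hyK, ?_⟩))
        rw [Metric.mem_ball, hout] at hyx
        calc dist z y ≤ dist z x + dist x (x + δ • ξ) + dist (x + δ • ξ) y :=
              dist_triangle4 _ _ _ _
          _ < δ * ‖ξ‖ + δ * c := by
            rw [dist_self_add_right, norm_smul, Real.norm_of_nonneg hδ.le, dist_comm (x + δ • ξ),
              dist_comm z x]
            linarith
          _ < r := by linarith
    have hsupp : tsupport φ ⊆ Cᶜ := by
      have h1 : tsupport φ ⊆ (Metric.thickening (δ * c / 2) C)ᶜ :=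
        closure_minimal (fun x hx hx' => hx (hzero x hx')) Metric.isOpen_thickening.isClosed_compl
      exact h1.trans (compl_subset_compl.2 (Metric.self_subset_thickening (by positivity) C))
    have h0 := hdiv φ hsmooth hcpt hsupp
    have hd : ∀ b x, fderiv ℝ φ x (basisVec b) = mollify ρ (g b) (x + δ • ξ) := by
      intro b x
      rw [← fderiv_mollify ρ hw hwg, hφ, fderiv_comp_add_right]
    simp only [hd, integral_mul_mollify_translate ρ (hs _) (hg _)] at h0
    rw [← h0, hΦ, mollify_apply']
    simp only [mollify_apply', Finset.mul_sum]
    rw [integral_finsetSum]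
    intro b _
    have hcb := continuous_integral_mul_translate (hs b) (hg b)
    exact (((ρ.contDiff_normed (n := ⊤)).continuous).mul
      (hcb.comp (continuous_const.sub continuous_id))).integrable_of_hasCompactSupport
        (ρ.hasCompactSupport_normed (μ := volume)).mul_right
  have hΦ0 : Φ 0 = 0 := by
    by_contra hne
    have hpos : 0 < |Φ 0| := abs_pos.2 hne
    obtain ⟨η, hη, hηΦ⟩ := Metric.continuous_iff.1 hΦc 0 (|Φ 0| / 4) (by positivity)
    have hb : 0 < ‖ξ‖ + c := by positivity
    obtain ⟨δ, hδ, hδ1⟩ : ∃ δ : ℝ, 0 < δ ∧ δ < min δ₀ (min (r / (‖ξ‖ + c)) (η / (‖ξ‖ + c))) :=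
      exists_between (by positivity)
    rw [lt_min_iff, lt_min_iff, lt_div_iff₀ hb, lt_div_iff₀ hb] at hδ1
    have hk := key δ hδ hδ1.1 hδ1.2.1
    have hnorm : ‖δ • ξ‖ = δ * ‖ξ‖ := by rw [norm_smul, Real.norm_of_nonneg hδ.le]
    have hδc : 0 < δ * c := by positivity
    have h1 : |Φ (δ • ξ) - Φ 0| ≤ |Φ 0| / 4 := by
      have := hηΦ (δ • ξ) (by rw [dist_zero_right, hnorm]; nlinarith [hδ1.2.2])
      rw [Real.dist_eq] at this
      exact this.le
    have h2 := abs_mollify_sub_le (bumpOfRadius (δ * c / 2) (by positivity))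
      hΦc.aestronglyMeasurable (x := δ • ξ) (ε := |Φ 0| / 2) (fun y hy => by
        have hy' : dist y (δ • ξ) < δ * c / 2 := hy
        have h3 := hηΦ y (by
          rw [dist_zero_right]
          have := norm_le_norm_add_norm_sub' y (δ • ξ)
          rw [← dist_eq_norm] at this
          nlinarith [hδ1.2.2])
        rw [Real.dist_eq] at h3
        calc |Φ y - Φ (δ • ξ)| ≤ |Φ y - Φ 0| + |Φ 0 - Φ (δ • ξ)| := abs_sub_le _ _ _
          _ ≤ |Φ 0| / 2 := by rw [abs_sub_comm (Φ 0)]; linarith)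
    rw [hk, zero_sub, abs_neg] at h2
    have h3 : |Φ 0| ≤ |Φ 0 - Φ (δ • ξ)| + |Φ (δ • ξ)| := by
      simpa using abs_sub_le (Φ 0) (Φ (δ • ξ)) 0
    rw [abs_sub_comm] at h3
    linarith
  simpa [hΦ] using hΦ0

/-- `w` belongs to the homogeneous Sobolev space of scalar functions, with weak gradient `g`. -/
structure IsScalarDotH1 (w : R3 → ℝ) (g : Fin 3 → R3 → ℝ) : Prop where
  memL6 : MemLp w 6 volume
  grad_memL2 : ∀ b, MemLp (g b) 2 volume
  weak_grad : IsWeakGradient w g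

theorem IsScalarDotH1.locallyIntegrable {w : R3 → ℝ} {g : Fin 3 → R3 → ℝ}
    (h : IsScalarDotH1 w g) : LocallyIntegrable w volume :=
  h.memL6.locallyIntegrable (by norm_num)

theorem continuous_pderiv {φ : R3 → ℝ} (hφ : ContDiff ℝ 1 φ) (v : R3) :
    Continuous fun x => fderiv ℝ φ x v :=
  (hφ.continuous_fderiv (by simp)).clm_apply continuous_const

/-- A Sobolev function times a test function is a Sobolev function (product rule). -/
theorem IsScalarDotH1.mul_test {w : R3 → ℝ} {g : Fin 3 → R3 → ℝ} (h : IsScalarDotH1 w g)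
    {ψ : R3 → ℝ} (hψ : ContDiff ℝ ∞ ψ) (hψc : HasCompactSupport ψ) :
    IsScalarDotH1 (fun x => ψ x * w x)
      (fun b x => ψ x * g b x + w x * fderiv ℝ ψ x (basisVec b)) := by
  have hψ1 : ContDiff ℝ 1 ψ := hψ.of_le (by simp)
  have hbdd : MemLp ψ ⊤ volume := hψ.continuous.memLp_of_hasCompactSupport hψc
  have hd3 : ∀ b, MemLp (fun x => fderiv ℝ ψ x (basisVec b)) 3 volume := fun b =>
    (continuous_pderiv hψ1 _).memLp_of_hasCompactSupport (hψc.fderiv_apply ℝ _)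
  have htriple : ENNReal.HolderTriple 6 3 2 := ⟨by
    rw [← ENNReal.toReal_eq_toReal_iff' (by simp) (by simp),
      ENNReal.toReal_add (by simp) (by simp)]
    norm_num⟩
  refine ⟨h.memL6.mul hbdd, fun b => ?_, fun φ hφ hφc b => ?_⟩
  · exact ((h.grad_memL2 b).mul hbdd).add ((hd3 b).mul h.memL6)
  · have hφ1 : ContDiff ℝ 1 φ := hφ.of_le (by simp)
    have hprod := h.weak_grad (fun x => ψ x * φ x) (hψ.mul hφ) hφc.mul_left b
    have hd : ∀ x, fderiv ℝ (fun x => ψ x * φ x) x (basisVec b) =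
        ψ x * fderiv ℝ φ x (basisVec b) + φ x * fderiv ℝ ψ x (basisVec b) := by
      intro x
      rw [fderiv_fun_mul (hψ1.differentiable (by simp) x) (hφ1.differentiable (by simp) x)]
      simp
    have hloc := h.locallyIntegrable
    have hgloc := (h.grad_memL2 b).locallyIntegrable (by norm_num)
    have i1 : Integrable (fun x => ψ x * w x * fderiv ℝ φ x (basisVec b)) volume := by
      refine (hloc.integrable_smul_left_of_hasCompactSupport
        (hψ.continuous.mul (continuous_pderiv hφ1 (basisVec b))) hψc.mul_right).congr
        (Eventually.of_forall fun x => ?_)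
      simp only [smul_eq_mul, Pi.mul_apply]; ring
    have i2 : Integrable (fun x => w x * fderiv ℝ ψ x (basisVec b) * φ x) volume := by
      refine (hloc.integrable_smul_left_of_hasCompactSupport
        (hφ.continuous.mul (continuous_pderiv hψ1 (basisVec b))) hφc.mul_right).congr
        (Eventually.of_forall fun x => ?_)
      simp only [smul_eq_mul, Pi.mul_apply]; ring
    have i3 : Integrable (fun x => ψ x * g b x * φ x) volume := by
      refine (hgloc.integrable_smul_left_of_hasCompactSupport
        (hφ.continuous.mul hψ.continuous) hφc.mul_right).congr
        (Eventually.of_forall fun x => ?_)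
      simp only [smul_eq_mul, Pi.mul_apply]; ring
    have e1 : ∫ x, w x * fderiv ℝ (fun x => ψ x * φ x) x (basisVec b) =
        (∫ x, ψ x * w x * fderiv ℝ φ x (basisVec b)) +
          ∫ x, w x * fderiv ℝ ψ x (basisVec b) * φ x := by
      rw [← integral_add i1 i2]
      refine integral_congr_ae (Eventually.of_forall fun x => ?_)
      simp only [hd]; ring
    have e2 : ∫ x, (ψ x * g b x + w x * fderiv ℝ ψ x (basisVec b)) * φ x =
        (∫ x, ψ x * g b x * φ x) + ∫ x, w x * fderiv ℝ ψ x (basisVec b) * φ x := by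
      rw [← integral_add i3 i2]
      refine integral_congr_ae (Eventually.of_forall fun x => ?_)
      simp only; ring
    have e3 : ∫ x, g b x * (ψ x * φ x) = ∫ x, ψ x * g b x * φ x :=
      integral_congr_ae (Eventually.of_forall fun x => by simp only; ring)
    rw [e1, e3] at hprod
    rw [e2]
    linarith

/-- The preceding orthogonality for functions with compact support, by a partition of unity. -/
theorem IsScalarDotH1.sum_integral_mul_eq_zero_of_test {A C : Set R3} (hcone : HasLocalCone A C)
    {w : R3 → ℝ} {s g : Fin 3 → R3 → ℝ} (hs : ∀ b, MemLp (s b) 2 volume)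
    (hdiv : ∀ φ : R3 → ℝ, ContDiff ℝ ∞ φ → HasCompactSupport φ → tsupport φ ⊆ Cᶜ →
      ∑ b, ∫ x, s b x * fderiv ℝ φ x (basisVec b) = 0)
    (h : IsScalarDotH1 w g) (hwA : ∀ᵐ x, x ∈ A → w x = 0)
    {η : R3 → ℝ} (hη : ContDiff ℝ ∞ η) (hηc : HasCompactSupport η) :
    ∑ b, ∫ x, s b x * (η x * g b x + w x * fderiv ℝ η x (basisVec b)) = 0 := by
  choose U hUo hxU ξ c δ₀ hc hδ₀ hball using hcone
  obtain ⟨t, ht⟩ := hηc.isCompact.elim_finite_subcover U hUo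
    (fun x _ => mem_iUnion.2 ⟨x, hxU x⟩)
  obtain ⟨f, hf⟩ := SmoothPartitionOfUnity.exists_isSubordinate 𝓘(ℝ, R3)
    (s := tsupport η) (isClosed_tsupport η) (fun i : t => U i) (fun i => hUo i)
    (by simpa [iUnion_subtype] using ht)
  have hfs : ∀ i, ContDiff ℝ ∞ (f i) := fun i => (f i).contMDiff.contDiff
  have hψ : ∀ i, ContDiff ℝ ∞ (fun x => f i x * η x) := fun i => (hfs i).mul hη
  have hψc : ∀ i, HasCompactSupport (fun x => f i x * η x) := fun i => hηc.mul_left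
  have hloc : ∀ i, ∑ b, ∫ x, s b x * (f i x * η x * g b x +
      w x * fderiv ℝ (fun x => f i x * η x) x (basisVec b)) = 0 := by
    intro i
    have hi := h.mul_test (hψ i) (hψc i)
    refine sum_integral_mul_weakGradient_eq_zero_of_cone (hUo i) (hψc i).isCompact ?_ (hc i) (hδ₀ i)
      (hball i) hs hdiv hi.locallyIntegrable hi.grad_memL2 hi.weak_grad
      (Eventually.of_forall fun x hx => ?_) ?_
    · exact (closure_mono (Function.support_mul_subset_left _ _)).trans (hf i)
    · rw [image_eq_zero_of_notMem_tsupport hx, zero_mul]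
    · filter_upwards [hwA] with x hx hxA
      rw [hx hxA, mul_zero]
  have hsum : ∀ x, ∑ i, f i x * η x = η x := by
    intro x
    by_cases hx : x ∈ tsupport η
    · have := f.sum_eq_one hx
      rw [finsum_eq_sum_of_fintype] at this
      rw [← Finset.sum_mul, this, one_mul]
    · simp [image_eq_zero_of_notMem_tsupport hx]
  have hsumd : ∀ x b, ∑ i, fderiv ℝ (fun x => f i x * η x) x (basisVec b) =
      fderiv ℝ η x (basisVec b) := by
    intro x b
    rw [← sum_apply, ← fderiv_fun_sum fun i _ =>
      (hψ i).differentiable (by simp) x]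
    simp only [hsum]
  have hint : ∀ i b, Integrable (fun x => s b x * (f i x * η x * g b x +
      w x * fderiv ℝ (fun x => f i x * η x) x (basisVec b))) volume := fun i b =>
    (hs b).integrable_mul ((h.mul_test (hψ i) (hψc i)).grad_memL2 b)
  calc _ = ∑ b, ∑ i, ∫ x, s b x * (f i x * η x * g b x +
      w x * fderiv ℝ (fun x => f i x * η x) x (basisVec b)) := by
        refine Finset.sum_congr rfl fun b _ => ?_
        rw [← integral_finsetSum _ fun i _ => hint i b]
        refine integral_congr_ae (Eventually.of_forall fun x => ?_)
        simp only
        rw [← Finset.mul_sum, Finset.sum_add_distrib, ← Finset.sum_mul, ← Finset.mul_sum, hsum,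
          hsumd]
    _ = 0 := by
        rw [Finset.sum_comm]
        exact Finset.sum_eq_zero fun i _ => hloc i

/-- A fixed cutoff function, equal to one on the unit ball. -/
def unitCutoff : ContDiffBump (0 : R3) := ⟨1, 2, by norm_num, by norm_num⟩

/-- The cutoff function at scale `k + 1`. -/
def cutoff (k : ℕ) (x : R3) : ℝ := unitCutoff (((k : ℝ) + 1)⁻¹ • x)

theorem contDiff_cutoff (k : ℕ) : ContDiff ℝ ∞ (cutoff k) :=
  (unitCutoff.contDiff (n := ⊤)).comp (contDiff_const_smul _)

theorem hasCompactSupport_cutoff (k : ℕ) : HasCompactSupport (cutoff k) :=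
  unitCutoff.hasCompactSupport.comp_smul (inv_ne_zero (by positivity))

theorem cutoff_eq_one {k : ℕ} {x : R3} (hx : ‖x‖ ≤ k + 1) : cutoff k x = 1 := by
  refine unitCutoff.one_of_mem_closedBall ?_
  have h : (0 : ℝ) < k + 1 := by positivity
  rw [mem_closedBall_zero_iff, norm_smul, norm_inv, Real.norm_of_nonneg h.le]
  change _ ≤ (1 : ℝ)
  rw [inv_mul_le_iff₀ h]
  linarith

theorem fderiv_cutoff (k : ℕ) (x v : R3) : fderiv ℝ (cutoff k) x v =
    ((k : ℝ) + 1)⁻¹ * fderiv ℝ unitCutoff (((k : ℝ) + 1)⁻¹ • x) v := by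
  have h : HasFDerivAt unitCutoff (fderiv ℝ unitCutoff (((k : ℝ) + 1)⁻¹ • x))
      (((k : ℝ) + 1)⁻¹ • x) :=
    ((unitCutoff.contDiff (n := 1)).differentiable (by simp) _).hasFDerivAt
  have h2 := h.comp x ((hasFDerivAt_id x).const_smul ((k : ℝ) + 1)⁻¹)
  have h3 := h2.fderiv
  change fderiv ℝ (cutoff k) x = _ at h3
  rw [h3]; simp

theorem fderiv_cutoff_eq_zero {k : ℕ} {x : R3} (hx : ‖x‖ < k + 1) (v : R3) :
    fderiv ℝ (cutoff k) x v = 0 := by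
  have h : cutoff k =ᶠ[𝓝 x] fun _ => 1 := by
    filter_upwards [(isOpen_lt continuous_norm continuous_const).mem_nhds hx] with y hy
    exact cutoff_eq_one (le_of_lt hy)
  rw [h.fderiv_eq]; simp

/-- The `L³` norm of the gradient of the cutoff functions does not depend on the scale. -/
theorem integral_abs_fderiv_cutoff (k : ℕ) (v : R3) :
    ∫ x, |fderiv ℝ (cutoff k) x v| ^ 3 = ∫ x, |fderiv ℝ unitCutoff x v| ^ 3 := by
  have h : (0 : ℝ) < k + 1 := by positivity
  simp only [fderiv_cutoff, abs_mul, mul_pow]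
  rw [integral_const_mul, Measure.integral_comp_inv_smul volume
    (fun x => |fderiv ℝ unitCutoff x v| ^ 3)]
  simp only [finrank_euclideanSpace, Fintype.card_fin, abs_inv, abs_of_pos h, abs_of_pos (pow_pos h 3),
    smul_eq_mul]
  field_simp

theorem tendsto_integral_indicator_norm_ge {f : R3 → ℝ} (hf : Integrable f volume) :
    Tendsto (fun k : ℕ => ∫ x, {x : R3 | (k : ℝ) + 1 ≤ ‖x‖}.indicator f x) atTop (𝓝 0) := by
  rw [show (0 : ℝ) = ∫ _ : R3, (0 : ℝ) by simp]
  have hm : ∀ k : ℕ, MeasurableSet {x : R3 | (k : ℝ) + 1 ≤ ‖x‖} := fun k =>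
    measurableSet_le measurable_const measurable_norm
  refine tendsto_integral_of_dominated_convergence (fun x => ‖f x‖)
    (fun k => hf.1.indicator (hm k)) hf.norm
    (fun k => Eventually.of_forall fun x => norm_indicator_le_norm_self _ _)
    (Eventually.of_forall fun x => ?_)
  refine tendsto_const_nhds.congr' ?_
  obtain ⟨m, hmx⟩ := exists_nat_gt ‖x‖
  filter_upwards [eventually_ge_atTop m] with k hk
  rw [indicator_of_notMem]
  simp only [mem_ofPred_eq, not_le]
  have : (m : ℝ) ≤ k := by exact_mod_cast hk
  linarith

theorem mul_mul_le_sq_add_pow_add_pow {a b c : ℝ} (hb : 0 ≤ b) (hc : 0 ≤ c) :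
    a * b * c ≤ a ^ 2 + b ^ 6 + c ^ 3 := by
  have h1 : a * (b * c) ≤ a ^ 2 + (b * c) ^ 2 := by
    nlinarith [sq_nonneg (a - b * c), sq_nonneg a, sq_nonneg (b * c)]
  have h2 : (b * c) ^ 2 ≤ b ^ 6 + c ^ 3 := by
    rcases le_total (b ^ 2) c with h | h
    · have : b ^ 2 * c ^ 2 ≤ c * c ^ 2 := by gcongr
      nlinarith [pow_nonneg hb 6]
    · have : b ^ 2 * c ^ 2 ≤ b ^ 2 * (b ^ 2) ^ 2 := by gcongr
      nlinarith [pow_nonneg hc 3]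
  nlinarith

theorem integrable_abs_fderiv_cutoff (k : ℕ) (v : R3) :
    Integrable (fun x => |fderiv ℝ (cutoff k) x v| ^ 3) volume := by
  have hc : Continuous fun x => |fderiv ℝ (cutoff k) x v| ^ 3 :=
    ((continuous_pderiv ((contDiff_cutoff k).of_le (by simp)) v).abs).pow 3
  refine hc.integrable_of_hasCompactSupport ?_
  exact ((hasCompactSupport_cutoff k).fderiv_apply ℝ v).comp_left (g := fun t => |t| ^ 3) (by simp)

theorem norm_integral_mul_mul_fderiv_cutoff_le {s w : R3 → ℝ} {θ : ℝ} (hθ : 0 < θ)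
    (hint : Integrable (fun x => |s x| ^ 2 + θ⁻¹ ^ 6 * |w x| ^ 6) volume) (v : R3) (k : ℕ) :
    ‖∫ x, s x * (w x * fderiv ℝ (cutoff k) x v)‖ ≤
      (∫ x, {x : R3 | (k : ℝ) + 1 ≤ ‖x‖}.indicator
        (fun x => |s x| ^ 2 + θ⁻¹ ^ 6 * |w x| ^ 6) x) +
      θ ^ 3 * ∫ x, |fderiv ℝ unitCutoff x v| ^ 3 := by
  have hset : MeasurableSet {x : R3 | (k : ℝ) + 1 ≤ ‖x‖} :=
    measurableSet_le measurable_const measurable_norm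
  have hd3 := (integrable_abs_fderiv_cutoff k v).const_mul (θ ^ 3)
  rw [← integral_abs_fderiv_cutoff k v, ← integral_const_mul,
    ← integral_add (hint.indicator hset) hd3]
  refine norm_integral_le_of_norm_le ((hint.indicator hset).add hd3)
    (Eventually.of_forall fun x => ?_)
  by_cases hx : (k : ℝ) + 1 ≤ ‖x‖
  · rw [indicator_of_mem (show x ∈ {x : R3 | (k : ℝ) + 1 ≤ ‖x‖} from hx)]
    have h := mul_mul_le_sq_add_pow_add_pow (a := |s x|) (b := θ⁻¹ * |w x|)
      (c := θ * |fderiv ℝ (cutoff k) x v|) (by positivity) (by positivity)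
    rw [mul_pow, mul_pow] at h
    refine le_trans (le_of_eq ?_) h
    rw [Real.norm_eq_abs, abs_mul, abs_mul]
    field_simp
  · rw [fderiv_cutoff_eq_zero (not_le.1 hx), mul_zero, mul_zero, norm_zero]
    rw [indicator_of_notMem (show x ∉ {x : R3 | (k : ℝ) + 1 ≤ ‖x‖} from hx)]
    positivity

/-- The commutator with the cutoff at infinity is negligible for functions of `L⁶`. -/
theorem tendsto_integral_mul_mul_fderiv_cutoff {s w : R3 → ℝ} (hs : MemLp s 2 volume)
    (hw : MemLp w 6 volume) (v : R3) :
    Tendsto (fun k => ∫ x, s x * (w x * fderiv ℝ (cutoff k) x v)) atTop (𝓝 0) := by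
  have hs2 : Integrable (fun x => |s x| ^ 2) volume :=
    hs.integrable_norm_pow (p := 2) (by norm_num)
  have hw6 : Integrable (fun x => |w x| ^ 6) volume :=
    hw.integrable_norm_pow (p := 6) (by norm_num)
  generalize hI : ∫ x, |fderiv ℝ unitCutoff x v| ^ 3 = I
  rw [Metric.tendsto_atTop]
  intro ε hε
  -- the weight `θ` makes the contribution `θ ^ 3 * I` of the cutoff small
  obtain ⟨θ, hθ, hθI⟩ : ∃ θ : ℝ, 0 < θ ∧ θ ^ 3 * I < ε / 2 := by
    have h1 : Tendsto (fun θ : ℝ => θ ^ 3 * I) (𝓝[>] 0) (𝓝 (0 ^ 3 * I)) :=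
      ((continuous_id.pow 3).mul continuous_const).continuousWithinAt
    have h0 : (0 : ℝ) ^ 3 * I < ε / 2 := by
      rw [zero_pow (by norm_num), zero_mul]; exact half_pos hε
    obtain ⟨θ, h3, h4⟩ := ((h1.eventually (gt_mem_nhds h0)).and self_mem_nhdsWithin).exists
    exact ⟨θ, h4, h3⟩
  have hint : Integrable (fun x => |s x| ^ 2 + θ⁻¹ ^ 6 * |w x| ^ 6) volume :=
    hs2.add (hw6.const_mul _)
  obtain ⟨m, hm⟩ := (Metric.tendsto_atTop.1 (tendsto_integral_indicator_norm_ge hint)) (ε / 2)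
    (half_pos hε)
  refine ⟨m, fun k hk => ?_⟩
  have h1 := hm k hk
  have h2 := norm_integral_mul_mul_fderiv_cutoff_le hθ hint v k
  rw [hI] at h2
  rw [dist_zero_right] at h1 ⊢
  have h3 := (le_abs_self _).trans_lt h1
  linarith

theorem tendsto_integral_mul_cutoff {f : R3 → ℝ} (hf : Integrable f volume) :
    Tendsto (fun k => ∫ x, cutoff k x * f x) atTop (𝓝 (∫ x, f x)) := by
  refine tendsto_integral_of_dominated_convergence (fun x => ‖f x‖)
    (fun k => (contDiff_cutoff k).continuous.aestronglyMeasurable.mul hf.1) hf.norm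
    (fun k => Eventually.of_forall fun x => ?_) (Eventually.of_forall fun x => ?_)
  · have h0 : 0 ≤ cutoff k x := unitCutoff.nonneg
    have h1 : cutoff k x ≤ 1 := unitCutoff.le_one
    rw [norm_mul, Real.norm_of_nonneg h0]
    exact mul_le_of_le_one_left (norm_nonneg _) h1
  · refine tendsto_const_nhds.congr' ?_
    obtain ⟨m, hmx⟩ := exists_nat_gt ‖x‖
    filter_upwards [eventually_ge_atTop m] with k hk
    have : (m : ℝ) ≤ k := by exact_mod_cast hk
    rw [cutoff_eq_one (by linarith), one_mul]

/-- **Density.** A Sobolev function that vanishes on `A` is a limit of test functions supported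
outside `C`, whence its gradient is orthogonal to the `L²` fields that are divergence free outside
`C`. -/
theorem IsScalarDotH1.sum_integral_mul_eq_zero {A C : Set R3} (hcone : HasLocalCone A C)
    {w : R3 → ℝ} {s g : Fin 3 → R3 → ℝ} (hs : ∀ b, MemLp (s b) 2 volume)
    (hdiv : ∀ φ : R3 → ℝ, ContDiff ℝ ∞ φ → HasCompactSupport φ → tsupport φ ⊆ Cᶜ →
      ∑ b, ∫ x, s b x * fderiv ℝ φ x (basisVec b) = 0)
    (h : IsScalarDotH1 w g) (hwA : ∀ᵐ x, x ∈ A → w x = 0) :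
    ∑ b, ∫ x, s b x * g b x = 0 := by
  have h1 : ∀ k, ∑ b, ((∫ x, cutoff k x * (s b x * g b x)) +
      ∫ x, s b x * (w x * fderiv ℝ (cutoff k) x (basisVec b))) = 0 := by
    intro k
    rw [← h.sum_integral_mul_eq_zero_of_test hcone hs hdiv hwA (contDiff_cutoff k)
      (hasCompactSupport_cutoff k)]
    refine Finset.sum_congr rfl fun b _ => ?_
    have hbdd : MemLp (cutoff k) ⊤ volume :=
      (contDiff_cutoff k).continuous.memLp_of_hasCompactSupport (hasCompactSupport_cutoff k)
    have i1 : Integrable (fun x => cutoff k x * (s b x * g b x)) volume := by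
      refine ((hs b).integrable_mul ((h.grad_memL2 b).mul (r := 2) hbdd)).congr
        (Eventually.of_forall fun x => ?_)
      simp only [Pi.mul_apply]; ring
    have i2 : Integrable (fun x => s b x * (w x * fderiv ℝ (cutoff k) x (basisVec b))) volume := by
      have i3 := (hs b).integrable_mul
        ((h.mul_test (contDiff_cutoff k) (hasCompactSupport_cutoff k)).grad_memL2 b)
      refine (i3.sub i1).congr (Eventually.of_forall fun x => ?_)
      simp only [Pi.mul_apply, Pi.sub_apply]; ring
    rw [← integral_add i1 i2]
    refine integral_congr_ae (Eventually.of_forall fun x => ?_)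
    simp only; ring
  have h2 : Tendsto (fun k => ∑ b, ((∫ x, cutoff k x * (s b x * g b x)) +
      ∫ x, s b x * (w x * fderiv ℝ (cutoff k) x (basisVec b)))) atTop
      (𝓝 (∑ b, ((∫ x, s b x * g b x) + 0))) :=
    tendsto_finsetSum _ fun b _ =>
      (tendsto_integral_mul_cutoff ((hs b).integrable_mul (h.grad_memL2 b))).add
        (tendsto_integral_mul_mul_fderiv_cutoff (hs b) h.memL6 _)
  simp only [h1, add_zero] at h2
  exact (tendsto_nhds_unique h2 tendsto_const_nhds)

/-! ### Rigidity of fields with vanishing deformation tensor -/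

theorem IsDotH1.component {u : R3 → R3} {G : R3 → Mat3} (h : IsDotH1 u G) (a : Fin 3) :
    IsScalarDotH1 (fun x => u x a) (fun b x => G x a b) where
  memL6 := (EuclideanSpace.proj a : R3 →L[ℝ] ℝ).comp_memLp' h.memL6
  grad_memL2 b := h.grad_memL2 a b
  weak_grad φ hφ hφc b := h.weak_grad φ hφ hφc a b

theorem fderiv_pderiv_comm {φ : R3 → ℝ} (hφ : ContDiff ℝ ∞ φ) (v w x : R3) :
    fderiv ℝ (fun y => fderiv ℝ φ y v) x w = fderiv ℝ (fun y => fderiv ℝ φ y w) x v := by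
  have hd : DifferentiableAt ℝ (fderiv ℝ φ) x :=
    (hφ.fderiv_right (m := ∞) (by simp)).differentiable (by simp) x
  have h1 : ∀ v w, fderiv ℝ (fun y => fderiv ℝ φ y v) x w = fderiv ℝ (fderiv ℝ φ) x w v := by
    intro v w
    rw [fderiv_clm_apply hd (differentiableAt_const v)]
    simp
  rw [h1, h1]
  exact (hφ.contDiffAt (x := x)).isSymmSndFDerivAt
    (by simpa using WithTop.coe_le_coe.2 (le_top : (2 : ℕ∞) ≤ ⊤)) w v

theorem contDiff_pderiv {φ : R3 → ℝ} (hφ : ContDiff ℝ ∞ φ) (v : R3) :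
    ContDiff ℝ ∞ fun x => fderiv ℝ φ x v :=
  (hφ.fderiv_right (m := ∞) (by simp)).clm_apply contDiff_const

/-- The distributional second derivatives commute. -/
theorem IsWeakGradient.integral_pderiv_comm {w : R3 → ℝ} {g : Fin 3 → R3 → ℝ}
    (h : IsWeakGradient w g) {φ : R3 → ℝ} (hφ : ContDiff ℝ ∞ φ) (hφc : HasCompactSupport φ)
    (b c : Fin 3) :
    ∫ x, g b x * fderiv ℝ φ x (basisVec c) = ∫ x, g c x * fderiv ℝ φ x (basisVec b) := by
  have h1 := h _ (contDiff_pderiv hφ (basisVec c)) (hφc.fderiv_apply ℝ _) b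
  have h2 := h _ (contDiff_pderiv hφ (basisVec b)) (hφc.fderiv_apply ℝ _) c
  simp only [fderiv_pderiv_comm hφ (basisVec c) (basisVec b)] at h1
  linarith

/-- A field of `Ḣ¹` whose deformation tensor vanishes is zero: the second derivatives are
combinations of the derivatives of the deformation tensor. -/
theorem IsDotH1.ae_eq_zero_of_deformation {u : R3 → R3} {G : R3 → Mat3} (h : IsDotH1 u G)
    (hG : ∀ᵐ x, ∀ a b, G x a b = - G x b a) : u =ᵐ[volume] 0 := by
  have hG0 : ∀ a b, (fun x => G x a b) =ᵐ[volume] 0 := by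
    intro a b
    refine ae_eq_zero_of_weakGradient_zero (p := 2) (by norm_num) (by simp) (h.grad_memL2 a b) ?_
    intro φ hφ hφc c
    have hsym : ∀ a b c, ∫ x, G x a b * fderiv ℝ φ x (basisVec c) =
        ∫ x, G x a c * fderiv ℝ φ x (basisVec b) := fun a b c =>
      (h.component a).weak_grad.integral_pderiv_comm hφ hφc b c
    have hanti : ∀ a b c, ∫ x, G x a b * fderiv ℝ φ x (basisVec c) =
        - ∫ x, G x b a * fderiv ℝ φ x (basisVec c) := by
      intro a b c
      rw [← integral_neg]
      refine integral_congr_ae ?_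
      filter_upwards [hG] with x hx
      rw [hx a b]; ring
    have := hanti a b c
    have := hsym b a c
    have := hanti b c a
    have := hsym c b a
    have := hanti c a b
    have := hsym a c b
    simp only [zero_mul, integral_zero, neg_zero]
    linarith
  have hu : ∀ a, (fun x => u x a) =ᵐ[volume] 0 := by
    intro a
    refine ae_eq_zero_of_weakGradient_zero (p := 6) (by norm_num) (by simp)
      (h.component a).memL6 ?_
    intro φ hφ hφc b
    rw [h.weak_grad φ hφ hφc a b]
    simp only [zero_mul, integral_zero, neg_inj]
    refine integral_eq_zero_of_ae ?_
    filter_upwards [hG0 a b] with x hx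
    simp only [Pi.zero_apply] at hx
    simp [hx]
  filter_upwards [hu 0, hu 1, hu 2] with x h0 h1 h2
  ext a
  fin_cases a
  · exact h0
  · exact h1
  · exact h2

/-- The weak gradient vanishes on the open sets on which the function does. -/
theorem IsScalarDotH1.grad_ae_eq_zero {w : R3 → ℝ} {g : Fin 3 → R3 → ℝ} (h : IsScalarDotH1 w g)
    {O : Set R3} (hO : IsOpen O) (hw : ∀ᵐ x, x ∈ O → w x = 0) (b : Fin 3) :
    ∀ᵐ x, x ∈ O → g b x = 0 := by
  refine hO.ae_eq_zero_of_integral_contDiff_smul_eq_zero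
    (((h.grad_memL2 b).locallyIntegrable (by norm_num)).locallyIntegrableOn _)
    fun φ hφ hφc hφO => ?_
  have h1 := h.weak_grad φ hφ hφc b
  have h2 : ∫ x, w x * fderiv ℝ φ x (basisVec b) = 0 := by
    refine integral_eq_zero_of_ae ?_
    filter_upwards [hw] with x hx
    by_cases hxO : x ∈ O
    · simp [hx hxO]
    · have : fderiv ℝ φ x = 0 :=
        image_eq_zero_of_notMem_tsupport fun hx' => hxO (hφO (tsupport_fderiv_subset ℝ hx'))
      simp [this]
  rw [h2] at h1
  simp only [smul_eq_mul, mul_comm (φ _)]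
  linarith

/-! ### Scalar components of the vector identities -/

theorem basisVec_apply (a b : Fin 3) : basisVec a b = if b = a then 1 else 0 := by
  simp [basisVec]

theorem jac_smul_basisVec {φ : R3 → ℝ} {x : R3} (hφ : DifferentiableAt ℝ φ x) (a c b : Fin 3) :
    jac (fun y => φ y • basisVec a) x c b =
      if c = a then fderiv ℝ φ x (basisVec b) else 0 := by
  rw [jac, Matrix.of_apply, fderiv_smul_const hφ]
  simp [basisVec_apply]

theorem contract_jac_smul_basisVec {φ : R3 → ℝ} {x : R3} (hφ : DifferentiableAt ℝ φ x) (A : Mat3)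
    (a : Fin 3) :
    contract A (jac (fun y => φ y • basisVec a) x) = ∑ b, A a b * fderiv ℝ φ x (basisVec b) := by
  simp only [contract, jac_smul_basisVec hφ, mul_ite, mul_zero]
  rw [Finset.sum_eq_single a]
  · simp
  · intro c _ hc
    simp [hc]
  · simp

theorem div_smul_basisVec {φ : R3 → ℝ} {x : R3} (hφ : DifferentiableAt ℝ φ x) (a : Fin 3) :
    div (fun y => φ y • basisVec a) x = fderiv ℝ φ x (basisVec a) := by
  simp [div, Matrix.trace, jac_smul_basisVec hφ]

theorem inner_smul_basisVec (v : R3) (r : ℝ) (a : Fin 3) :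
    inner ℝ v (r • basisVec a) = v a * r := by
  rw [real_inner_smul_right, basisVec, EuclideanSpace.inner_single_right]
  simp [mul_comm]

theorem inner_eq_sum (v w : R3) : inner ℝ v w = ∑ a, v a * w a := by
  rw [PiLp.inner_apply]
  simp [mul_comm]

theorem stress_apply (G : Mat3) (p : ℝ) (a b : Fin 3) :
    stress G p a b = G a b + G b a - p * (1 : Mat3) a b := by
  simp only [stress, deformation, Matrix.sub_apply, Matrix.smul_apply, Matrix.add_apply,
    Matrix.transpose_apply, smul_eq_mul]
  ring

variable {N : ℕ} {S : Fin N → Set R3}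

theorem isOpen_fluidDomain : IsOpen (fluidDomain S) :=
  (isClosed_iUnion_of_finite fun _ => isClosed_closure).isOpen_compl

theorem contDiff_smul_basisVec {φ : R3 → ℝ} (hφ : ContDiff ℝ ∞ φ) (a : Fin 3) :
    ContDiff ℝ ∞ fun y => φ y • basisVec a := hφ.smul contDiff_const

theorem tsupport_smul_basisVec_subset (φ : R3 → ℝ) (a : Fin 3) :
    tsupport (fun y => φ y • basisVec a) ⊆ tsupport φ :=
  closure_mono fun x hx hx' => hx (by simp [hx'])

theorem setIntegral_fluidDomain_eq {φ X : R3 → ℝ} (hφF : tsupport φ ⊆ fluidDomain S)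
    (hX : ∀ x, x ∉ tsupport φ → X x = 0) : ∫ x in fluidDomain S, X x = ∫ x, X x :=
  setIntegral_eq_integral_of_forall_compl_eq_zero fun x hx => hX x fun h => hx (hφF h)

theorem pderiv_eq_zero_of_notMem_tsupport {φ : R3 → ℝ} {x : R3} (hx : x ∉ tsupport φ) (v : R3) :
    fderiv ℝ φ x v = 0 := by
  rw [image_eq_zero_of_notMem_tsupport fun h => hx (tsupport_fderiv_subset ℝ h)]
  rfl

/-- The rows of the stress tensor of a Stokes flow are divergence free in the fluid domain. -/
theorem IsStokesSolution.sum_integral_stress_mul_eq_zero {d : Fin N → R3 → R3} {u : R3 → R3}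
    {G : R3 → Mat3} {p : R3 → ℝ} (h : IsStokesSolution S d u G p) {φ : R3 → ℝ}
    (hφ : ContDiff ℝ ∞ φ) (hφc : HasCompactSupport φ) (hφF : tsupport φ ⊆ fluidDomain S)
    (a : Fin 3) :
    ∑ b, ∫ x in fluidDomain S, stress (G x) (p x) a b * fderiv ℝ φ x (basisVec b) = 0 := by
  have hφd : ∀ x, DifferentiableAt ℝ φ x := fun x => hφ.differentiable (by simp) x
  have hφ2 : ∀ b, MemLp (fun x => fderiv ℝ φ x (basisVec b)) 2 volume := fun b =>
    (contDiff_pderiv hφ _).continuous.memLp_of_hasCompactSupport (hφc.fderiv_apply ℝ _)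
  have hG : ∀ a b c, IntegrableOn (fun x => G x a b * fderiv ℝ φ x (basisVec c))
      (fluidDomain S) volume := fun a b c =>
    ((h.dotH1.grad_memL2 a b).integrable_mul (hφ2 c)).integrableOn
  have hp : ∀ c, IntegrableOn (fun x => p x * fderiv ℝ φ x (basisVec c))
      (fluidDomain S) volume := fun c =>
    h.pressure.integrable_mul ((hφ2 c).mono_measure Measure.restrict_le_self)
  -- the momentum equation tested with `φ • basisVec a`
  have h1 := h.momentum _ (contDiff_smul_basisVec hφ a) hφc.smul_right
    ((tsupport_smul_basisVec_subset φ a).trans hφF)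
  simp only [contract_jac_smul_basisVec (hφd _), div_smul_basisVec (hφd _)] at h1
  rw [integral_sub (integrable_finsetSum _ fun b _ => hG a b b) (hp a),
    integral_finsetSum _ fun b _ => hG a b b] at h1
  -- incompressibility removes the transposed gradient
  have h2 : ∑ b, ∫ x in fluidDomain S, G x b a * fderiv ℝ φ x (basisVec b) = 0 := by
    have h3 : ∀ b, ∫ x in fluidDomain S, G x b a * fderiv ℝ φ x (basisVec b) =
        ∫ x in fluidDomain S, G x b b * fderiv ℝ φ x (basisVec a) := by
      intro b
      rw [setIntegral_fluidDomain_eq hφF fun x hx => by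
          rw [pderiv_eq_zero_of_notMem_tsupport hx, mul_zero],
        setIntegral_fluidDomain_eq hφF fun x hx => by
          rw [pderiv_eq_zero_of_notMem_tsupport hx, mul_zero]]
      exact (h.dotH1.component b).weak_grad.integral_pderiv_comm hφ hφc a b
    rw [Finset.sum_congr rfl fun b _ => h3 b, ← integral_finsetSum _ fun b _ => hG b b a]
    refine integral_eq_zero_of_ae ?_
    filter_upwards [h.incompressible] with x hx
    rw [← Finset.sum_mul]
    have : ∑ b, G x b b = 0 := hx
    simp [this]
  have h4 : ∀ b, ∫ x in fluidDomain S, stress (G x) (p x) a b * fderiv ℝ φ x (basisVec b) =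
      (∫ x in fluidDomain S, G x a b * fderiv ℝ φ x (basisVec b)) +
      (∫ x in fluidDomain S, G x b a * fderiv ℝ φ x (basisVec b)) -
      (∫ x in fluidDomain S, p x * fderiv ℝ φ x (basisVec b)) * (1 : Mat3) a b := by
    intro b
    have i1 : IntegrableOn (fun x => G x a b * fderiv ℝ φ x (basisVec b) +
        G x b a * fderiv ℝ φ x (basisVec b)) (fluidDomain S) := (hG a b b).add (hG b a b)
    rw [← integral_mul_const, ← integral_add (hG a b b) (hG b a b),
      ← integral_sub i1 ((hp b).mul_const _)]
    refine integral_congr_ae (Eventually.of_forall fun x => ?_)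
    simp only [stress_apply]; ring
  rw [Finset.sum_congr rfl fun b _ => h4 b, Finset.sum_sub_distrib, Finset.sum_add_distrib, h2]
  have h5 : ∑ b, (∫ x in fluidDomain S, p x * fderiv ℝ φ x (basisVec b)) * (1 : Mat3) a b =
      ∫ x in fluidDomain S, p x * fderiv ℝ φ x (basisVec a) := by
    simp [Matrix.one_apply]
  rw [h5]
  linarith

theorem IsStokesSolution.stress_memLp {d : Fin N → R3 → R3} {u : R3 → R3}
    {G : R3 → Mat3} {p : R3 → ℝ} (h : IsStokesSolution S d u G p) (a b : Fin 3) :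
    MemLp (fun x => stress (G x) (p x) a b) 2 (volume.restrict (fluidDomain S)) := by
  simp only [stress_apply]
  exact (((h.dotH1.grad_memL2 a b).restrict _).add ((h.dotH1.grad_memL2 b a).restrict _)).sub
    (h.pressure.mul_const _)

/-- The Green formula that defines the normal trace, row by row. -/
theorem HasNormalTrace.exists_divergence {σ : R3 → Mat3} {τ : R3 → R3}
    (h : HasNormalTrace S σ τ) :
    ∃ g : Fin 3 → R3 → ℝ, (∀ a, LocallyIntegrable ((fluidDomain S).indicator (g a)) volume) ∧
      ∀ (a : Fin 3) (φ : R3 → ℝ), ContDiff ℝ ∞ φ → HasCompactSupport φ →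
        (∑ b, ∫ x in fluidDomain S, σ x a b * fderiv ℝ φ x (basisVec b)) +
          ∫ x in fluidDomain S, g a x * φ x =
        ∫ x in bodyBoundary S, τ x a * φ x ∂μHE[2] := by
  obtain ⟨g, hg, hgreen⟩ := h.green
  have hgl : ∀ a, LocallyIntegrable ((fluidDomain S).indicator fun x => g x a) volume := by
    intro a
    have h1 : ∀ x, (fluidDomain S).indicator (fun x => g x a) x =
        EuclideanSpace.proj (𝕜 := ℝ) a ((fluidDomain S).indicator g x) := by
      intro x
      by_cases hx : x ∈ fluidDomain S <;> simp [hx]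
    intro x
    obtain ⟨U, hU, hi⟩ := hg x
    refine ⟨U, hU, ?_⟩
    refine ((EuclideanSpace.proj a : R3 →L[ℝ] ℝ).integrable_comp hi).congr
      (Eventually.of_forall fun y => (h1 y).symm)
  refine ⟨fun a x => g x a, hgl, fun a φ hφ hφc => ?_⟩
  have hφd : ∀ x, DifferentiableAt ℝ φ x := fun x => hφ.differentiable (by simp) x
  have h1 := hgreen _ (contDiff_smul_basisVec hφ a) hφc.smul_right
  simp only [contract_jac_smul_basisVec (hφd _), inner_smul_basisVec] at h1
  have hm : MeasurableSet (fluidDomain S) := isOpen_fluidDomain.measurableSet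
  have hint : ∀ (f ψ : R3 → ℝ), LocallyIntegrable ((fluidDomain S).indicator f) volume →
      Continuous ψ → HasCompactSupport ψ → IntegrableOn (fun x => f x * ψ x) (fluidDomain S) := by
    intro f ψ hf hψ hψc
    rw [← integrable_indicator_iff hm]
    refine (hf.integrable_smul_left_of_hasCompactSupport hψ hψc).congr
      (Eventually.of_forall fun x => ?_)
    by_cases hx : x ∈ fluidDomain S <;> simp [hx, mul_comm]
  have i1 : ∀ b, IntegrableOn (fun x => σ x a b * fderiv ℝ φ x (basisVec b)) (fluidDomain S) :=
    fun b => hint _ _ (h.tensor_loc a b) (contDiff_pderiv hφ _).continuous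
      (hφc.fderiv_apply ℝ _)
  rw [integral_add (integrable_finsetSum _ fun b _ => i1 b)
    (hint _ _ (hgl a) hφ.continuous hφc), integral_finsetSum _ fun b _ => i1 b] at h1
  exact h1

/-! ### Green's formula for test fields of limited regularity -/

theorem tendsto_integral_mul_mollify {ν : Measure R3} {r f : R3 → ℝ} (hr : Integrable r ν)
    (hf : UniformContinuous f) {B : ℝ} (hB : ∀ x, |f x| ≤ B) :
    Tendsto (fun k => ∫ x, r x * mollify (bumpSeq k) f x ∂ν) atTop (𝓝 (∫ x, r x * f x ∂ν)) := by
  have hloc : LocallyIntegrable f volume := hf.continuous.locallyIntegrable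
  refine tendsto_integral_filter_of_dominated_convergence (fun x => ‖r x‖ * (B + 1))
    (Eventually.of_forall fun k => hr.1.mul
      (contDiff_mollify _ hloc).continuous.aestronglyMeasurable) ?_ (hr.norm.mul_const _)
    (Eventually.of_forall fun x => ?_)
  · filter_upwards [eventually_abs_mollify_sub_le hf one_pos] with k hk
    refine Eventually.of_forall fun x => ?_
    rw [norm_mul]
    gcongr
    rw [Real.norm_eq_abs]
    have h1 := abs_sub_abs_le_abs_sub (mollify (bumpSeq k) f x) (f x)
    linarith [hk x, hB x]
  · refine tendsto_const_nhds.mul (Metric.tendsto_nhds.2 fun ε hε => ?_)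
    filter_upwards [eventually_abs_mollify_sub_le hf (half_pos hε)] with k hk
    rw [Real.dist_eq]
    linarith [hk x]

theorem mollify_bumpSeq_eq_zero {f : R3 → ℝ} {K : Set R3} (hK : ∀ x, x ∉ K → f x = 0) {x : R3}
    (hx : x ∉ Metric.cthickening 1 K) (k : ℕ) : mollify (bumpSeq k) f x = 0 := by
  refine mollify_eq_zero _ (Eventually.of_forall fun y hy => hK y fun hyK => hx ?_)
  refine Metric.thickening_subset_cthickening _ _ (Metric.mem_thickening_iff.2 ⟨y, hyK, ?_⟩)
  rw [dist_comm]
  refine (Metric.mem_ball.1 hy).trans_le ?_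
  change 1 / ((k : ℝ) + 1) ≤ 1
  rw [div_le_one (by positivity)]
  linarith [k.cast_nonneg (α := ℝ)]

/-- A Green formula that holds for the smooth test functions extends to the continuously
differentiable ones. -/
theorem green_of_contDiff_one {μ : Measure R3} {s : Fin 3 → R3 → ℝ} {τ : R3 → ℝ}
    (hs : ∀ b, LocallyIntegrable (s b) volume) (hτ : Integrable τ μ)
    (h : ∀ φ : R3 → ℝ, ContDiff ℝ ∞ φ → HasCompactSupport φ →
      ∑ b, ∫ x, s b x * fderiv ℝ φ x (basisVec b) = ∫ x, τ x * φ x ∂μ)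
    {φ : R3 → ℝ} (hφ : ContDiff ℝ 1 φ) (hφc : HasCompactSupport φ) :
    ∑ b, ∫ x, s b x * fderiv ℝ φ x (basisVec b) = ∫ x, τ x * φ x ∂μ := by
  have hloc : LocallyIntegrable φ volume := hφ.continuous.locallyIntegrable
  set K := Metric.cthickening 1 (tsupport φ) with hK
  have hKc : IsCompact K := hφc.isCompact.cthickening
  have hKm : MeasurableSet K := hKc.measurableSet
  have hsub : tsupport φ ⊆ K := Metric.self_subset_cthickening _
  have hd : ∀ b, Continuous fun x => fderiv ℝ φ x (basisVec b) := fun b => continuous_pderiv hφ _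
  have hdc : ∀ b, HasCompactSupport fun x => fderiv ℝ φ x (basisVec b) := fun b =>
    hφc.fderiv_apply ℝ _
  have hK0 : ∀ k b x, x ∉ K →
      mollify (bumpSeq k) (fun x => fderiv ℝ φ x (basisVec b)) x = 0 := fun k b x hx =>
    mollify_bumpSeq_eq_zero (fun y hy => pderiv_eq_zero_of_notMem_tsupport hy _) hx k
  have hcut : ∀ b (ζ : R3 → ℝ), (∀ x, x ∉ K → ζ x = 0) →
      ∫ x, s b x * ζ x = ∫ x, K.indicator (s b) x * ζ x := by
    intro b ζ hζ
    refine integral_congr_ae (Eventually.of_forall fun x => ?_)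
    by_cases hx : x ∈ K
    · simp [hx]
    · simp [hζ x hx]
  have hleft : Tendsto (fun k => ∑ b, ∫ x, s b x *
      fderiv ℝ (mollify (bumpSeq k) φ) x (basisVec b)) atTop
      (𝓝 (∑ b, ∫ x, s b x * fderiv ℝ φ x (basisVec b))) := by
    refine tendsto_finsetSum _ fun b _ => ?_
    obtain ⟨B, hB⟩ := (hd b).bounded_above_of_compact_support (hdc b)
    have h1 := tendsto_integral_mul_mollify
      ((integrable_indicator_iff hKm).2 ((hs b).integrableOn_isCompact hKc))
      ((hd b).uniformContinuous_of_tendsto_cocompact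
        (by simpa using (hdc b).is_zero_at_infty)) hB
    rw [← hcut b _ fun x hx => pderiv_eq_zero_of_notMem_tsupport (fun h => hx (hsub h)) _] at h1
    refine h1.congr fun k => ?_
    rw [← hcut b _ (hK0 k b)]
    simp only [fderiv_mollify (bumpSeq k) hloc (isWeakGradient_of_contDiff hφ)]
  have hright : Tendsto (fun k => ∫ x, τ x * mollify (bumpSeq k) φ x ∂μ) atTop
      (𝓝 (∫ x, τ x * φ x ∂μ)) := by
    obtain ⟨B, hB⟩ := hφ.continuous.bounded_above_of_compact_support hφc
    exact tendsto_integral_mul_mollify hτ (hφ.continuous.uniformContinuous_of_tendsto_cocompact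
      (by simpa using hφc.is_zero_at_infty)) hB
  refine tendsto_nhds_unique hleft (hright.congr fun k => (h _ (contDiff_mollify _ hloc) ?_).symm)
  exact HasCompactSupport.intro hKc fun x hx =>
    mollify_bumpSeq_eq_zero (fun y hy => image_eq_zero_of_notMem_tsupport hy) hx k

theorem abs_fderiv_mollify_le (ρ : ContDiffBump (0 : R3)) {f : R3 → ℝ} {L : ℝ≥0}
    (hf : LipschitzWith L f) (b : Fin 3) (x : R3) :
    |fderiv ℝ (mollify ρ f) x (basisVec b)| ≤ L := by
  have hρ : Continuous (ρ.normed volume) := (ρ.contDiff_normed (n := ⊤)).continuous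
  have hρc : HasCompactSupport (ρ.normed volume) := ρ.hasCompactSupport_normed
  have hlip : LipschitzWith L (mollify ρ f) := by
    refine LipschitzWith.of_dist_le_mul fun x y => ?_
    have hi : ∀ z, Integrable (fun t => ρ.normed volume t * f (z - t)) volume := fun z =>
      (hρ.mul (hf.continuous.comp (continuous_const.sub continuous_id))).integrable_of_hasCompactSupport
        hρc.mul_right
    rw [dist_eq_norm, mollify_apply', mollify_apply', ← integral_sub (hi x) (hi y)]
    calc _ ≤ ∫ t, ρ.normed volume t * (L * dist x y) := by
          refine norm_integral_le_of_norm_le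
            ((hρ.integrable_of_hasCompactSupport hρc).mul_const _)
            (Eventually.of_forall fun t => ?_)
          rw [← mul_sub, norm_mul, Real.norm_of_nonneg (ρ.nonneg_normed t), ← dist_eq_norm]
          refine mul_le_mul_of_nonneg_left ?_ (ρ.nonneg_normed t)
          simpa using hf.dist_le_mul (x - t) (y - t)
      _ = L * dist x y := by rw [integral_mul_const, ρ.integral_normed, one_mul]
  calc |fderiv ℝ (mollify ρ f) x (basisVec b)| ≤ ‖fderiv ℝ (mollify ρ f) x‖ * ‖basisVec b‖ :=
        (fderiv ℝ (mollify ρ f) x).le_opNorm _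
    _ ≤ L * 1 := by
        gcongr
        · exact norm_fderiv_le_of_lipschitz ℝ hlip
        · simp [basisVec]
    _ = L := mul_one _

/-- Cutoff functions that exhaust an open set. -/
theorem exists_cutoff_seq {F : Set R3} (hF : IsOpen F) :
    ∃ χ : ℕ → R3 → ℝ, (∀ m, ContDiff ℝ ∞ (χ m)) ∧ (∀ m, tsupport (χ m) ⊆ F) ∧
      (∀ m x, 0 ≤ χ m x ∧ χ m x ≤ 1) ∧ ∀ x ∈ F, Tendsto (fun m => χ m x) atTop (𝓝 1) := by
  obtain ⟨f, hfs, hf, hfr⟩ := hF.exists_contDiff_support_eq (n := ⊤)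
  have hf0 : ∀ x, 0 ≤ f x := fun x => (hfr (mem_range_self x)).1
  refine ⟨fun m x => Real.smoothTransition (m * f x - 1), fun m => ?_, fun m => ?_, fun m x =>
    ⟨Real.smoothTransition.nonneg _, Real.smoothTransition.le_one _⟩, fun x hx => ?_⟩
  · exact (Real.smoothTransition.contDiff (n := ⊤)).comp ((contDiff_const.mul hf).sub contDiff_const)
  · have hcl : IsClosed {x | 1 ≤ (m : ℝ) * f x} :=
      isClosed_le continuous_const (continuous_const.mul hf.continuous)
    refine (closure_minimal (fun x hx => ?_) hcl).trans fun x hx => ?_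
    · by_contra h
      have h' : (m : ℝ) * f x < 1 := not_le.1 h
      exact hx (Real.smoothTransition.zero_of_nonpos (by linarith))
    · have hx' : 1 ≤ (m : ℝ) * f x := hx
      rw [← hfs, Function.mem_support]
      intro h
      rw [h] at hx'
      norm_num at hx'
  · have hpos : 0 < f x := lt_of_le_of_ne (hf0 x) (by rw [← hfs] at hx; exact fun h => hx h.symm)
    refine tendsto_const_nhds.congr' ?_
    obtain ⟨m₀, hm₀⟩ := exists_nat_gt (2 / f x)
    filter_upwards [eventually_ge_atTop m₀] with m hm
    rw [div_lt_iff₀ hpos] at hm₀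
    have : (m₀ : ℝ) ≤ m := by exact_mod_cast hm
    exact (Real.smoothTransition.one_of_one_le (by nlinarith)).symm

theorem bodyBoundary_disjoint_fluidDomain {x : R3} (hx : x ∈ bodyBoundary S) :
    x ∉ fluidDomain S := by
  obtain ⟨j, hj⟩ := mem_iUnion.1 hx
  exact fun h => h (mem_iUnion.2 ⟨j, frontier_subset_closure hj⟩)

theorem IsOutwardNormal.integral_pderiv {n : R3 → R3} (hn : IsOutwardNormal S n) {φ : R3 → ℝ}
    (hφ : ContDiff ℝ ∞ φ) (hφc : HasCompactSupport φ) (b : Fin 3) :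
    ∫ x in fluidDomain S, fderiv ℝ φ x (basisVec b) =
      ∫ x in bodyBoundary S, n x b * φ x ∂μHE[2] := by
  have h := hn.gauss_green _ (contDiff_smul_basisVec hφ b) hφc.smul_right
  simpa only [div_smul_basisVec (hφ.differentiable (by simp) _), inner_smul_basisVec] using h

theorem IsOutwardNormal.integrable_component {n : R3 → R3} (hn : IsOutwardNormal S n) (b : Fin 3) :
    IntegrableOn (fun x => n x b) (bodyBoundary S) μHE[2] :=
  (EuclideanSpace.proj b : R3 →L[ℝ] ℝ).integrable_comp hn.integrable

theorem integrable_mul_of_bounded {X : Type*} [MeasurableSpace X] {μ : Measure X} {f g : X → ℝ}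
    (hf : Integrable f μ) (hg : AEStronglyMeasurable g μ) {B : ℝ} (hB : ∀ x, |g x| ≤ B) :
    Integrable (fun x => f x * g x) μ := by
  simpa [mul_comm] using hf.bdd_mul hg (Eventually.of_forall hB)

/-- The Gauss-Green formula for a bounded Lipschitz field, whose distributional divergence in the
fluid domain is `g`. The divergences of its mollifications are bounded by the Lipschitz constant,
so that no mass concentrates at the boundary. -/
theorem IsOutwardNormal.green_of_lipschitz {n : R3 → R3} (hn : IsOutwardNormal S n)
    {ψ : Fin 3 → R3 → ℝ} {L : ℝ≥0} {B : ℝ} (hL : ∀ b, LipschitzWith L (ψ b))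
    (hB : ∀ b x, |ψ b x| ≤ B) {g : R3 → ℝ}
    (hg : LocallyIntegrable ((fluidDomain S).indicator g) volume)
    (hdiv : ∀ φ : R3 → ℝ, ContDiff ℝ ∞ φ → HasCompactSupport φ → tsupport φ ⊆ fluidDomain S →
      (∑ b, ∫ x in fluidDomain S, ψ b x * fderiv ℝ φ x (basisVec b)) +
        ∫ x in fluidDomain S, g x * φ x = 0)
    {φ : R3 → ℝ} (hφ : ContDiff ℝ ∞ φ) (hφc : HasCompactSupport φ) :
    (∑ b, ∫ x in fluidDomain S, ψ b x * fderiv ℝ φ x (basisVec b)) +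
      ∫ x in fluidDomain S, g x * φ x =
    ∑ b, ∫ x in bodyBoundary S, n x b * φ x * ψ b x ∂μHE[2] := by
  set F := fluidDomain S with hF
  have hFm : MeasurableSet F := isOpen_fluidDomain.measurableSet
  have hψu : ∀ b, UniformContinuous (ψ b) := fun b => (hL b).uniformContinuous
  have hψl : ∀ b, LocallyIntegrable (ψ b) volume := fun b => (hL b).continuous.locallyIntegrable
  set Ψ : ℕ → Fin 3 → R3 → ℝ := fun k b => mollify (bumpSeq k) (ψ b) with hΨ
  have hΨs : ∀ k b, ContDiff ℝ ∞ (Ψ k b) := fun k b => contDiff_mollify _ (hψl b)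
  have hΨd : ∀ k b x, |fderiv ℝ (Ψ k b) x (basisVec b)| ≤ L := fun k b x =>
    abs_fderiv_mollify_le _ (hL b) b x
  have hpi : ∀ (ζ : R3 → ℝ), Continuous ζ → HasCompactSupport ζ → IntegrableOn ζ F := fun ζ h1 h2 =>
    (h1.integrable_of_hasCompactSupport h2).integrableOn
  -- Gauss-Green for the mollified field
  have hGG : ∀ k (ζ : R3 → ℝ), ContDiff ℝ ∞ ζ → HasCompactSupport ζ →
      (∑ b, ∫ x in F, fderiv ℝ ζ x (basisVec b) * Ψ k b x) +
        (∑ b, ∫ x in F, fderiv ℝ (Ψ k b) x (basisVec b) * ζ x) =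
      ∑ b, ∫ x in bodyBoundary S, n x b * ζ x * Ψ k b x ∂μHE[2] := by
    intro k ζ hζ hζc
    rw [← Finset.sum_add_distrib]
    refine Finset.sum_congr rfl fun b _ => ?_
    have h1 := hn.integral_pderiv ((hΨs k b).mul hζ) hζc.mul_left b
    have h2 : ∀ x, fderiv ℝ (Ψ k b * ζ) x (basisVec b) =
        fderiv ℝ ζ x (basisVec b) * Ψ k b x + fderiv ℝ (Ψ k b) x (basisVec b) * ζ x := by
      intro x
      rw [fderiv_mul ((hΨs k b).differentiable (by simp) x) (hζ.differentiable (by simp) x)]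
      simp [mul_comm]
    rw [← integral_add]
    · rw [← integral_congr_ae (Eventually.of_forall h2)]
      refine h1.trans (integral_congr_ae (Eventually.of_forall fun x => ?_))
      simp only; ring
    · exact hpi _ ((contDiff_pderiv hζ _).continuous.mul (hΨs k b).continuous)
        (hζc.fderiv_apply ℝ _).mul_right
    · exact hpi _ ((contDiff_pderiv (hΨs k b) _).continuous.mul hζ.continuous) hζc.mul_left
  have hA : ∀ (ζ : R3 → ℝ), ContDiff ℝ ∞ ζ → HasCompactSupport ζ →
      Tendsto (fun k => ∑ b, ∫ x in F, fderiv ℝ ζ x (basisVec b) * Ψ k b x) atTop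
        (𝓝 (∑ b, ∫ x in F, ψ b x * fderiv ℝ ζ x (basisVec b))) := by
    intro ζ hζ hζc
    refine tendsto_finsetSum _ fun b _ => ?_
    simp only [mul_comm (ψ b _)]
    exact tendsto_integral_mul_mollify (hpi _ (contDiff_pderiv hζ _).continuous
      (hζc.fderiv_apply ℝ _)) (hψu b) (hB b)
  have hBd : Tendsto (fun k => ∑ b, ∫ x in bodyBoundary S, n x b * φ x * Ψ k b x ∂μHE[2]) atTop
      (𝓝 (∑ b, ∫ x in bodyBoundary S, n x b * φ x * ψ b x ∂μHE[2])) := by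
    refine tendsto_finsetSum _ fun b _ => ?_
    obtain ⟨C, hC⟩ := hφ.continuous.bounded_above_of_compact_support hφc
    exact tendsto_integral_mul_mollify (integrable_mul_of_bounded (hn.integrable_component b)
      hφ.continuous.aestronglyMeasurable hC) (hψu b) (hB b)
  -- the volume term of the mollified field
  set D : ℕ → (R3 → ℝ) → ℝ := fun k ζ => ∑ b, ∫ x in F, fderiv ℝ (Ψ k b) x (basisVec b) * ζ x
    with hD
  set E : ℝ := (∑ b, ∫ x in bodyBoundary S, n x b * φ x * ψ b x ∂μHE[2]) -
    ∑ b, ∫ x in F, ψ b x * fderiv ℝ φ x (basisVec b) with hE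
  have hDE : Tendsto (fun k => D k φ) atTop (𝓝 E) :=
    (hBd.sub (hA φ hφ hφc)).congr fun k => by rw [← hGG k φ hφ hφc]; ring
  obtain ⟨χ, hχs, hχF, hχ01, hχ1⟩ := exists_cutoff_seq (isOpen_fluidDomain (S := S))
  have hζs : ∀ m, ContDiff ℝ ∞ (fun x => χ m x * φ x) := fun m => (hχs m).mul hφ
  have hζc : ∀ m, HasCompactSupport (fun x => χ m x * φ x) := fun m => hφc.mul_left
  have hζF : ∀ m, tsupport (fun x => χ m x * φ x) ⊆ F := fun m =>
    (closure_mono (Function.support_mul_subset_left _ _)).trans (hχF m)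
  have hDζ : ∀ m, Tendsto (fun k => D k (fun x => χ m x * φ x)) atTop
      (𝓝 (∫ x in F, g x * (χ m x * φ x))) := by
    intro m
    have h1 := hdiv _ (hζs m) (hζc m) (hζF m)
    rw [show ∫ x in F, g x * (χ m x * φ x) =
      - ∑ b, ∫ x in F, ψ b x * fderiv ℝ (fun x => χ m x * φ x) x (basisVec b) by linarith]
    refine (hA _ (hζs m) (hζc m)).neg.congr fun k => ?_
    have h2 := hGG k _ (hζs m) (hζc m)
    have h3 : ∀ b, ∫ x in bodyBoundary S, n x b * (χ m x * φ x) * Ψ k b x ∂μHE[2] = 0 := by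
      intro b
      refine setIntegral_eq_zero_of_forall_eq_zero fun x hx => ?_
      have h4 : χ m x = 0 := image_eq_zero_of_notMem_tsupport fun h =>
        bodyBoundary_disjoint_fluidDomain hx (hχF m h)
      simp [h4]
    simp only [h3, Finset.sum_const_zero] at h2
    simp only [hD]
    linarith
  have hbound : ∀ k m, |D k φ - D k (fun x => χ m x * φ x)| ≤
      3 * L * ∫ x in F, (1 - χ m x) * |φ x| := by
    intro k m
    simp only [hD]
    rw [← Finset.sum_sub_distrib]
    have h1 : ∀ b, |(∫ x in F, fderiv ℝ (Ψ k b) x (basisVec b) * φ x) -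
        ∫ x in F, fderiv ℝ (Ψ k b) x (basisVec b) * (χ m x * φ x)| ≤
        L * ∫ x in F, (1 - χ m x) * |φ x| := by
      intro b
      have hc := (contDiff_pderiv (hΨs k b) (basisVec b)).continuous
      have i1 : IntegrableOn (fun x => fderiv ℝ (Ψ k b) x (basisVec b) * φ x) F :=
        hpi _ (hc.mul hφ.continuous) hφc.mul_left
      have i2 : IntegrableOn (fun x => fderiv ℝ (Ψ k b) x (basisVec b) * (χ m x * φ x)) F :=
        hpi _ (hc.mul (hζs m).continuous) (hζc m).mul_left
      rw [← integral_sub i1 i2, ← integral_const_mul, ← Real.norm_eq_abs]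
      have i3 : IntegrableOn (fun x => (1 - χ m x) * |φ x|) F :=
        hpi _ ((continuous_const.sub (hχs m).continuous).mul hφ.continuous.abs)
          (HasCompactSupport.mul_left (f' := fun x => |φ x|) hφc.norm)
      refine norm_integral_le_of_norm_le (i3.const_mul _) (Eventually.of_forall fun x => ?_)
      rw [show fderiv ℝ (Ψ k b) x (basisVec b) * φ x -
        fderiv ℝ (Ψ k b) x (basisVec b) * (χ m x * φ x) =
        fderiv ℝ (Ψ k b) x (basisVec b) * ((1 - χ m x) * φ x) by ring, norm_mul, norm_mul,
        Real.norm_of_nonneg (by linarith [(hχ01 m x).2] : 0 ≤ 1 - χ m x)]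
      exact mul_le_mul_of_nonneg_right (hΨd k b x)
        (mul_nonneg (by linarith [(hχ01 m x).2]) (abs_nonneg _))
    refine (Finset.abs_sum_le_sum_abs _ _).trans ((Finset.sum_le_sum fun b _ => h1 b).trans ?_)
    rw [Finset.sum_const, Finset.card_univ, Fintype.card_fin, nsmul_eq_mul]
    push_cast
    linarith
  have hlim : ∀ m, |E - ∫ x in F, g x * (χ m x * φ x)| ≤
      3 * L * ∫ x in F, (1 - χ m x) * |φ x| := fun m =>
    le_of_tendsto ((hDE.sub (hDζ m)).abs) (Eventually.of_forall fun k => hbound k m)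
  have hgφ : IntegrableOn (fun x => g x * φ x) F := by
    rw [← integrable_indicator_iff hFm]
    refine (hg.integrable_smul_left_of_hasCompactSupport hφ.continuous hφc).congr
      (Eventually.of_forall fun x => ?_)
    by_cases hx : x ∈ F <;> simp [hx, mul_comm]
  have hl1 : Tendsto (fun m => ∫ x in F, g x * (χ m x * φ x)) atTop (𝓝 (∫ x in F, g x * φ x)) := by
    refine tendsto_integral_of_dominated_convergence (fun x => ‖g x * φ x‖) (fun m => ?_) hgφ.norm
      (fun m => Eventually.of_forall fun x => ?_) ?_
    · refine (hgφ.1.mul (hχs m).continuous.aestronglyMeasurable).congr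
        (Eventually.of_forall fun x => ?_)
      simp only [Pi.mul_apply]; ring
    · rw [show g x * (χ m x * φ x) = χ m x * (g x * φ x) by ring, norm_mul,
        Real.norm_of_nonneg (hχ01 m x).1]
      exact mul_le_of_le_one_left (norm_nonneg _) (hχ01 m x).2
    · filter_upwards [ae_restrict_mem hFm] with x hx
      simpa using tendsto_const_nhds.mul ((hχ1 x hx).mul_const (φ x))
  have hl2 : Tendsto (fun m => ∫ x in F, (1 - χ m x) * |φ x|) atTop (𝓝 0) := by
    rw [show (0 : ℝ) = ∫ _ in F, (0 : ℝ) by simp]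
    refine tendsto_integral_of_dominated_convergence (fun x => |φ x|) (fun m => ?_)
      (hpi _ hφ.continuous.abs hφc.norm)
      (fun m => Eventually.of_forall fun x => ?_) ?_
    · exact ((continuous_const.sub (hχs m).continuous).mul hφ.continuous.abs).aestronglyMeasurable
    · rw [norm_mul, Real.norm_of_nonneg (by linarith [(hχ01 m x).2] : 0 ≤ 1 - χ m x),
        Real.norm_eq_abs, abs_abs]
      exact mul_le_of_le_one_left (abs_nonneg _) (by linarith [(hχ01 m x).1])
    · filter_upwards [ae_restrict_mem hFm] with x hx
      have := ((hχ1 x hx).const_sub 1).mul_const |φ x|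
      simpa using this
  have hfin := le_of_tendsto_of_tendsto' ((tendsto_const_nhds (x := E)).sub hl1).abs
    (hl2.const_mul (3 * (L : ℝ))) hlim
  rw [mul_zero] at hfin
  have := abs_nonpos_iff.1 hfin
  linarith

/-! ### Geometry of embedded tubes -/

/-- If `g` is a submersion at `z₀`, it maps cones contained in `J` to sets that contain
cones, uniformly with respect to the vertex near `z₀`. -/
theorem exists_cone_image {E F : Type*} [NormedAddCommGroup E] [NormedSpace ℝ E] [CompleteSpace E]
    [NormedAddCommGroup F] [NormedSpace ℝ F] [CompleteSpace F] {g : E → F} {A : E →L[ℝ] F} {z₀ : E}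
    (hg : HasStrictFDerivAt g A z₀) (hA : Function.Surjective A) {K J : Set E} {d : E} {r : ℝ}
    (hr : 0 < r)
    (hcone : ∀ z ∈ K, dist z z₀ < r → ∀ δ ∈ Ioo (0 : ℝ) 1, Metric.ball (z + δ • d) (δ * r) ⊆ J) :
    ∃ O : Set E, IsOpen O ∧ z₀ ∈ O ∧ ∃ c δ₀ : ℝ, 0 < c ∧ 0 < δ₀ ∧ ∀ z ∈ K ∩ O, ∀ δ ∈ Ioo 0 δ₀,
      Metric.ball (g z + δ • A d) (δ * c) ⊆ g '' J := by
  obtain ⟨I, hI⟩ : ∃ I : A.NonlinearRightInverse, 0 < I.nnnorm :=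
    ⟨_, A.nonlinearRightInverseOfSurjective_nnnorm_pos (LinearMap.range_eq_top.2 hA)⟩
  set κ : ℝ := ((I.nnnorm : ℝ))⁻¹ with hκ
  have hκ0 : 0 < κ := inv_pos.2 hI
  set c₁ : ℝ := min (κ / 2) (κ * r / (8 * (‖d‖ + 1))) with hc₁
  have hd1 : 0 < ‖d‖ + 1 := by positivity
  have hc₁0 : 0 < c₁ := lt_min (by positivity) (by positivity)
  have hc₁a : c₁ ≤ κ / 2 := min_le_left _ _
  have hc₁b : c₁ * ‖d‖ ≤ κ * r / 8 := by
    have h1 : c₁ ≤ κ * r / (8 * (‖d‖ + 1)) := min_le_right _ _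
    rw [le_div_iff₀ (by positivity)] at h1
    nlinarith [norm_nonneg d]
  obtain ⟨s, hs, happ⟩ := hg.approximates_deriv_on_nhds (c := ⟨c₁, hc₁0.le⟩) (Or.inr hc₁0)
  obtain ⟨η, hη, hηs⟩ := Metric.mem_nhds_iff.1 hs
  have hdr : 0 < ‖d‖ + r := by positivity
  refine ⟨Metric.ball z₀ (min r (η / 2)), Metric.isOpen_ball, Metric.mem_ball_self (by positivity),
    κ * r / 8, min 1 (η / (2 * (‖d‖ + r))), by positivity, by positivity, ?_⟩
  rintro z ⟨hzK, hz⟩ δ ⟨hδ, hδ'⟩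
  rw [lt_min_iff, lt_div_iff₀ (by positivity)] at hδ'
  rw [Metric.mem_ball, lt_min_iff] at hz
  have hsub : Metric.closedBall (z + δ • d) (δ * (r / 2)) ⊆ s := by
    intro y hy
    refine hηs ?_
    rw [Metric.mem_closedBall] at hy
    rw [Metric.mem_ball]
    calc dist y z₀ ≤ dist y (z + δ • d) + dist (z + δ • d) z + dist z z₀ := dist_triangle4 _ _ _ _
      _ < η := by
        rw [dist_self_add_left, norm_smul, Real.norm_of_nonneg hδ.le]
        nlinarith [hz.2, mul_pos hδ hr]
  have hzs : z ∈ s := hηs (by rw [Metric.mem_ball]; linarith [hz.2])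
  have hzd : z + δ • d ∈ s := hsub (Metric.mem_closedBall_self (by positivity))
  have hsurj := happ.surjOn_closedBall_of_nonlinearRightInverse I (ε := δ * (r / 2))
    (by positivity) hsub
  have herr : ‖g (z + δ • d) - g z - δ • A d‖ ≤ c₁ * (δ * ‖d‖) := by
    have := happ _ hzd _ hzs
    rw [add_sub_cancel_left, map_smul, norm_smul, Real.norm_of_nonneg hδ.le] at this
    exact this
  intro x hx
  have hx' : x ∈ Metric.closedBall (g (z + δ • d)) ((κ - c₁) * (δ * (r / 2))) := by
    rw [Metric.mem_ball] at hx
    rw [Metric.mem_closedBall]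
    have h1 : dist (g z + δ • A d) (g (z + δ • d)) ≤ c₁ * (δ * ‖d‖) := by
      rw [dist_comm, dist_eq_norm, ← sub_sub]
      exact herr
    have h2 : c₁ * (δ * ‖d‖) ≤ δ * (κ * r / 8) := by nlinarith
    have h3 : δ * (κ * r / 8) + δ * (κ * r / 8) ≤ (κ - c₁) * (δ * (r / 2)) := by
      have : κ / 2 * (δ * (r / 2)) ≤ (κ - c₁) * (δ * (r / 2)) := by gcongr; linarith
      nlinarith
    linarith [dist_triangle x (g z + δ • A d) (g (z + δ • d))]
  obtain ⟨y, hy, rfl⟩ := hsurj hx'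
  refine ⟨y, hcone z hzK hz.1 δ ⟨hδ, hδ'.1⟩ ?_, rfl⟩
  rw [Metric.mem_closedBall] at hy
  rw [Metric.mem_ball]
  have := mul_pos hδ hr
  linarith

/-- The image under `g` of a compact set `K` satisfies the cone condition near `g z₀`. For loops,
`g` is invariant under the translation by the period `v`, and only injective modulo this
translation; `v = 0` otherwise. The set `K'` contains `K` and is invariant as well. -/
theorem exists_cone_of_injective {E F : Type*} [NormedAddCommGroup E] [NormedSpace ℝ E]
    [CompleteSpace E] [NormedAddCommGroup F] [NormedSpace ℝ F] [CompleteSpace F] {g : E → F}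
    {A : E →L[ℝ] F} {z₀ v : E} (hgc : Continuous g)
    (hg : HasStrictFDerivAt g A z₀) (hA : Function.Surjective A) {K K' J : Set E} {d : E} {r : ℝ}
    (hr : 0 < r) (hK : IsCompact K) (hKK' : K ⊆ K') (hv : ∀ z ∈ K', z - v ∈ K')
    (hgv : ∀ z, g (z + v) = g z) (hinj : ∀ z ∈ K, g z = g z₀ → z = z₀ ∨ z = z₀ + v)
    (hcone : ∀ z ∈ K', dist z z₀ < r → ∀ δ ∈ Ioo (0 : ℝ) 1, Metric.ball (z + δ • d) (δ * r) ⊆ J) :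
    ∃ U : Set F, IsOpen U ∧ g z₀ ∈ U ∧ ∃ (ξ : F) (c δ₀ : ℝ), 0 < c ∧ 0 < δ₀ ∧
      ∀ x ∈ U ∩ g '' K, ∀ δ ∈ Ioo 0 δ₀, Metric.ball (x + δ • ξ) (δ * c) ⊆ g '' J := by
  obtain ⟨O, hO, hzO, c, δ₀, hc, hδ₀, h⟩ := exists_cone_image hg hA hr hcone
  have hO2 : IsOpen (O ∪ (fun z => z - v) ⁻¹' O) :=
    hO.union (hO.preimage (continuous_id.sub continuous_const))
  refine ⟨(g '' (K \ (O ∪ (fun z => z - v) ⁻¹' O)))ᶜ,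
    ((hK.diff hO2).image hgc).isClosed.isOpen_compl, ?_, A d, c, δ₀, hc, hδ₀, ?_⟩
  · rintro ⟨z, ⟨hzK, hzO'⟩, hz⟩
    rcases hinj z hzK hz with rfl | rfl
    · exact hzO' (Or.inl hzO)
    · exact hzO' (Or.inr (by simpa using hzO))
  · rintro x ⟨hxU, z, hzK, rfl⟩ δ hδ
    by_cases h1 : z ∈ O
    · exact h z ⟨hKK' hzK, h1⟩ δ hδ
    · by_cases h2 : z - v ∈ O
      · have h3 := h (z - v) ⟨hv z (hKK' hzK), h2⟩ δ hδ
        rwa [← hgv (z - v), sub_add_cancel] at h3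
      · exact absurd ⟨z, ⟨hzK, fun h' => h'.elim h1 h2⟩, rfl⟩ hxU

/-- An embedding of a solid cylinder of length `L`, or of a solid torus of period `L`, defined up
to the boundary. -/
structure IsTube (loop : Prop) (L : ℝ) (g : ℝ × R2 → R3) : Prop where
  L_pos : 0 < L
  contDiff : ContDiff ℝ 1 g
  inj : ¬ loop → InjOn g (Icc 0 L ×ˢ Metric.closedBall (0 : R2) 1)
  inj_loop : loop → InjOn g (Ico 0 L ×ˢ Metric.closedBall (0 : R2) 1)
  immersion : ∀ z ∈ Icc 0 L ×ˢ Metric.closedBall (0 : R2) 1, Function.Bijective (fderiv ℝ g z)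
  periodic : loop → ∀ s y, g (s + L, y) = g (s, y)

namespace IsTube

variable {loop : Prop} {L : ℝ} {g : ℝ × R2 → R3}

theorem isCompact_domain : IsCompact (Icc 0 L ×ˢ Metric.closedBall (0 : R2) 1) :=
  isCompact_Icc.prod (isCompact_closedBall 0 1)

theorem closure_image (h : IsTube loop L g) :
    closure (g '' (Icc 0 L ×ˢ Metric.ball (0 : R2) 1)) =
      g '' (Icc 0 L ×ˢ Metric.closedBall (0 : R2) 1) := by
  refine Subset.antisymm (closure_minimal (image_mono ?_)
    (isCompact_domain.image h.contDiff.continuous).isClosed) ?_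
  · exact prod_mono_right Metric.ball_subset_closedBall
  · have h1 : Icc 0 L ×ˢ Metric.closedBall (0 : R2) 1 =
        closure (Icc 0 L ×ˢ Metric.ball (0 : R2) 1) := by
      rw [closure_prod_eq, closure_Icc, closure_ball _ one_ne_zero]
    rw [h1]
    exact image_closure_subset_closure_image h.contDiff.continuous

theorem isCompact_closure_image (h : IsTube loop L g) :
    IsCompact (closure (g '' (Icc 0 L ×ˢ Metric.ball (0 : R2) 1))) := by
  rw [h.closure_image]
  exact isCompact_domain.image h.contDiff.continuous

theorem hasStrictFDerivAt (h : IsTube loop L g) (z : ℝ × R2) :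
    HasStrictFDerivAt g (fderiv ℝ g z) z :=
  h.contDiff.contDiffAt.hasStrictFDerivAt (by simp)

theorem image_subset_interior (h : IsTube loop L g) :
    g '' (Ioo 0 L ×ˢ Metric.ball (0 : R2) 1) ⊆
      interior (g '' (Icc 0 L ×ˢ Metric.ball (0 : R2) 1)) := by
  rintro _ ⟨z, hz, rfl⟩
  rw [mem_interior_iff_mem_nhds]
  have h1 := (h.hasStrictFDerivAt z).map_nhds_eq_of_surj
    (LinearMap.range_eq_top.2 (h.immersion z ⟨Ioo_subset_Icc_self hz.1,
      Metric.ball_subset_closedBall hz.2⟩).2)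
  rw [← h1]
  refine Filter.image_mem_map (mem_of_superset
    ((isOpen_Ioo.prod Metric.isOpen_ball).mem_nhds hz) (prod_mono_left Ioo_subset_Icc_self))

theorem nonempty_interior (h : IsTube loop L g) :
    (interior (g '' (Icc 0 L ×ˢ Metric.ball (0 : R2) 1))).Nonempty :=
  ⟨g (L / 2, 0), h.image_subset_interior ⟨(L / 2, 0),
    ⟨⟨half_pos h.L_pos, half_lt_self h.L_pos⟩, Metric.mem_ball_self one_pos⟩, rfl⟩⟩

/-- The boundary of a tube is negligible, as the image of the boundary of a convex set. -/
theorem volume_closure_diff_interior (h : IsTube loop L g) :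
    volume (closure (g '' (Icc 0 L ×ˢ Metric.ball (0 : R2) 1)) \
      interior (g '' (Icc 0 L ×ˢ Metric.ball (0 : R2) 1))) = 0 := by
  obtain ⟨e⟩ : Nonempty (R3 ≃L[ℝ] ℝ × R2) :=
    FiniteDimensional.nonempty_continuousLinearEquiv_of_finrank_eq (by simp)
  set K := Icc 0 L ×ˢ Metric.closedBall (0 : R2) 1 with hK
  have hKi : interior K = Ioo 0 L ×ˢ Metric.ball (0 : R2) 1 := by
    rw [hK, interior_prod_eq, interior_Icc, interior_closedBall _ one_ne_zero]
  have hconv : Convex ℝ (e ⁻¹' K) :=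
    ((convex_Icc 0 L).prod (convex_closedBall 0 1)).linear_preimage (e : R3 →ₗ[ℝ] ℝ × R2)
  have hsub : closure (g '' (Icc 0 L ×ˢ Metric.ball (0 : R2) 1)) \
      interior (g '' (Icc 0 L ×ˢ Metric.ball (0 : R2) 1)) ⊆ (g ∘ e) '' frontier (e ⁻¹' K) := by
    rintro x ⟨hx, hx'⟩
    rw [h.closure_image] at hx
    obtain ⟨z, hz, rfl⟩ := hx
    refine ⟨e.symm z, ⟨subset_closure (by rwa [mem_preimage, e.apply_symm_apply]), fun hi => hx' ?_⟩, by simp⟩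
    have h1 := e.toHomeomorph.preimage_interior K
    change e ⁻¹' interior K = interior (e ⁻¹' K) at h1
    rw [← h1, hKi] at hi
    exact h.image_subset_interior ⟨z, by simpa using hi, rfl⟩
  refine measure_mono_null hsub (addHaar_image_eq_zero_of_differentiableOn_of_addHaar_eq_zero
    volume ?_ (hconv.addHaar_frontier volume))
  exact ((h.contDiff.differentiable (by simp)).comp e.differentiable).differentiableOn

theorem exists_cone_open (h : IsTube loop L g) (hl : ¬ loop) {z₀ : ℝ × R2}
    (hz₀ : z₀ ∈ Icc 0 L ×ˢ Metric.closedBall (0 : R2) 1) :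
    ∃ U : Set R3, IsOpen U ∧ g z₀ ∈ U ∧ ∃ (ξ : R3) (c δ₀ : ℝ), 0 < c ∧ 0 < δ₀ ∧
      ∀ x ∈ U ∩ g '' (Icc 0 L ×ˢ Metric.closedBall (0 : R2) 1), ∀ δ ∈ Ioo 0 δ₀,
        Metric.ball (x + δ • ξ) (δ * c) ⊆ g '' (Icc 0 L ×ˢ Metric.ball (0 : R2) 1) := by
  have hL := h.L_pos
  -- the axis of the cone points to the center of the cylinder
  refine exists_cone_of_injective (d := (L / 2 - z₀.1, - z₀.2)) (r := min (L / 2) 1 / 2) (v := 0)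
    h.contDiff.continuous (h.hasStrictFDerivAt z₀) (h.immersion z₀ hz₀).2 (by positivity)
    isCompact_domain Subset.rfl (fun z hz => by simpa using hz) (fun z => by simp)
    (fun z hz hzz => Or.inl (h.inj hl hz hz₀ hzz)) ?_
  rintro ⟨s, y⟩ ⟨hs, hy⟩ hzr δ ⟨hδ, hδ1⟩ ⟨s', y'⟩ hx
  obtain ⟨s₀, y₀⟩ := z₀
  have hm1 : min (L / 2) 1 ≤ L / 2 := min_le_left _ _
  have hm2 : min (L / 2) 1 ≤ 1 := min_le_right _ _
  set r := min (L / 2) 1 / 2 with hr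
  rw [Prod.dist_eq, max_lt_iff] at hzr
  rw [Metric.mem_ball, Prod.dist_eq, max_lt_iff] at hx
  simp only [Prod.smul_mk, Prod.mk_add_mk, smul_eq_mul, Real.dist_eq, mem_Icc,
    mem_closedBall_zero_iff] at hx hzr hs hy
  refine ⟨?_, ?_⟩
  · have h1 := abs_lt.1 hx.1
    have h2 := abs_lt.1 hzr.1
    change 0 ≤ s' ∧ s' ≤ L
    constructor <;> nlinarith [hs.1, hs.2]
  · rw [mem_ball_zero_iff]
    have h1 : y' = (y' - (y + δ • -y₀)) + (1 - δ) • y + δ • (y - y₀) := by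
      module
    have h2 : ‖y' - (y + δ • -y₀)‖ < δ * r := by rw [← dist_eq_norm]; exact hx.2
    have h3 : ‖y - y₀‖ < r := by rw [← dist_eq_norm]; exact hzr.2
    rw [h1]
    refine (norm_add₃_le).trans_lt ?_
    rw [norm_smul, norm_smul, Real.norm_of_nonneg hδ.le,
      Real.norm_of_nonneg (by linarith : 0 ≤ 1 - δ)]
    nlinarith

theorem image_univ_subset (h : IsTube loop L g) (hl : loop) :
    g '' (univ ×ˢ Metric.ball (0 : R2) 1) ⊆ g '' (Icc 0 L ×ˢ Metric.ball (0 : R2) 1) := by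
  rintro _ ⟨⟨s, y⟩, ⟨-, hy⟩, rfl⟩
  have hper : Function.Periodic (fun s => g (s, y)) L := fun s => h.periodic hl s y
  obtain ⟨s', hs', he⟩ := hper.exists_mem_Ico₀ h.L_pos s
  exact ⟨(s', y), ⟨Ico_subset_Icc_self hs', hy⟩, he.symm⟩

theorem exists_cone_loop (h : IsTube loop L g) (hl : loop) {z₀ : ℝ × R2}
    (hz₀ : z₀ ∈ Ico 0 L ×ˢ Metric.closedBall (0 : R2) 1) :
    ∃ U : Set R3, IsOpen U ∧ g z₀ ∈ U ∧ ∃ (ξ : R3) (c δ₀ : ℝ), 0 < c ∧ 0 < δ₀ ∧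
      ∀ x ∈ U ∩ g '' (Icc 0 L ×ˢ Metric.closedBall (0 : R2) 1), ∀ δ ∈ Ioo 0 δ₀,
        Metric.ball (x + δ • ξ) (δ * c) ⊆ g '' (Icc 0 L ×ˢ Metric.ball (0 : R2) 1) := by
  have hz₀' : z₀ ∈ Icc 0 L ×ˢ Metric.closedBall (0 : R2) 1 := ⟨Ico_subset_Icc_self hz₀.1, hz₀.2⟩
  have hgv : ∀ z, g (z + (L, (0 : R2))) = g z := by
    rintro ⟨s, y⟩
    simpa using h.periodic hl s y
  have key := exists_cone_of_injective (d := ((0 : ℝ), - z₀.2)) (r := 1 / 2) (v := (L, (0 : R2)))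
    (K' := univ ×ˢ Metric.closedBall (0 : R2) 1) (J := univ ×ˢ Metric.ball (0 : R2) 1)
    h.contDiff.continuous (h.hasStrictFDerivAt z₀) (h.immersion z₀ hz₀').2 (by norm_num)
    (isCompact_domain (L := L)) (prod_mono_left (subset_univ _))
    (fun z hz => ⟨mem_univ _, by simpa using hz.2⟩) hgv ?_ ?_
  · obtain ⟨U, hU, hz, ξ, c, δ₀, hc, hδ₀, hb⟩ := key
    exact ⟨U, hU, hz, ξ, c, δ₀, hc, hδ₀, fun x hx δ hδ =>
      (hb x hx δ hδ).trans (h.image_univ_subset hl)⟩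
  · rintro ⟨s, y⟩ ⟨hs, hy⟩ hzz
    rcases lt_or_eq_of_le hs.2 with h1 | h1
    · exact Or.inl (h.inj_loop hl ⟨⟨hs.1, h1⟩, hy⟩ hz₀ hzz)
    · right
      have h2 : g ((0 : ℝ), y) = g z₀ := by
        rw [← hzz, ← hgv]
        congr 1
        simpa using h1.symm
      have h3 := h.inj_loop hl (mk_mem_prod (left_mem_Ico.2 h.L_pos) hy) hz₀ h2
      rw [← h3]
      simpa using h1
  · rintro ⟨s, y⟩ ⟨-, hy⟩ hzr δ ⟨hδ, hδ1⟩ ⟨s', y'⟩ hx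
    obtain ⟨s₀, y₀⟩ := z₀
    rw [Prod.dist_eq, max_lt_iff] at hzr
    rw [Metric.mem_ball, Prod.dist_eq, max_lt_iff] at hx
    simp only [Prod.smul_mk, Prod.mk_add_mk, mem_closedBall_zero_iff] at hx hzr hy
    refine ⟨mem_univ _, ?_⟩
    rw [mem_ball_zero_iff]
    have h1 : y' = (y' - (y + δ • -y₀)) + (1 - δ) • y + δ • (y - y₀) := by
      module
    have h2 : ‖y' - (y + δ • -y₀)‖ < δ * (1 / 2) := by rw [← dist_eq_norm]; exact hx.2
    have h3 : ‖y - y₀‖ < 1 / 2 := by rw [← dist_eq_norm]; exact hzr.2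
    rw [h1]
    refine (norm_add₃_le).trans_lt ?_
    rw [norm_smul, norm_smul, Real.norm_of_nonneg hδ.le,
      Real.norm_of_nonneg (by linarith : 0 ≤ 1 - δ)]
    nlinarith

/-- Tubes satisfy the uniform interior cone condition. -/
theorem exists_cone (h : IsTube loop L g) {x₀ : R3}
    (hx₀ : x₀ ∈ closure (g '' (Icc 0 L ×ˢ Metric.ball (0 : R2) 1))) :
    ∃ U : Set R3, IsOpen U ∧ x₀ ∈ U ∧ ∃ (ξ : R3) (c δ₀ : ℝ), 0 < c ∧ 0 < δ₀ ∧
      ∀ x ∈ U ∩ closure (g '' (Icc 0 L ×ˢ Metric.ball (0 : R2) 1)), ∀ δ ∈ Ioo 0 δ₀,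
        Metric.ball (x + δ • ξ) (δ * c) ⊆ g '' (Icc 0 L ×ˢ Metric.ball (0 : R2) 1) := by
  rw [h.closure_image] at hx₀ ⊢
  obtain ⟨⟨s, y⟩, hz, rfl⟩ := hx₀
  by_cases hl : loop
  · rcases lt_or_eq_of_le hz.1.2 with h1 | h1
    · exact h.exists_cone_loop hl ⟨⟨hz.1.1, h1⟩, hz.2⟩
    · have h2 : g (s, y) = g (0, y) := by
        rw [← h.periodic hl 0 y]
        congr 2
        simpa using h1
      rw [h2]
      exact h.exists_cone_loop hl ⟨⟨le_rfl, h.L_pos⟩, hz.2⟩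
  · exact h.exists_cone_open hl hz

end IsTube

/-! ### Configurations of separated filaments -/

theorem act_apply (A : Mat3) (x : R3) (a : Fin 3) : act A x a = ∑ b, A a b * x b := rfl

/-- The product with a matrix as a continuous linear map. -/
def actL (A : Mat3) : R3 →L[ℝ] R3 :=
  LinearMap.toContinuousLinearMap
    { toFun := act A
      map_add' := fun x y => by simp [act, Matrix.mulVec_add]
      map_smul' := fun c x => by simp [act, Matrix.mulVec_smul] }

theorem actL_apply (A : Mat3) (x : R3) : actL A x = act A x := rfl

theorem bijective_actL {Q : Mat3} (hQ : Q ∈ Matrix.specialOrthogonalGroup (Fin 3) ℝ) :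
    Function.Bijective (actL Q) := by
  have h1 := (Matrix.mem_specialOrthogonalGroup_iff.1 hQ).1
  have h2 : Q * Qᵀ = 1 := Matrix.mem_orthogonalGroup_iff (Fin 3) ℝ |>.1 h1
  have h3 : Qᵀ * Q = 1 := Matrix.mem_orthogonalGroup_iff' (Fin 3) ℝ |>.1 h1
  refine Function.bijective_iff_has_inverse.2 ⟨actL Qᵀ, fun x => ?_, fun x => ?_⟩
  · simp [actL_apply, act, h3]
  · simp [actL_apply, act, h2]

theorem Filament.contDiff_tube (f : Filament) (ε : ℝ) : ContDiff ℝ 1 (f.tube ε) := by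
  refine contDiff_euclidean.2 fun a => ?_
  have hγ : ContDiff ℝ ∞ fun z : ℝ × R2 => f.γ z.1 a :=
    (contDiff_euclidean.1 f.γ_smooth a).comp contDiff_fst
  have hR : ∀ b, ContDiff ℝ ∞ fun z : ℝ × R2 => f.R z.1 a b := fun b =>
    (f.R_smooth a b).comp contDiff_fst
  have hΨ : ∀ b, ContDiff ℝ ∞ fun z : ℝ × R2 => inPlane (f.Ψ z.1 z.2) b := by
    intro b
    fin_cases b
    · exact contDiff_euclidean.1 f.Ψ_smooth 0
    · exact contDiff_euclidean.1 f.Ψ_smooth 1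
    · exact contDiff_const
  have h : ContDiff ℝ ∞ fun z : ℝ × R2 =>
      f.γ z.1 a + ε * ∑ b, f.R z.1 a b * inPlane (f.Ψ z.1 z.2) b :=
    hγ.add (contDiff_const.mul (ContDiff.sum fun b _ => (hR b).mul (hΨ b)))
  exact h.of_le (by simp)

/-- The parametrization of the filament in a given position and orientation. -/
def Filament.bodyMap (f : Filament) (ε : ℝ) (h : R3) (Q : Mat3) (z : ℝ × R2) : R3 :=
  h + act Q (f.tube ε z - f.center ε)

theorem Filament.body_eq (f : Filament) (ε : ℝ) (h : R3) (Q : Mat3) :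
    f.body ε h Q = f.bodyMap ε h Q '' (Icc 0 f.L ×ˢ Metric.ball (0 : R2) 1) := by
  ext x
  constructor
  · rintro ⟨_, ⟨s, hs, y, hy, rfl⟩, rfl⟩
    exact ⟨(s, y), ⟨hs, hy⟩, rfl⟩
  · rintro ⟨⟨s, y⟩, ⟨hs, hy⟩, rfl⟩
    exact ⟨_, ⟨s, hs, y, hy, rfl⟩, rfl⟩

theorem Filament.isTube_bodyMap (f : Filament) {ε : ℝ} (hf : f.IsEmbedded ε) (h : R3) {Q : Mat3}
    (hQ : Q ∈ Matrix.specialOrthogonalGroup (Fin 3) ℝ) :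
    IsTube f.IsLoop f.L (f.bodyMap ε h Q) := by
  have hinj : ∀ {z z'}, f.bodyMap ε h Q z = f.bodyMap ε h Q z' → f.tube ε z = f.tube ε z' :=
    fun e => sub_left_injective ((bijective_actL hQ).1 (add_right_injective h e))
  have hd : ∀ z, HasFDerivAt (f.bodyMap ε h Q) (actL Q ∘L fderiv ℝ (f.tube ε) z) z := fun z =>
    ((actL Q).hasFDerivAt.comp z
      (((f.contDiff_tube ε).differentiable (by simp) z).hasFDerivAt.sub_const _)).const_add h
  refine ⟨f.L_pos, ?_, fun hl z hz z' hz' e => hf.inj hl hz hz' (hinj e),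
    fun hl z hz z' hz' e => hf.inj_loop hl hz hz' (hinj e), fun z hz => ?_, fun hl s y => ?_⟩
  · exact contDiff_const.add ((actL Q).contDiff.comp ((f.contDiff_tube ε).sub contDiff_const))
  · rw [(hd z).fderiv]
    exact (bijective_actL hQ).comp (hf.immersion z hz)
  · simp only [bodyMap, tube, f.γ_periodic hl s, f.R_periodic hl s, f.Ψ_periodic hl s]

theorem Filament.refSet_eq_body (f : Filament) (ε : ℝ) : f.refSet ε = f.body ε (f.center ε) 1 := by
  simp [body, act]

theorem Filament.mass_pos (f : Filament) {ε : ℝ} (hf : f.IsEmbedded ε) (hε : 0 < ε) {ρ : ℝ}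
    (hρ : 0 < ρ) : 0 < f.mass ε ρ := by
  have ht := f.isTube_bodyMap hf (f.center ε) (one_mem _)
  have hvol : 0 < volume.real (f.refSet ε) := by
    rw [f.refSet_eq_body, f.body_eq]
    refine ENNReal.toReal_pos ?_ ?_
    · exact (Measure.measure_pos_of_nonempty_interior _ ht.nonempty_interior).ne'
    · exact ((measure_mono subset_closure).trans_lt ht.isCompact_closure_image.measure_lt_top).ne
  rw [mass]
  positivity

/-- The geometric properties of a configuration of filaments on which the analysis relies. -/
structure IsRegularConfiguration {N : ℕ} (S : Fin N → Set R3) : Prop where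
  isCompact_closure : ∀ j, IsCompact (closure (S j))
  separated : Separated S
  nonempty_interior : ∀ j, (interior (S j)).Nonempty
  volume_boundary : ∀ j, volume (closure (S j) \ interior (S j)) = 0
  cone : HasLocalCone (⋃ j, S j) (⋃ j, closure (S j))

theorem isRegularConfiguration_body {N : ℕ} (fil : Fin N → Filament) {ε : ℝ}
    (hf : ∀ i, (fil i).IsEmbedded ε) (h : Fin N → R3) {Q : Fin N → Mat3}
    (hQ : ∀ i, Q i ∈ Matrix.specialOrthogonalGroup (Fin 3) ℝ)
    (hsep : Separated fun i => (fil i).body ε (h i) (Q i)) :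
    IsRegularConfiguration fun i => (fil i).body ε (h i) (Q i) := by
  have ht := fun i => (fil i).isTube_bodyMap (hf i) (h i) (hQ i)
  have hcpt : ∀ i, IsCompact (closure ((fil i).body ε (h i) (Q i))) := fun i => by
    rw [Filament.body_eq]; exact (ht i).isCompact_closure_image
  refine ⟨hcpt, hsep, fun i => ?_, fun i => ?_, fun x₀ => ?_⟩
  · rw [Filament.body_eq]; exact (ht i).nonempty_interior
  · rw [Filament.body_eq]; exact (ht i).volume_closure_diff_interior
  · by_cases hx₀ : x₀ ∈ ⋃ j, closure ((fil j).body ε (h j) (Q j))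
    · obtain ⟨j, hj⟩ := mem_iUnion.1 hx₀
      have hj' := hj
      rw [Filament.body_eq] at hj'
      obtain ⟨U, hU, hxU, ξ, c, δ₀, hc, hδ₀, hball⟩ := (ht j).exists_cone hj'
      rw [← Filament.body_eq] at hball
      have hcl : IsClosed (⋃ i : {i // i ≠ j}, closure ((fil i).body ε (h i) (Q i))) :=
        isClosed_iUnion_of_finite fun _ => isClosed_closure
      refine ⟨U ∩ (⋃ i : {i // i ≠ j}, closure ((fil i).body ε (h i) (Q i)))ᶜ,
        hU.inter hcl.isOpen_compl, ⟨hxU, fun hx => ?_⟩, ξ, c, δ₀, hc, hδ₀, ?_⟩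
      · obtain ⟨⟨i, hi⟩, hxi⟩ := mem_iUnion.1 hx
        exact (hsep i j hi).le_bot ⟨hxi, hj⟩
      · rintro x ⟨⟨hxU, hxo⟩, hxC⟩ δ hδ
        obtain ⟨i, hi⟩ := mem_iUnion.1 hxC
        have hij : i = j := by
          by_contra hne
          exact hxo (mem_iUnion.2 ⟨⟨i, hne⟩, hi⟩)
        subst hij
        exact (hball x ⟨hxU, hi⟩ δ hδ).trans (subset_iUnion_of_subset i subset_rfl)
    · have hcl : IsClosed (⋃ i, closure ((fil i).body ε (h i) (Q i))) :=
        isClosed_iUnion_of_finite fun _ => isClosed_closure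
      exact ⟨_, hcl.isOpen_compl, hx₀, 0, 1, 1, one_pos, one_pos, fun x hx => absurd hx.2 hx.1⟩

theorem isCompact_frontier_of_closure {s : Set R3} (h : IsCompact (closure s)) :
    IsCompact (frontier s) :=
  h.of_isClosed_subset isClosed_frontier frontier_subset_closure

theorem IsRegularConfiguration.exists_cutoff (hS : IsRegularConfiguration S) (j : Fin N) :
    ∃ χ : R3 → ℝ, ContDiff ℝ ∞ χ ∧ HasCompactSupport χ ∧
      ∀ i, ∀ x ∈ closure (S i), χ x = if i = j then 1 else 0 := by
  have hcl : IsClosed (⋃ i : {i // i ≠ j}, closure (S i)) :=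
    isClosed_iUnion_of_finite fun _ => isClosed_closure
  obtain ⟨χ, hχ, -, hsupp, hone⟩ := exists_contMDiff_support_eq_eq_one_iff 𝓘(ℝ, R3) (n := ⊤)
    (s := Metric.thickening 1 (closure (S j)) ∩ (⋃ i : {i // i ≠ j}, closure (S i))ᶜ)
    (Metric.isOpen_thickening.inter hcl.isOpen_compl) (isClosed_closure (s := S j))
    (fun x hx => ⟨Metric.self_subset_thickening one_pos _ hx, fun hx' => by
      obtain ⟨⟨i, hi⟩, hxi⟩ := mem_iUnion.1 hx'
      exact (hS.separated i j hi).le_bot ⟨hxi, hx⟩⟩)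
  refine ⟨χ, hχ.contDiff, HasCompactSupport.intro ((hS.isCompact_closure j).cthickening (r := 1))
    fun x hx => ?_, fun i x hx => ?_⟩
  · rw [← Function.notMem_support, hsupp]
    exact fun h => hx (Metric.thickening_subset_cthickening _ _ h.1)
  · split_ifs with hij
    · subst hij; exact (hone x).1 hx
    · rw [← Function.notMem_support, hsupp]
      exact fun h => h.2 (mem_iUnion.2 ⟨⟨i, hij⟩, hx⟩)

/-- Prescribed fields on the filaments are the restrictions of one field with compact support. -/
theorem IsRegularConfiguration.exists_extension (hS : IsRegularConfiguration S)
    {d : Fin N → R3 → R3} {m : ℕ∞} (hd : ∀ j, ContDiff ℝ m (d j)) :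
    ∃ φ : R3 → R3, ContDiff ℝ m φ ∧ HasCompactSupport φ ∧
      ∀ j, ∀ x ∈ closure (S j), φ x = d j x := by
  choose χ hχ hχc hχS using hS.exists_cutoff
  refine ⟨fun x => ∑ j, χ j x • d j x,
    ContDiff.sum fun j _ => ((hχ j).of_le (by exact_mod_cast le_top)).smul (hd j), ?_,
    fun j x hx => ?_⟩
  · refine HasCompactSupport.intro (isCompact_iUnion fun j => (hχc j).isCompact) fun x hx => ?_
    refine Finset.sum_eq_zero fun j _ => ?_
    rw [image_eq_zero_of_notMem_tsupport fun h => hx (mem_iUnion.2 ⟨j, h⟩), zero_smul]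
  · simp [hχS _ j x hx]

theorem ae_restrict_iUnion_imp {d : Fin N → R3 → R3} {u : R3 → R3}
    (h : ∀ j, ∀ᵐ x ∂(volume.restrict (S j)), u x = d j x) :
    ∀ᵐ x, ∀ j, x ∈ S j → u x = d j x :=
  ae_all_iff.2 fun j => ae_imp_of_ae_restrict (h j)

/-! ### Tractions of divergence free stress tensors -/

/-- `τ` is the traction on the boundary of the fluid domain of the square integrable tensor field
`σ`, whose rows are divergence free in the fluid domain. -/
structure IsTraction (S : Fin N → Set R3) (σ : R3 → Mat3) (τ : R3 → R3) : Prop where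
  memLp : ∀ a b, MemLp (fun x => σ x a b) 2 (volume.restrict (fluidDomain S))
  integrable : IntegrableOn τ (bodyBoundary S) μHE[2]
  green : ∀ (a : Fin 3) (φ : R3 → ℝ), ContDiff ℝ ∞ φ → HasCompactSupport φ →
    ∑ b, ∫ x in fluidDomain S, σ x a b * fderiv ℝ φ x (basisVec b) =
      ∫ x in bodyBoundary S, τ x a * φ x ∂μHE[2]

theorem integrableOn_component {τ : R3 → R3} {s : Set R3} {μ : Measure R3} (h : IntegrableOn τ s μ)
    (a : Fin 3) : IntegrableOn (fun x => τ x a) s μ :=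
  (EuclideanSpace.proj a : R3 →L[ℝ] ℝ).integrable_comp h

theorem integrableOn_inner_of_continuous {τ d : R3 → R3} {s : Set R3} {μ : Measure R3}
    (h : IntegrableOn τ s μ) (hs : IsCompact s) (hd : Continuous d) :
    IntegrableOn (fun x => inner ℝ (τ x) (d x)) s μ := by
  obtain ⟨C, hC⟩ := hs.exists_bound_of_continuousOn hd.continuousOn
  refine Integrable.mono' (h.norm.mul_const C) (h.1.inner hd.aestronglyMeasurable) ?_
  filter_upwards [ae_restrict_mem hs.measurableSet] with x hx
  exact (norm_inner_le_norm _ _).trans (mul_le_mul_of_nonneg_left (hC x hx) (norm_nonneg _))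

theorem frontier_subset_bodyBoundary (j : Fin N) : frontier (S j) ⊆ bodyBoundary S :=
  subset_iUnion (fun j => frontier (S j)) j

theorem IsRegularConfiguration.integral_bodyBoundary (hS : IsRegularConfiguration S) {f : R3 → ℝ}
    (hf : ∀ j, IntegrableOn f (frontier (S j)) μHE[2]) :
    ∫ x in bodyBoundary S, f x ∂μHE[2] = ∑ j, ∫ x in frontier (S j), f x ∂μHE[2] :=
  integral_iUnion_fintype (fun _ => isClosed_frontier.measurableSet)
    (fun i j hij => (hS.separated i j hij).mono frontier_subset_closure frontier_subset_closure) hf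

theorem setIntegral_fluidDomain_indicator (f g : R3 → ℝ) :
    ∫ x, (fluidDomain S).indicator f x * g x = ∫ x in fluidDomain S, f x * g x := by
  rw [← integral_indicator isOpen_fluidDomain.measurableSet]
  refine integral_congr_ae (Eventually.of_forall fun x => ?_)
  by_cases hx : x ∈ fluidDomain S <;> simp [hx]

theorem IsScalarDotH1.sub_contDiff {w : R3 → ℝ} {g : Fin 3 → R3 → ℝ} (h : IsScalarDotH1 w g)
    {ψ : R3 → ℝ} (hψ : ContDiff ℝ 1 ψ) (hψc : HasCompactSupport ψ) :
    IsScalarDotH1 (fun x => w x - ψ x) (fun b x => g b x - fderiv ℝ ψ x (basisVec b)) := by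
  refine ⟨h.memL6.sub (hψ.continuous.memLp_of_hasCompactSupport hψc), fun b =>
    (h.grad_memL2 b).sub ((continuous_pderiv hψ _).memLp_of_hasCompactSupport
      (hψc.fderiv_apply ℝ _)), fun ζ hζ hζc b => ?_⟩
  have h1 := h.weak_grad ζ hζ hζc b
  have h2 := isWeakGradient_of_contDiff hψ ζ hζ hζc b
  have c1 := (contDiff_pderiv hζ (basisVec b)).continuous
  have c2 := hζc.fderiv_apply ℝ (basisVec b)
  have i1 : Integrable (fun x => w x * fderiv ℝ ζ x (basisVec b)) volume := by
    simpa [mul_comm] using h.locallyIntegrable.integrable_smul_left_of_hasCompactSupport c1 c2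
  have i2 : Integrable (fun x => ψ x * fderiv ℝ ζ x (basisVec b)) volume :=
    (hψ.continuous.mul c1).integrable_of_hasCompactSupport c2.mul_left
  have i3 : Integrable (fun x => g b x * ζ x) volume := by
    simpa [mul_comm] using ((h.grad_memL2 b).locallyIntegrable
      (by norm_num)).integrable_smul_left_of_hasCompactSupport hζ.continuous hζc
  have i4 : Integrable (fun x => fderiv ℝ ψ x (basisVec b) * ζ x) volume :=
    ((continuous_pderiv hψ _).mul hζ.continuous).integrable_of_hasCompactSupport hζc.mul_left
  simp only [sub_mul]
  rw [integral_sub i1 i2, integral_sub i3 i4, h1, h2]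
  ring

/-- Green's formula for a traction and a field of `Ḣ¹` with smooth values on the filaments. -/
theorem IsTraction.integral_contract (hS : IsRegularConfiguration S) {σ : R3 → Mat3} {τ : R3 → R3}
    (h : IsTraction S σ τ) {u : R3 → R3} {G : R3 → Mat3} (hu : IsDotH1 u G)
    {d : Fin N → R3 → R3} (hd : ∀ j, ContDiff ℝ 1 (d j))
    (hud : ∀ j, ∀ᵐ x ∂(volume.restrict (S j)), u x = d j x) :
    ∫ x in fluidDomain S, contract (σ x) (G x) =
      ∑ j, ∫ x in frontier (S j), inner ℝ (τ x) (d j x) ∂μHE[2] := by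
  obtain ⟨φ, hφ, hφc, hφd⟩ := hS.exists_extension (m := 1) (by exact_mod_cast hd)
  have hφ1 : ContDiff ℝ 1 φ := by exact_mod_cast hφ
  have hφa : ∀ a, ContDiff ℝ 1 fun x => φ x a := fun a => contDiff_euclidean.1 hφ1 a
  have hφac : ∀ a, HasCompactSupport fun x => φ x a := fun a =>
    hφc.comp_left (g := fun v : R3 => v a) rfl
  have hφ2 : ∀ a b, MemLp (fun x => fderiv ℝ (fun x => φ x a) x (basisVec b)) 2 volume :=
    fun a b => (continuous_pderiv (hφa a) _).memLp_of_hasCompactSupport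
      ((hφac a).fderiv_apply ℝ _)
  have hFm : MeasurableSet (fluidDomain S) := isOpen_fluidDomain.measurableSet
  have hs2 : ∀ a b, MemLp ((fluidDomain S).indicator fun x => σ x a b) 2 volume := fun a b =>
    (memLp_indicator_iff_restrict hFm).2 (h.memLp a b)
  have hae := ae_restrict_iUnion_imp hud
  have hrow : ∀ a, ∑ b, ∫ x in fluidDomain S, σ x a b * G x a b =
      ∫ x in bodyBoundary S, τ x a * φ x a ∂μHE[2] := by
    intro a
    -- the difference with the extension vanishes on the filaments
    have hw := (hu.component a).sub_contDiff (hφa a) (hφac a)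
    have hzero := hw.sum_integral_mul_eq_zero hS.cone (hs2 a) (fun ζ hζ hζc hζF => ?_) ?_
    · have hsub : ∀ b, ∫ x, (fluidDomain S).indicator (fun x => σ x a b) x *
          (G x a b - fderiv ℝ (fun x => φ x a) x (basisVec b)) =
          (∫ x in fluidDomain S, σ x a b * G x a b) -
            ∫ x, (fluidDomain S).indicator (fun x => σ x a b) x *
              fderiv ℝ (fun x => φ x a) x (basisVec b) := by
        intro b
        rw [← setIntegral_fluidDomain_indicator]
        simp only [mul_sub]
        exact integral_sub ((hs2 a b).integrable_mul (hu.grad_memL2 a b))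
          ((hs2 a b).integrable_mul (hφ2 a b))
      rw [Finset.sum_congr rfl fun b _ => hsub b, Finset.sum_sub_distrib, sub_eq_zero] at hzero
      rw [hzero]
      refine green_of_contDiff_one (fun b => (hs2 a b).locallyIntegrable (by norm_num))
        (integrableOn_component h.integrable a) (fun ζ hζ hζc => ?_) (hφa a) (hφac a)
      simp only [setIntegral_fluidDomain_indicator]
      exact h.green a ζ hζ hζc
    · simp only [setIntegral_fluidDomain_indicator]
      rw [h.green a ζ hζ hζc]
      refine setIntegral_eq_zero_of_forall_eq_zero fun x hx => ?_
      rw [image_eq_zero_of_notMem_tsupport fun hx' =>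
        bodyBoundary_disjoint_fluidDomain hx (hζF hx'), mul_zero]
    · filter_upwards [hae] with x hx hxA
      obtain ⟨j, hj⟩ := mem_iUnion.1 hxA
      rw [hx j hj, hφd j x (subset_closure hj), sub_self]
  have hi1 : ∀ a b, IntegrableOn (fun x => σ x a b * G x a b) (fluidDomain S) := fun a b =>
    (h.memLp a b).integrable_mul ((hu.grad_memL2 a b).restrict _)
  have hi2 : ∀ a, IntegrableOn (fun x => τ x a * φ x a) (bodyBoundary S) μHE[2] := fun a => by
    obtain ⟨C, hC⟩ := (hφa a).continuous.bounded_above_of_compact_support (hφac a)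
    exact integrable_mul_of_bounded (integrableOn_component h.integrable a)
      (hφa a).continuous.aestronglyMeasurable hC
  calc ∫ x in fluidDomain S, contract (σ x) (G x)
      = ∑ a, ∑ b, ∫ x in fluidDomain S, σ x a b * G x a b := by
        simp only [contract]
        rw [integral_finsetSum _ fun a _ => integrable_finsetSum _ fun b _ => hi1 a b]
        exact Finset.sum_congr rfl fun a _ => integral_finsetSum _ fun b _ => hi1 a b
    _ = ∫ x in bodyBoundary S, inner ℝ (τ x) (φ x) ∂μHE[2] := by
        simp only [inner_eq_sum]
        rw [integral_finsetSum _ fun a _ => hi2 a]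
        exact Finset.sum_congr rfl fun a _ => hrow a
    _ = ∑ j, ∫ x in frontier (S j), inner ℝ (τ x) (d j x) ∂μHE[2] := by
        rw [hS.integral_bodyBoundary fun j => integrableOn_inner_of_continuous
          (h.integrable.mono_set (frontier_subset_bodyBoundary j))
          (isCompact_frontier_of_closure (hS.isCompact_closure j)) hφ1.continuous]
        refine Finset.sum_congr rfl fun j _ => setIntegral_congr_fun
          isClosed_frontier.measurableSet fun x hx => ?_
        simp only [hφd j x (frontier_subset_closure hx)]

/-- The normal trace of the stress tensor of a Stokes flow is a traction. -/
theorem IsStokesSolution.isTraction {d : Fin N → R3 → R3} {u : R3 → R3}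
    {G : R3 → Mat3} {p : R3 → ℝ} (h : IsStokesSolution S d u G p) {τ : R3 → R3}
    (hτ : HasNormalTrace S (fun x => stress (G x) (p x)) τ) :
    IsTraction S (fun x => stress (G x) (p x)) τ := by
  refine ⟨h.stress_memLp, hτ.integrable, ?_⟩
  obtain ⟨g, hg, hgreen⟩ := hτ.exists_divergence
  have hg0 : ∀ a, ∀ᵐ x, x ∈ fluidDomain S → (fluidDomain S).indicator (g a) x = 0 := by
    intro a
    refine isOpen_fluidDomain.ae_eq_zero_of_integral_contDiff_smul_eq_zero
      ((hg a).locallyIntegrableOn _) fun φ hφ hφc hφF => ?_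
    have h1 := hgreen a φ hφ hφc
    rw [h.sum_integral_stress_mul_eq_zero hφ hφc hφF a, zero_add] at h1
    simp only [smul_eq_mul, mul_comm (φ _)]
    rw [setIntegral_fluidDomain_indicator, h1]
    refine setIntegral_eq_zero_of_forall_eq_zero fun x hx => ?_
    rw [image_eq_zero_of_notMem_tsupport fun hx' =>
      bodyBoundary_disjoint_fluidDomain hx (hφF hx'), mul_zero]
  intro a φ hφ hφc
  rw [← hgreen a φ hφ hφc, left_eq_add]
  refine setIntegral_eq_zero_of_ae_eq_zero ?_
  filter_upwards [hg0 a] with x hx hxF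
  have := hx hxF
  rw [indicator_of_mem hxF] at this
  rw [this, zero_mul]

theorem contract_stress_comm {G G' : Mat3} (hG : G.trace = 0) (hG' : G'.trace = 0) (p p' : ℝ) :
    contract (stress G p) G' = contract (stress G' p') G := by
  simp only [Matrix.trace, Fin.sum_univ_three, Matrix.diag_apply] at hG hG'
  simp only [contract, stress_apply, Fin.sum_univ_three, Matrix.one_apply]
  simp
  linear_combination p' * hG - p * hG'

/-- The reciprocal theorem: the power of the stress of one Stokes flow against another one is
symmetric. -/
theorem IsStokesSolution.integral_contract_comm {d d' : Fin N → R3 → R3} {u u' : R3 → R3}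
    {G G' : R3 → Mat3} {p p' : R3 → ℝ} (h : IsStokesSolution S d u G p)
    (h' : IsStokesSolution S d' u' G' p') :
    ∫ x in fluidDomain S, contract (stress (G x) (p x)) (G' x) =
      ∫ x in fluidDomain S, contract (stress (G' x) (p' x)) (G x) := by
  refine integral_congr_ae ?_
  filter_upwards [h.incompressible, h'.incompressible] with x hx hx'
  exact contract_stress_comm hx hx' _ _

/-! ### Rigid velocity fields -/

/-- The cross product with a fixed vector as a continuous linear map. -/
def crossL (w : R3) : R3 →L[ℝ] R3 :=
  LinearMap.toContinuousLinearMap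
    { toFun := cross w
      map_add' := fun x y => by simp [cross]
      map_smul' := fun c x => by simp [cross] }

theorem crossL_apply (w x : R3) : crossL w x = cross w x := rfl

theorem cross_basisVec_antisymm (w : R3) (a b : Fin 3) :
    cross w (basisVec b) a = - cross w (basisVec a) b := by
  fin_cases a <;> fin_cases b <;> simp [cross, basisVec, cross_apply]

theorem eq_zero_of_cross_basisVec {w : R3} (h : ∀ b, cross w (basisVec b) = 0) : w = 0 := by
  have h0 := congrArg (fun v : R3 => v 1) (h 0)
  have h1 := congrArg (fun v : R3 => v 0) (h 2)
  have h2 := congrArg (fun v : R3 => v 2) (h 1)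
  simp [cross, basisVec, cross_apply] at h0 h1 h2
  ext a
  fin_cases a <;> simp [h0, h1, h2]

/-- A rigid velocity field is the combination of the elementary ones. -/
theorem sum_smul_rigidField (Y : Dof → ℝ) (h x : R3) :
    ∑ α, Y α • rigidField h α x =
      WithLp.toLp 2 (fun a => Y (Sum.inl a)) +
        cross (WithLp.toLp 2 fun a => Y (Sum.inr a)) (x - h) := by
  ext a
  simp only [Fintype.sum_sum_type, Fin.sum_univ_three, rigidField]
  fin_cases a <;> simp [cross, basisVec, cross_apply] <;> ring

theorem hasFDerivAt_rigid (v w h x : R3) :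
    HasFDerivAt (fun y => v + cross w (y - h)) (crossL w) x :=
  ((crossL w).hasFDerivAt.comp x ((hasFDerivAt_id x).sub_const h)).const_add v

theorem contDiff_rigid (v w h : R3) {m : ℕ∞} : ContDiff ℝ m fun y => v + cross w (y - h) :=
  contDiff_const.add ((crossL w).contDiff.comp (contDiff_id.sub contDiff_const))

theorem fderiv_rigid_component (v w h x : R3) (a b : Fin 3) :
    fderiv ℝ (fun y => (v + cross w (y - h)) a) x (basisVec b) = cross w (basisVec b) a := by
  have h1 := (EuclideanSpace.proj a : R3 →L[ℝ] ℝ).hasFDerivAt.comp x (hasFDerivAt_rigid v w h x)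
  have h2 : fderiv ℝ (fun y => (v + cross w (y - h)) a) x =
      (EuclideanSpace.proj a : R3 →L[ℝ] ℝ) ∘L crossL w := h1.fderiv
  rw [h2]
  rfl

theorem contDiff_rigidField (h : R3) (α : Dof) {m : ℕ∞} : ContDiff ℝ m (rigidField h α) := by
  cases α with
  | inl a => exact contDiff_const
  | inr a => simpa [rigidField] using contDiff_rigid 0 (basisVec a) h (m := m)

/-- A rigid velocity field that vanishes on a nonempty open set is zero. -/
theorem rigid_eq_zero {v w h : R3} {O : Set R3} (hO : IsOpen O) (hne : O.Nonempty)
    (hz : ∀ x ∈ O, v + cross w (x - h) = 0) : v = 0 ∧ w = 0 := by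
  obtain ⟨x, hx⟩ := hne
  have h1 : (fun y => v + cross w (y - h)) =ᶠ[𝓝 x] fun _ => 0 := by
    filter_upwards [hO.mem_nhds hx] with y hy using hz y hy
  have h2 := (hasFDerivAt_rigid v w h x).fderiv
  rw [h1.fderiv_eq, fderiv_const_apply] at h2
  have hw : w = 0 := eq_zero_of_cross_basisVec fun b => by
    rw [← crossL_apply, ← h2]; rfl
  refine ⟨?_, hw⟩
  have h3 := hz x hx
  subst hw
  simpa [cross] using h3

/-! ### The resistance matrix -/

theorem IsDotH1.sum {ι : Type*} [Fintype ι] {u : ι → R3 → R3} {G : ι → R3 → Mat3}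
    (h : ∀ k, IsDotH1 (u k) (G k)) (c : ι → ℝ) :
    IsDotH1 (fun x => ∑ k, c k • u k x) (fun x => ∑ k, c k • G k x) := by
  refine ⟨memLp_finsetSum _ fun k _ => (h k).memL6.const_smul (c k), fun a b => ?_,
    fun φ hφ hφc a b => ?_⟩
  · simp only [Matrix.sum_apply, Matrix.smul_apply]
    exact memLp_finsetSum _ fun k _ => ((h k).grad_memL2 a b).const_smul (c k)
  · have c1 := (contDiff_pderiv hφ (basisVec b)).continuous
    have c2 := hφc.fderiv_apply ℝ (basisVec b)
    have i1 : ∀ k, Integrable (fun x => u k x a * fderiv ℝ φ x (basisVec b)) volume := fun k => by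
      simpa [mul_comm] using
        ((h k).component a).locallyIntegrable.integrable_smul_left_of_hasCompactSupport c1 c2
    have i2 : ∀ k, Integrable (fun x => G k x a b * φ x) volume := fun k => by
      simpa [mul_comm] using (((h k).grad_memL2 a b).locallyIntegrable
        (by norm_num)).integrable_smul_left_of_hasCompactSupport hφ.continuous hφc
    have e1 : ∀ x, (∑ k, c k • u k x) a * fderiv ℝ φ x (basisVec b) =
        ∑ k, c k * (u k x a * fderiv ℝ φ x (basisVec b)) := fun x => by
      simp [Finset.sum_mul, mul_assoc]
    have e2 : ∀ x, (∑ k, c k • G k x) a b * φ x = ∑ k, c k * (G k x a b * φ x) := fun x => by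
      simp [Matrix.sum_apply, Finset.sum_mul, mul_assoc]
    simp only [e1, e2]
    rw [integral_finsetSum _ fun k _ => (i1 k).const_mul _,
      integral_finsetSum _ fun k _ => (i2 k).const_mul _, ← Finset.sum_neg_distrib]
    refine Finset.sum_congr rfl fun k _ => ?_
    rw [integral_const_mul, integral_const_mul, (h k).weak_grad φ hφ hφc a b, mul_neg]

/-- The weak gradient on the filaments is the gradient of the prescribed velocity. -/
theorem IsDotH1.grad_ae_eq (hS : IsRegularConfiguration S) {u : R3 → R3} {G : R3 → Mat3}
    (hu : IsDotH1 u G) {d : Fin N → R3 → R3} (hd : ∀ j, ContDiff ℝ 1 (d j))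
    (hud : ∀ j, ∀ᵐ x ∂(volume.restrict (S j)), u x = d j x) (j : Fin N) :
    ∀ᵐ x, x ∈ interior (S j) →
      ∀ a b, G x a b = fderiv ℝ (fun y => d j y a) x (basisVec b) := by
  obtain ⟨φ, hφ, hφc, hφd⟩ := hS.exists_extension (m := 1) (by exact_mod_cast hd)
  have hφ1 : ContDiff ℝ 1 φ := by exact_mod_cast hφ
  have h1 : ∀ a b, ∀ᵐ x, x ∈ interior (S j) →
      G x a b - fderiv ℝ (fun y => φ y a) x (basisVec b) = 0 := fun a b => by
    refine ((hu.component a).sub_contDiff (contDiff_euclidean.1 hφ1 a)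
      (hφc.comp_left (g := fun v : R3 => v a) rfl)).grad_ae_eq_zero isOpen_interior ?_ b
    filter_upwards [ae_imp_of_ae_restrict (hud j)] with x hx hxj
    rw [hx (interior_subset hxj), hφd j x (subset_closure (interior_subset hxj)), sub_self]
  have h2 : ∀ᵐ x, ∀ a b, x ∈ interior (S j) →
      G x a b - fderiv ℝ (fun y => φ y a) x (basisVec b) = 0 :=
    ae_all_iff.2 fun a => ae_all_iff.2 fun b => h1 a b
  filter_upwards [h2] with x hx hxj a b
  rw [sub_eq_zero.1 (hx a b hxj)]
  have h3 : (fun y => φ y a) =ᶠ[𝓝 x] fun y => d j y a := by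
    filter_upwards [isOpen_interior.mem_nhds hxj] with y hy
    rw [hφd j y (subset_closure (interior_subset hy))]
  rw [h3.fderiv_eq]

theorem IsRegularConfiguration.ae_mem (hS : IsRegularConfiguration S) :
    ∀ᵐ x, x ∈ fluidDomain S ∨ ∃ j, x ∈ interior (S j) := by
  have h1 : ∀ᵐ x, ∀ j, x ∉ closure (S j) \ interior (S j) :=
    ae_all_iff.2 fun j => measure_eq_zero_iff_ae_notMem.1 (hS.volume_boundary j)
  filter_upwards [h1] with x hx
  by_cases hxF : x ∈ fluidDomain S
  · exact Or.inl hxF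
  · obtain ⟨j, hj⟩ := mem_iUnion.1 (not_not.1 hxF)
    exact Or.inr ⟨j, by_contra fun h => hx j ⟨hj, h⟩⟩

section Resistance

variable {h : Fin N → R3} {V : Fin N → Dof → R3 → R3} {GV : Fin N → Dof → R3 → Mat3}
  {P : Fin N → Dof → R3 → ℝ} {τV : Fin N → Dof → R3 → R3}

/-- Green's formula against an elementary Stokes flow. -/
theorem IsTraction.integral_contract_elementary (hS : IsRegularConfiguration S) {σ : R3 → Mat3}
    {τ : R3 → R3} (hτ : IsTraction S σ τ)
    (hV : ∀ i α, IsStokesSolution S (fun j x => if i = j then rigidField (h i) α x else 0)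
      (V i α) (GV i α) (P i α)) (i : Fin N) (α : Dof) :
    ∫ x in fluidDomain S, contract (σ x) (GV i α x) =
      ∫ x in frontier (S i), inner ℝ (τ x) (rigidField (h i) α x) ∂μHE[2] := by
  have hd : ∀ j, ContDiff ℝ 1 fun x => if i = j then rigidField (h i) α x else 0 := by
    intro j
    by_cases hij : i = j
    · simpa [hij] using (contDiff_rigidField (h j) α (m := 1))
    · simpa [hij] using contDiff_const
  rw [hτ.integral_contract hS (hV i α).dotH1 hd (hV i α).boundary, Finset.sum_eq_single i]
  · simp
  · intro j _ hj
    simp [Ne.symm hj]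
  · simp

theorem resistance_eq_integral (hS : IsRegularConfiguration S)
    (hV : ∀ i α, IsStokesSolution S (fun j x => if i = j then rigidField (h i) α x else 0)
      (V i α) (GV i α) (P i α))
    (hτV : ∀ i α, HasNormalTrace S (fun x => stress (GV i α x) (P i α x)) (τV i α))
    (k l : Fin N × Dof) :
    resistance S h τV k l =
      ∫ x in fluidDomain S, contract (stress (GV k.1 k.2 x) (P k.1 k.2 x)) (GV l.1 l.2 x) :=
  (((hV k.1 k.2).isTraction (hτV k.1 k.2)).integral_contract_elementary hS hV l.1 l.2).symm

theorem contract_stress_self {G : Mat3} (hG : G.trace = 0) (p : ℝ) :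
    contract (stress G p) G = ∑ a, ∑ b, (G a b + G b a) ^ 2 / 2 := by
  simp only [Matrix.trace, Fin.sum_univ_three, Matrix.diag_apply] at hG
  simp only [contract, stress_apply, Fin.sum_univ_three, Matrix.one_apply]
  simp
  linear_combination -p * hG

theorem contract_sum_sum {ι : Type*} [Fintype ι] (c : ι → ℝ) (G : ι → Mat3) (p : ι → ℝ) :
    contract (stress (∑ k, c k • G k) (∑ k, c k * p k)) (∑ l, c l • G l) =
      ∑ k, ∑ l, c k * (c l * contract (stress (G k) (p k)) (G l)) := by
  have h1 : ∀ a b, stress (∑ k, c k • G k) (∑ k, c k * p k) a b =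
      ∑ k, c k * stress (G k) (p k) a b := by
    intro a b
    simp only [stress_apply, Matrix.sum_apply, Matrix.smul_apply, smul_eq_mul, mul_sub, mul_add,
      Finset.sum_sub_distrib, Finset.sum_add_distrib, Finset.sum_mul, mul_assoc]
  simp only [contract, h1, Matrix.sum_apply, Matrix.smul_apply, smul_eq_mul]
  simp only [Fin.sum_univ_three, Finset.sum_mul_sum, ← Finset.sum_add_distrib]
  refine Finset.sum_congr rfl fun k _ => Finset.sum_congr rfl fun l _ => ?_
  ring

theorem IsStokesSolution.integrable_contract {d : Fin N → R3 → R3} {u : R3 → R3}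
    {G : R3 → Mat3} {p : R3 → ℝ} (hs : IsStokesSolution S d u G p) {u' : R3 → R3}
    {G' : R3 → Mat3} (hu' : IsDotH1 u' G') :
    IntegrableOn (fun x => contract (stress (G x) (p x)) (G' x)) (fluidDomain S) :=
  integrable_finsetSum _ fun a _ => integrable_finsetSum _ fun b _ =>
    (hs.stress_memLp a b).integrable_mul ((hu'.grad_memL2 a b).restrict _)

/-- The resistance matrix is invertible: its quadratic form is the dissipation of the combined
flow, and a flow without dissipation is at rest. -/
theorem isUnit_det_resistance (hS : IsRegularConfiguration S)
    (hV : ∀ i α, IsStokesSolution S (fun j x => if i = j then rigidField (h i) α x else 0)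
      (V i α) (GV i α) (P i α))
    (hτV : ∀ i α, HasNormalTrace S (fun x => stress (GV i α x) (P i α x)) (τV i α)) :
    IsUnit (resistance S h τV).det := by
  rw [isUnit_iff_ne_zero]
  intro hdet
  obtain ⟨c, hc, hKc⟩ := Matrix.exists_mulVec_eq_zero_iff.2 hdet
  refine hc ?_
  set u : R3 → R3 := fun x => ∑ k : Fin N × Dof, c k • V k.1 k.2 x with hu
  set G : R3 → Mat3 := fun x => ∑ k : Fin N × Dof, c k • GV k.1 k.2 x with hG
  set p : R3 → ℝ := fun x => ∑ k : Fin N × Dof, c k * P k.1 k.2 x with hp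
  have hdot : IsDotH1 u G := IsDotH1.sum (fun k : Fin N × Dof => (hV k.1 k.2).dotH1) c
  -- the dissipation is the quadratic form of the resistance matrix
  have hdiss : ∫ x in fluidDomain S, contract (stress (G x) (p x)) (G x) = 0 := by
    have hi : ∀ k l : Fin N × Dof, IntegrableOn (fun x => c k * (c l *
        contract (stress (GV k.1 k.2 x) (P k.1 k.2 x)) (GV l.1 l.2 x))) (fluidDomain S) :=
      fun k l => (((hV k.1 k.2).integrable_contract (hV l.1 l.2).dotH1).const_mul _).const_mul _
    simp only [hG, hp, contract_sum_sum]
    rw [integral_finsetSum _ fun k _ => integrable_finsetSum _ fun l _ => hi k l]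
    refine Finset.sum_eq_zero fun k _ => ?_
    rw [integral_finsetSum _ fun l _ => hi k l]
    simp only [integral_const_mul, ← resistance_eq_integral hS hV hτV]
    have h1 : ∑ l, resistance S h τV k l * c l = 0 := congrFun hKc k
    rw [← Finset.mul_sum]
    simp only [mul_comm (c _) (resistance S h τV k _), h1, mul_zero]
  have htr : ∀ᵐ x ∂(volume.restrict (fluidDomain S)), (G x).trace = 0 := by
    have h1 : ∀ᵐ x ∂(volume.restrict (fluidDomain S)), ∀ k : Fin N × Dof,
        (GV k.1 k.2 x).trace = 0 := ae_all_iff.2 fun k => (hV k.1 k.2).incompressible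
    filter_upwards [h1] with x hx
    simp [hG, Matrix.trace_sum, Matrix.trace_smul, hx]
  have hantiF : ∀ᵐ x, x ∈ fluidDomain S → ∀ a b, G x a b = - G x b a := by
    refine ae_imp_of_ae_restrict ?_
    have h1 : ∫ x in fluidDomain S, ∑ a, ∑ b, (G x a b + G x b a) ^ 2 / 2 = 0 := by
      rw [← hdiss]
      refine integral_congr_ae ?_
      filter_upwards [htr] with x hx
      rw [contract_stress_self hx]
    have hi : IntegrableOn (fun x => ∑ a, ∑ b, (G x a b + G x b a) ^ 2 / 2) (fluidDomain S) :=
      integrable_finsetSum _ fun a _ => integrable_finsetSum _ fun b _ =>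
        ((((hdot.grad_memL2 a b).add (hdot.grad_memL2 b a)).restrict _).integrable_sq).div_const 2
    rw [integral_eq_zero_iff_of_nonneg (fun x => by positivity) hi] at h1
    filter_upwards [h1] with x hx a b
    have h2 := (Finset.sum_eq_zero_iff_of_nonneg fun a _ => by positivity).1 hx a
      (Finset.mem_univ a)
    have h3 := (Finset.sum_eq_zero_iff_of_nonneg fun b _ => by positivity).1 h2 b
      (Finset.mem_univ b)
    have h4 : G x a b + G x b a = 0 := by
      have : (G x a b + G x b a) ^ 2 = 0 := by linarith
      exact pow_eq_zero_iff (by norm_num) |>.1 this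
    linarith
  set v : Fin N → R3 := fun j => WithLp.toLp 2 fun a => c (j, Sum.inl a) with hv
  set w : Fin N → R3 := fun j => WithLp.toLp 2 fun a => c (j, Sum.inr a) with hw
  have hbd : ∀ j, ∀ᵐ x ∂(volume.restrict (S j)), u x = v j + cross (w j) (x - h j) := by
    intro j
    have h1 : ∀ᵐ x ∂(volume.restrict (S j)), ∀ k : Fin N × Dof,
        V k.1 k.2 x = if k.1 = j then rigidField (h k.1) k.2 x else 0 :=
      ae_all_iff.2 fun k => (hV k.1 k.2).boundary j
    filter_upwards [h1] with x hx
    rw [← sum_smul_rigidField (fun α => c (j, α))]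
    simp only [hu, hx]
    rw [Fintype.sum_prod_type, Finset.sum_eq_single j]
    · simp
    · intro i _ hi
      simp [hi]
    · simp
  have hcd : ∀ j, ContDiff ℝ 1 fun x => v j + cross (w j) (x - h j) := fun j =>
    contDiff_rigid _ _ _ (m := 1)
  have hantiS : ∀ᵐ x, ∀ j, x ∈ interior (S j) → ∀ a b, G x a b = - G x b a := by
    refine ae_all_iff.2 fun j => ?_
    filter_upwards [hdot.grad_ae_eq hS hcd hbd j] with x hx hxj a b
    rw [hx hxj, hx hxj, fderiv_rigid_component, fderiv_rigid_component, cross_basisVec_antisymm]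
  have hu0 : u =ᵐ[volume] 0 := by
    refine hdot.ae_eq_zero_of_deformation ?_
    filter_upwards [hS.ae_mem, hantiF, hantiS] with x hx hxF hxS
    rcases hx with hx | ⟨j, hj⟩
    · exact hxF hx
    · exact hxS j hj
  have hzero : ∀ j, v j = 0 ∧ w j = 0 := by
    intro j
    refine rigid_eq_zero isOpen_interior (hS.nonempty_interior j) (h := h j) fun x hx => ?_
    have h1 : ∀ᵐ y ∂(volume.restrict (interior (S j))), v j + cross (w j) (y - h j) = 0 := by
      have h2 := (ae_restrict_iff' isOpen_interior.measurableSet).2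
        ((ae_imp_of_ae_restrict (hbd j)).mono fun y hy hyj => hy (interior_subset hyj))
      filter_upwards [h2, ae_restrict_of_ae hu0] with y hy hy0
      rw [← hy, hy0]; rfl
    exact Measure.eqOn_open_of_ae_eq h1 isOpen_interior (hcd j).continuous.continuousOn
      continuousOn_const hx
  ext ⟨j, α⟩
  cases α with
  | inl a => exact congrArg (fun z : R3 => z a) (hzero j).1
  | inr a => exact congrArg (fun z : R3 => z a) (hzero j).2

end Resistance

/-! ### The traction of the perturbation flow -/

theorem IsBackgroundFlow.hasFDerivAt {ub : ℝ → R3 → R3} {pb : ℝ → R3 → ℝ}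
    (hb : IsBackgroundFlow ub pb) {t : ℝ} (ht : 0 ≤ t) (x : R3) :
    HasFDerivAt (ub t) (fderivWithin ℝ (fun z : ℝ × R3 => ub z.1 z.2) (Ici (0 : ℝ) ×ˢ univ) (t, x) ∘L
      ContinuousLinearMap.inr ℝ ℝ R3) x := by
  have h1 := (hb.vel_W2.1 (t, x) ⟨ht, mem_univ _⟩).hasFDerivWithinAt
  have h2 : HasFDerivWithinAt (fun y : R3 => (t, y)) (ContinuousLinearMap.inr ℝ ℝ R3) univ x :=
    (hasFDerivAt_prodMk_right t x).hasFDerivWithinAt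
  exact hasFDerivWithinAt_univ.1 (h1.comp x h2 fun y _ => ⟨ht, mem_univ _⟩)

theorem IsBackgroundFlow.exists_fderiv_bounds {ub : ℝ → R3 → R3} {pb : ℝ → R3 → ℝ}
    (hb : IsBackgroundFlow ub pb) {t : ℝ} (ht : 0 ≤ t) :
    ∃ C : ℝ≥0, (∀ x, ‖fderiv ℝ (ub t) x‖ ≤ C) ∧ LipschitzWith C (fderiv ℝ (ub t)) := by
  obtain ⟨C, hC, hL⟩ := hb.vel_W2.2.2
  have hinr : ‖ContinuousLinearMap.inr ℝ ℝ R3‖ ≤ 1 := ContinuousLinearMap.norm_inr_le_one ..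
  refine ⟨C, fun x => ?_, LipschitzWith.of_dist_le_mul fun x y => ?_⟩
  · rw [(hb.hasFDerivAt ht x).fderiv]
    refine (ContinuousLinearMap.opNorm_comp_le _ _).trans ?_
    exact (mul_le_of_le_one_right (norm_nonneg _) hinr).trans (hC (t, x) ⟨ht, mem_univ _⟩)
  · rw [(hb.hasFDerivAt ht x).fderiv, (hb.hasFDerivAt ht y).fderiv, dist_eq_norm,
      ← ContinuousLinearMap.sub_comp]
    refine (ContinuousLinearMap.opNorm_comp_le _ _).trans ?_
    refine (mul_le_of_le_one_right (norm_nonneg _) hinr).trans ?_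
    have h1 := hL.dist_le_mul (t, x) ⟨ht, mem_univ _⟩ (t, y) ⟨ht, mem_univ _⟩
    rw [dist_eq_norm, Prod.dist_eq, dist_self, max_eq_right dist_nonneg] at h1
    exact h1

theorem IsBackgroundFlow.contDiff {ub : ℝ → R3 → R3} {pb : ℝ → R3 → ℝ}
    (hb : IsBackgroundFlow ub pb) {t : ℝ} (ht : 0 ≤ t) : ContDiff ℝ 1 (ub t) := by
  obtain ⟨C, -, hL⟩ := hb.exists_fderiv_bounds ht
  exact contDiff_one_iff_fderiv.2
    ⟨fun x => (hb.hasFDerivAt ht x).differentiableAt, hL.continuous⟩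

theorem abs_apply_le_norm (v : R3) (a : Fin 3) : |v a| ≤ ‖v‖ := PiLp.norm_apply_le v a

/-- The stress of the background flow is bounded and Lipschitz. -/
theorem IsBackgroundFlow.exists_stress_bounds {ub : ℝ → R3 → R3} {pb : ℝ → R3 → ℝ}
    (hb : IsBackgroundFlow ub pb) {t : ℝ} (ht : 0 ≤ t) :
    ∃ (L : ℝ≥0) (B : ℝ), ∀ a b,
      LipschitzWith L (fun x => stress (jac (ub t) x) (pb t x) a b) ∧
        ∀ x, |stress (jac (ub t) x) (pb t x) a b| ≤ B := by
  obtain ⟨C, hC, hL⟩ := hb.exists_fderiv_bounds ht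
  obtain ⟨D, hD, hDL⟩ := hb.pres_W1
  have hnorm : ∀ (A : R3 →L[ℝ] R3) (a b : Fin 3), |A (basisVec b) a| ≤ ‖A‖ := fun A a b => by
    refine (abs_apply_le_norm _ a).trans ((A.le_opNorm _).trans ?_)
    simp [basisVec]
  have hjac : ∀ a b x, |jac (ub t) x a b| ≤ C := fun a b x =>
    (hnorm (fderiv ℝ (ub t) x) a b).trans (hC x)
  have hjacL : ∀ a b x y, |jac (ub t) x a b - jac (ub t) y a b| ≤ C * dist x y := by
    intro a b x y
    have h1 := hnorm (fderiv ℝ (ub t) x - fderiv ℝ (ub t) y) a b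
    have h2 := hL.dist_le_mul x y
    rw [dist_eq_norm] at h2
    exact h1.trans h2
  have hone : ∀ a b : Fin 3, |(1 : Mat3) a b| ≤ 1 := fun a b => by
    rw [Matrix.one_apply]; split_ifs <;> simp
  have hpL : ∀ x y, |pb t x - pb t y| ≤ D * dist x y := by
    intro x y
    have h1 := hDL.dist_le_mul (t, x) ⟨ht, mem_univ _⟩ (t, y) ⟨ht, mem_univ _⟩
    rw [Prod.dist_eq, dist_self, max_eq_right dist_nonneg] at h1
    exact h1
  have hpB : ∀ x, |pb t x| ≤ D := fun x => hD (t, x) ⟨ht, mem_univ _⟩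
  refine ⟨C + C + D, C + C + D, fun a b => ⟨LipschitzWith.of_dist_le_mul fun x y => ?_,
    fun x => ?_⟩⟩
  · have h3 : |(pb t x - pb t y) * (1 : Mat3) a b| ≤ D * dist x y := by
      rw [abs_mul]
      exact (mul_le_of_le_one_right (abs_nonneg _) (hone a b)).trans (hpL x y)
    rw [Real.dist_eq, stress_apply, stress_apply]
    push_cast
    rw [show jac (ub t) x a b + jac (ub t) x b a - pb t x * (1 : Mat3) a b -
      (jac (ub t) y a b + jac (ub t) y b a - pb t y * (1 : Mat3) a b) =
      (jac (ub t) x a b - jac (ub t) y a b) + (jac (ub t) x b a - jac (ub t) y b a) -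
        (pb t x - pb t y) * (1 : Mat3) a b by ring]
    linarith [abs_sub ((jac (ub t) x a b - jac (ub t) y a b) +
      (jac (ub t) x b a - jac (ub t) y b a)) ((pb t x - pb t y) * (1 : Mat3) a b),
      abs_add_le (jac (ub t) x a b - jac (ub t) y a b) (jac (ub t) x b a - jac (ub t) y b a),
      hjacL a b x y, hjacL b a x y]
  · have h3 : |pb t x * (1 : Mat3) a b| ≤ D := by
      rw [abs_mul]
      exact (mul_le_of_le_one_right (abs_nonneg _) (hone a b)).trans (hpB x)
    rw [stress_apply]
    linarith [abs_sub (jac (ub t) x a b + jac (ub t) x b a) (pb t x * (1 : Mat3) a b),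
      abs_add_le (jac (ub t) x a b) (jac (ub t) x b a), hjac a b x, hjac b a x]

theorem IsOutwardNormal.integrableOn_act {n : R3 → R3} (hn : IsOutwardNormal S n)
    {σ : R3 → Mat3} {L : ℝ≥0} {B : ℝ} (hσ : ∀ a b, LipschitzWith L (fun x => σ x a b))
    (hB : ∀ a b x, |σ x a b| ≤ B) :
    IntegrableOn (fun x => act (σ x) (n x)) (bodyBoundary S) μHE[2] := by
  have h1 : ∀ x, act (σ x) (n x) = ∑ a, (∑ b, n x b * σ x a b) • basisVec a := by
    intro x
    ext a
    simp [act_apply, basisVec_apply, mul_comm]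
  simp only [h1]
  exact integrable_finsetSum _ fun a _ => Integrable.smul_const (integrable_finsetSum _ fun b _ =>
    integrable_mul_of_bounded (hn.integrable_component b)
      (hσ a b).continuous.aestronglyMeasurable (hB a b)) _

/-- The traction of the perturbation flow is the difference of the traction of the total flow and
of the one of the smooth background flow. -/
theorem IsStokesSolution.isTraction_sub {d : Fin N → R3 → R3} {u : R3 → R3} {G : R3 → Mat3}
    {p : R3 → ℝ} (h : IsStokesSolution S d u G p) {n : R3 → R3} (hn : IsOutwardNormal S n)
    {Gb : R3 → Mat3} {pb : R3 → ℝ} {L : ℝ≥0} {B : ℝ}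
    (hL : ∀ a b, LipschitzWith L (fun x => stress (Gb x) (pb x) a b))
    (hB : ∀ a b x, |stress (Gb x) (pb x) a b| ≤ B) {τ : R3 → R3}
    (hτ : HasNormalTrace S (fun x => stress (Gb x + G x) (pb x + p x)) τ) :
    IsTraction S (fun x => stress (G x) (p x))
      (fun x => τ x - act (stress (Gb x) (pb x)) (n x)) := by
  have hact := hn.integrableOn_act hL hB
  refine ⟨h.stress_memLp, hτ.integrable.sub hact, fun a φ hφ hφc => ?_⟩
  obtain ⟨g, hg, hgreen⟩ := hτ.exists_divergence
  have hsplit : ∀ ζ : R3 → ℝ, ContDiff ℝ ∞ ζ → HasCompactSupport ζ →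
      ∑ b, ∫ x in fluidDomain S, stress (Gb x + G x) (pb x + p x) a b *
        fderiv ℝ ζ x (basisVec b) =
      (∑ b, ∫ x in fluidDomain S, stress (Gb x) (pb x) a b * fderiv ℝ ζ x (basisVec b)) +
        ∑ b, ∫ x in fluidDomain S, stress (G x) (p x) a b * fderiv ℝ ζ x (basisVec b) := by
    intro ζ hζ hζc
    rw [← Finset.sum_add_distrib]
    refine Finset.sum_congr rfl fun b _ => ?_
    have c1 := (contDiff_pderiv hζ (basisVec b)).continuous
    have c2 := hζc.fderiv_apply ℝ (basisVec b)
    have i1 : IntegrableOn (fun x => stress (Gb x) (pb x) a b * fderiv ℝ ζ x (basisVec b))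
        (fluidDomain S) :=
      (((hL a b).continuous.mul c1).integrable_of_hasCompactSupport c2.mul_left).integrableOn
    have i2 : IntegrableOn (fun x => stress (G x) (p x) a b * fderiv ℝ ζ x (basisVec b))
        (fluidDomain S) :=
      (h.stress_memLp a b).integrable_mul
        ((c1.memLp_of_hasCompactSupport (p := 2) (μ := volume) c2).restrict _)
    rw [← integral_add i1 i2]
    refine integral_congr_ae (Eventually.of_forall fun x => ?_)
    simp only [stress_apply, Matrix.add_apply]
    ring
  have hlip := hn.green_of_lipschitz (hL a) (hB a) (hg a) (fun ζ hζ hζc hζF => ?_) hφ hφc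
  · have h1 := hgreen a φ hφ hφc
    rw [hsplit φ hφ hφc] at h1
    obtain ⟨C, hC⟩ := hφ.continuous.bounded_above_of_compact_support hφc
    have i1 : IntegrableOn (fun x => τ x a * φ x) (bodyBoundary S) μHE[2] :=
      integrable_mul_of_bounded (integrableOn_component hτ.integrable a)
        hφ.continuous.aestronglyMeasurable hC
    have i2 : IntegrableOn (fun x => act (stress (Gb x) (pb x)) (n x) a * φ x)
        (bodyBoundary S) μHE[2] :=
      integrable_mul_of_bounded (integrableOn_component hact a)
        hφ.continuous.aestronglyMeasurable hC
    have i3 : ∀ b, IntegrableOn (fun x => n x b * φ x * stress (Gb x) (pb x) a b)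
        (bodyBoundary S) μHE[2] := fun b =>
      integrable_mul_of_bounded (integrable_mul_of_bounded (hn.integrable_component b)
        hφ.continuous.aestronglyMeasurable hC) (hL a b).continuous.aestronglyMeasurable (hB a b)
    have h2 : ∑ b, ∫ x in bodyBoundary S, n x b * φ x * stress (Gb x) (pb x) a b ∂μHE[2] =
        ∫ x in bodyBoundary S, act (stress (Gb x) (pb x)) (n x) a * φ x ∂μHE[2] := by
      rw [← integral_finsetSum _ fun b _ => i3 b]
      refine integral_congr_ae (Eventually.of_forall fun x => ?_)
      simp only [act_apply, Finset.sum_mul]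
      exact Finset.sum_congr rfl fun b _ => by ring
    simp only [PiLp.sub_apply, sub_mul]
    rw [integral_sub i1 i2, ← h2, ← hlip, ← h1]
    ring
  · have h1 := hgreen a ζ hζ hζc
    rw [hsplit ζ hζ hζc, h.sum_integral_stress_mul_eq_zero hζ hζc hζF a, add_zero] at h1
    rw [h1]
    refine setIntegral_eq_zero_of_forall_eq_zero fun x hx => ?_
    rw [image_eq_zero_of_notMem_tsupport fun hx' =>
      bodyBoundary_disjoint_fluidDomain hx (hζF hx'), mul_zero]

/-! ### Forces and torques -/

theorem cross_apply_eq_inner (y f : R3) (a : Fin 3) :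
    cross y f a = inner ℝ f (cross (basisVec a) y) := by
  rw [inner_eq_sum, Fin.sum_univ_three]
  fin_cases a <;> simp [cross, basisVec, cross_apply] <;> ring

theorem apply_eq_inner_basisVec (f : R3) (a : Fin 3) : f a = inner ℝ f (basisVec a) := by
  simpa using (inner_smul_basisVec f 1 a).symm

theorem integral_apply {s : Set R3} {f : R3 → R3} {μ : Measure R3} (hf : IntegrableOn f s μ)
    (a : Fin 3) : (∫ x in s, f x ∂μ) a = ∫ x in s, f x a ∂μ :=
  ((EuclideanSpace.proj a : R3 →L[ℝ] ℝ).integral_comp_comm hf).symm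

/-- The components of the resultant force are its powers against the elementary translations. -/
theorem integral_apply_eq_inl {s : Set R3} {f : R3 → R3} {μ : Measure R3} (hf : IntegrableOn f s μ)
    (h : R3) (a : Fin 3) :
    (∫ x in s, f x ∂μ) a = ∫ x in s, inner ℝ (f x) (rigidField h (Sum.inl a) x) ∂μ := by
  rw [integral_apply hf]
  simp only [apply_eq_inner_basisVec, rigidField]

/-- The components of the resultant torque are its powers against the elementary rotations. -/
theorem integral_cross_apply_eq_inr {s : Set R3} (hs : IsCompact s) {f : R3 → R3} {μ : Measure R3}
    (hf : IntegrableOn f s μ) (h : R3) (a : Fin 3) :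
    (∫ x in s, cross (x - h) (f x) ∂μ) a =
      ∫ x in s, inner ℝ (f x) (rigidField h (Sum.inr a) x) ∂μ := by
  have h1 : ∀ x, cross (x - h) (f x) =
      ∑ b, (inner ℝ (f x) (rigidField h (Sum.inr b) x) : ℝ) • basisVec b := by
    intro x
    ext b
    simp [cross_apply_eq_inner, rigidField, basisVec_apply]
  have hi : IntegrableOn (fun x => cross (x - h) (f x)) s μ := by
    simp only [h1]
    exact integrable_finsetSum _ fun b _ => (integrableOn_inner_of_continuous hf hs
      (contDiff_rigidField h (Sum.inr b) (m := 1)).continuous).smul_const _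
  rw [integral_apply hi]
  simp only [cross_apply_eq_inner, rigidField]

theorem archimedesForce_apply (hS : IsRegularConfiguration S) {n : R3 → R3} {u : R3 → R3}
    {p : R3 → ℝ}
    (hact : IntegrableOn (fun x => act (stress (jac u x) (p x)) (n x)) (bodyBoundary S) μHE[2])
    (h : Fin N → R3) (i : Fin N) (α : Dof) :
    archimedesForce S h n u p (i, α) = - ∫ x in frontier (S i),
      inner ℝ (act (stress (jac u x) (p x)) (n x)) (rigidField (h i) α x) ∂μHE[2] := by
  have hi := hact.mono_set (frontier_subset_bodyBoundary i)
  cases α with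
  | inl a => rw [← integral_apply_eq_inl hi]; rfl
  | inr a =>
    rw [← integral_cross_apply_eq_inr (isCompact_frontier_of_closure (hS.isCompact_closure i)) hi]
    rfl

theorem velocityVector_sum_smul (v w h : Fin N → R3) (j : Fin N) (x : R3) :
    ∑ α, velocityVector v w (j, α) • rigidField (h j) α x =
      v j + cross (w j) (x - h j) := by
  rw [sum_smul_rigidField (fun α => velocityVector v w (j, α))]
  rfl

section Faxen

variable {h : Fin N → R3} {V : Fin N → Dof → R3 → R3} {GV : Fin N → Dof → R3 → Mat3}
  {P : Fin N → Dof → R3 → ℝ} {τV : Fin N → Dof → R3 → R3}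

/-- Faxén's law: by reciprocity, the force of the perturbation flow is linear in the velocities
of the filaments and of the background flow. -/
theorem integral_traction_eq (hS : IsRegularConfiguration S)
    (hV : ∀ i α, IsStokesSolution S (fun j x => if i = j then rigidField (h i) α x else 0)
      (V i α) (GV i α) (P i α))
    (hτV : ∀ i α, HasNormalTrace S (fun x => stress (GV i α x) (P i α x)) (τV i α))
    {v w : Fin N → R3} {ub : R3 → R3} (hub : ContDiff ℝ 1 ub) {up : R3 → R3} {Gp : R3 → Mat3}
    {pp : R3 → ℝ}
    (hup : IsStokesSolution S (fun i x => v i + cross (w i) (x - h i) - ub x) up Gp pp)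
    {τp : R3 → R3} (hτp : IsTraction S (fun x => stress (Gp x) (pp x)) τp) (k : Fin N × Dof) :
    ∫ x in frontier (S k.1), inner ℝ (τp x) (rigidField (h k.1) k.2 x) ∂μHE[2] =
      (resistance S h τV *ᵥ velocityVector v w) k - faxenForce S τV ub k := by
  have ht := (hV k.1 k.2).isTraction (hτV k.1 k.2)
  have hcpt : ∀ j, IsCompact (frontier (S j)) := fun j =>
    isCompact_frontier_of_closure (hS.isCompact_closure j)
  have hint : ∀ j (d : R3 → R3), Continuous d →
      IntegrableOn (fun x => inner ℝ (τV k.1 k.2 x) (d x)) (frontier (S j)) μHE[2] :=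
    fun j d hd => integrableOn_inner_of_continuous
      (ht.integrable.mono_set (frontier_subset_bodyBoundary j)) (hcpt j) hd
  rw [← hτp.integral_contract_elementary hS hV, hup.integral_contract_comm (hV k.1 k.2),
    ht.integral_contract hS hup.dotH1
      (fun j => (contDiff_rigid (v j) (w j) (h j) (m := 1)).sub hub) hup.boundary]
  have h1 : ∀ j, ∫ x in frontier (S j), inner ℝ (τV k.1 k.2 x)
      (v j + cross (w j) (x - h j) - ub x) ∂μHE[2] =
      (∑ α, resistance S h τV k (j, α) * velocityVector v w (j, α)) -
        ∫ x in frontier (S j), inner ℝ (τV k.1 k.2 x) (ub x) ∂μHE[2] := by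
    intro j
    have i1 : ∀ α, IntegrableOn (fun x => inner ℝ (τV k.1 k.2 x) (rigidField (h j) α x))
        (frontier (S j)) μHE[2] := fun α => hint j _ (contDiff_rigidField _ _ (m := 1)).continuous
    simp only [inner_sub_right]
    rw [integral_sub (hint j _ (contDiff_rigid _ _ _ (m := 1)).continuous)
      (hint j _ hub.continuous)]
    congr 1
    simp only [← velocityVector_sum_smul v w h j, inner_sum, real_inner_smul_right]
    rw [integral_finsetSum _ fun α _ => (i1 α).const_mul _]
    refine Finset.sum_congr rfl fun α _ => ?_
    rw [integral_const_mul, mul_comm]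
    rfl
  rw [Finset.sum_congr rfl fun j _ => h1 j, Finset.sum_sub_distrib, ← Fintype.sum_prod_type',
    ← hS.integral_bodyBoundary fun j => hint j _ hub.continuous]
  rfl

end Faxen

/-! ### The equations of motion -/

theorem inertiaMatrix_mulVec_inl {N : ℕ} (m : Fin N → ℝ) (J : Fin N → Mat3) (v w : Fin N → R3)
    (i : Fin N) (a : Fin 3) :
    (inertiaMatrix m J *ᵥ velocityVector v w) (i, Sum.inl a) = m i * v i a := by
  simp only [Matrix.mulVec, dotProduct, inertiaMatrix, Matrix.of_apply, Fintype.sum_prod_type]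
  rw [Finset.sum_eq_single i]
  · simp [velocityVector, Matrix.one_apply]
  · intro j _ hj
    simp [Ne.symm hj]
  · simp

theorem inertiaMatrix_mulVec_inr {N : ℕ} (m : Fin N → ℝ) (J : Fin N → Mat3) (v w : Fin N → R3)
    (i : Fin N) (a : Fin 3) :
    (inertiaMatrix m J *ᵥ velocityVector v w) (i, Sum.inr a) = act (J i) (w i) a := by
  simp only [Matrix.mulVec, dotProduct, inertiaMatrix, Matrix.of_apply, Fintype.sum_prod_type]
  rw [Finset.sum_eq_single i]
  · simp [velocityVector, act_apply]
  · intro j _ hj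
    simp [Ne.symm hj]
  · simp

theorem hasDerivWithinAt_R3_iff {f : ℝ → R3} {f' : R3} {s : Set ℝ} {t : ℝ} :
    HasDerivWithinAt f f' s t ↔ ∀ a, HasDerivWithinAt (fun r => f r a) (f' a) s t := by
  rw [hasDerivWithinAt_iff_hasFDerivWithinAt, hasFDerivWithinAt_euclidean]
  refine forall_congr' fun a => ?_
  rw [hasDerivWithinAt_iff_hasFDerivWithinAt]
  refine Iff.of_eq ?_
  congr 1

end Filaments

end

theorem proposition5p3 {N : ℕ}
    -- the reference filaments, their densities and their thickness
    (fil : Fin N → Filament) (ρ : Fin N → ℝ) (hρ : ∀ i, 0 < ρ i)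
    (ε : ℝ) (hε_pos : 0 < ε) (hε_lt : ε < 1) (hembedded : ∀ i, (fil i).IsEmbedded ε)
    -- the background flow
    (ub : ℝ → R3 → R3) (pb : ℝ → R3 → ℝ) (hb : IsBackgroundFlow ub pb)
    -- the motion of the filaments, which remain separated
    (T : ℝ) (h : Fin N → ℝ → R3) (Q : Fin N → ℝ → Mat3) (v w : Fin N → ℝ → R3)
    (hmotion : IsRigidMotion T h Q v w)
    (hsep : ∀ t ∈ Set.Ico 0 T, Separated (bodies fil ε h Q t))
    -- the unit normal pointing outside the fluid
    (n : ℝ → R3 → R3)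
    (hn : ∀ t ∈ Set.Ico 0 T, IsOutwardNormal (bodies fil ε h Q t) (n t))
    -- the perturbation flow, with gradient `Gp`, and the traction `τ` of the total flow
    (up : ℝ → R3 → R3) (Gp : ℝ → R3 → Mat3) (pp : ℝ → R3 → ℝ) (τ : ℝ → R3 → R3)
    (hup : ∀ t ∈ Set.Ico 0 T, IsStokesSolution (bodies fil ε h Q t)
      (fun i x => v i t + cross (w i t) (x - h i t) - ub t x) (up t) (Gp t) (pp t))
    (hτ : ∀ t ∈ Set.Ico 0 T, HasNormalTrace (bodies fil ε h Q t)
      (fun x => stress (jac (ub t) x + Gp t x) (pb t x + pp t x)) (τ t))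
    -- the elementary Stokes flows, with gradients `GV` and tractions `τV`
    (V : ℝ → Fin N → Dof → R3 → R3) (GV : ℝ → Fin N → Dof → R3 → Mat3)
    (P : ℝ → Fin N → Dof → R3 → ℝ) (τV : ℝ → Fin N → Dof → R3 → R3)
    (hV : ∀ t ∈ Set.Ico 0 T, ∀ i α, IsStokesSolution (bodies fil ε h Q t)
      (fun j x => if i = j then rigidField (h i t) α x else 0) (V t i α) (GV t i α) (P t i α))
    (hτV : ∀ t ∈ Set.Ico 0 T, ∀ i α, HasNormalTrace (bodies fil ε h Q t)
      (fun x => stress (GV t i α x) (P t i α x)) (τV t i α)) :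
    ∀ t ∈ Set.Ico 0 T,
      IsUnit (resistance (bodies fil ε h Q t) (fun i => h i t) (τV t)).det ∧
      (NewtonAt fil ρ ε T h Q v w (τ t) t ↔
        CompressedAt fil ρ ε T h Q v w (n t) (τV t) (ub t) (pb t) t) := by
  intro t ht
  have hS : IsRegularConfiguration (bodies fil ε h Q t) :=
    isRegularConfiguration_body fil hembedded (fun i => h i t)
      (fun i => hmotion.rotation i t ht) (hsep t ht)
  have hdet := isUnit_det_resistance (h := fun i => h i t) hS (hV t ht) (hτV t ht)
  refine ⟨hdet, ?_⟩
  obtain ⟨L, B, hLB⟩ := hb.exists_stress_bounds ht.1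
  have hact := (hn t ht).integrableOn_act (fun a b => (hLB a b).1) fun a b => (hLB a b).2
  have htp := (hup t ht).isTraction_sub (hn t ht) (fun a b => (hLB a b).1)
    (fun a b => (hLB a b).2) (hτ t ht)
  have hcpt : ∀ i, IsCompact (frontier (bodies fil ε h Q t i)) := fun i =>
    isCompact_frontier_of_closure (hS.isCompact_closure i)
  have hτi : ∀ i, IntegrableOn (τ t) (frontier (bodies fil ε h Q t i)) μHE[2] := fun i =>
    (hτ t ht).integrable.mono_set (frontier_subset_bodyBoundary i)
  have hm : ∀ i, 0 < (fil i).mass ε (ρ i) := fun i => (fil i).mass_pos (hembedded i) hε_pos (hρ i)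
  -- the generalized forces exerted by the total flow
  have hforce : ∀ k : Fin N × Dof,
      - ∫ x in frontier (bodies fil ε h Q t k.1),
        inner ℝ (τ t x) (rigidField (h k.1 t) k.2 x) ∂μHE[2] =
      (- (resistance (bodies fil ε h Q t) (fun i => h i t) (τV t) *ᵥ
        (velocityVector (fun i => v i t) (fun i => w i t) -
          faxenVelocity (bodies fil ε h Q t) (fun i => h i t) (τV t) (ub t))) +
        archimedesForce (bodies fil ε h Q t) (fun i => h i t) (n t) (ub t) (pb t)) k := by
    rintro ⟨i, α⟩
    have hc := (contDiff_rigidField (h i t) α (m := 1)).continuous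
    have h1 := integral_traction_eq hS (hV t ht) (hτV t ht) (hb.contDiff ht.1) (hup t ht) htp (i, α)
    simp only [inner_sub_left] at h1
    rw [integral_sub (integrableOn_inner_of_continuous (hτi i) (hcpt i) hc)
      (integrableOn_inner_of_continuous (hact.mono_set (frontier_subset_bodyBoundary i))
        (hcpt i) hc)] at h1
    rw [Pi.add_apply, Pi.neg_apply, Matrix.mulVec_sub, Pi.sub_apply, faxenVelocity,
      Matrix.mulVec_mulVec, Matrix.mul_nonsing_inv _ hdet, Matrix.one_mulVec,
      archimedesForce_apply hS hact]
    linarith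
  have hinl : ∀ i a, (- ∫ x in frontier (bodies fil ε h Q t i), τ t x ∂μHE[2]) a =
      - ∫ x in frontier (bodies fil ε h Q t i),
        inner ℝ (τ t x) (rigidField (h i t) (Sum.inl a) x) ∂μHE[2] := fun i a => by
    rw [← integral_apply_eq_inl (hτi i)]; rfl
  have hinr : ∀ i a,
      (- ∫ x in frontier (bodies fil ε h Q t i), cross (x - h i t) (τ t x) ∂μHE[2]) a =
      - ∫ x in frontier (bodies fil ε h Q t i),
        inner ℝ (τ t x) (rigidField (h i t) (Sum.inr a) x) ∂μHE[2] := fun i a => by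
    rw [← integral_cross_apply_eq_inr (hcpt i) (hτi i)]; rfl
  simp only [NewtonAt, CompressedAt]
  constructor
  · intro hN
    choose hN1 hN2 using hN
    choose A hA hAeq using hN1
    choose b hbd hbeq using hN2
    refine ⟨fun k => match k with
      | (i, Sum.inl a) => (fil i).mass ε (ρ i) * A i a
      | (i, Sum.inr a) => b i a, hasDerivWithinAt_pi.2 ?_, funext ?_⟩
    · rintro ⟨i, a | a⟩
      · simp only [inertiaMatrix_mulVec_inl]
        exact (hasDerivWithinAt_R3_iff.1 (hA i) a).const_mul _
      · simp only [inertiaMatrix_mulVec_inr]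
        exact hasDerivWithinAt_R3_iff.1 (hbd i) a
    · rintro ⟨i, a | a⟩
      · rw [← hforce, ← hinl, ← hAeq]
        simp [mul_assoc]
      · rw [← hforce, ← hinr, ← hbeq]
        simp
  · rintro ⟨Z, hZ, hZeq⟩ i
    rw [hasDerivWithinAt_pi] at hZ
    have hZk := fun k => (congrFun hZeq k).trans (hforce k).symm
    refine ⟨⟨WithLp.toLp 2 fun a => ((fil i).mass ε (ρ i))⁻¹ * Z (i, Sum.inl a),
      hasDerivWithinAt_R3_iff.2 fun a => ?_, ?_⟩, ⟨WithLp.toLp 2 fun a => Z (i, Sum.inr a),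
      hasDerivWithinAt_R3_iff.2 fun a => ?_, ?_⟩⟩
    · have h1 := (hZ (i, Sum.inl a)).const_mul ((fil i).mass ε (ρ i))⁻¹
      simp only [inertiaMatrix_mulVec_inl, inv_mul_cancel_left₀ (hm i).ne'] at h1
      exact h1
    · ext a
      rw [hinl, ← hZk (i, Sum.inl a)]
      simp [mul_assoc, (hm i).ne']
    · have h1 := hZ (i, Sum.inr a)
      simp only [inertiaMatrix_mulVec_inr] at h1
      exact h1
    · ext a
      rw [hinr, ← hZk (i, Sum.inr a)]
      simp
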